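/- Let $R$ be a commutative $\mathbf Q$-algebra. An $A_\infty$-category $\mathcal C$ over $R$ consists of objects, $\mathbf Z$-graded $R$-modules $\mathcal C(X,Y)$, and $R$-multilinear maps $m_i:\mathcal C(X_{i-1},X_i)\otimes\cdots\otimes\mathcal C(X_0,X_1)\to\mathcal C(X_0,X_i)$ of degree $2-i$ ($i\ge1$) with $$\sum_{j+k+l=p}(-1)^{jk+l}\,m_{j+1+l}(\mathrm{id}^{\otimes j}\otimes m_k\otimes\mathrm{id}^{\otimes l})=0\qquad\text{for all }p\ge1$$ (Koszul signs; no units are required). It is minimal if $m_1=0$; its cohomology category $\mathrm H\mathcal C$ is then $\mathcal C$ with $m_2$ kept and all other $m_i$ replaced by $0$. For $n\in\{1,2,\dots\}\cup\{\infty\}$ an $A_n$-functor $F:\mathcal C\to\mathcal D$ is a map on objects together with multilinear maps $F_i$ ($1\le i\le n$) of degree $1-i$ such that for all $p\le n$ $$\sum_{j+k+l=p}(-1)^{jk+l}F_{j+1+l}(\mathrm{id}^{\otimes j}\otimes m_k\otimes\mathrm{id}^{\otimes l})=\sum_{i_1+\cdots+i_r=p}(-1)^{s(i_1,\dots,i_r)}m_r(F_{i_1}\otimes\cdots\otimes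 F_{i_r}),$$ with $s(i_1,\dots,i_r)=\sum_{2\le u\le r}(1-i_u)\sum_{1\le v\le u}i_v$. It is a quasi-isomorphism if it is bijective on objects and every $F_1:\mathcal C(X,Y)\to\mathcal D(FX,FY)$ is a quasi-isomorphism with respect to $m_1$. A minimal $A_\infty$-category $\mathcal C$ is $A_n$-formal if there is an $A_n$-quasi-isomorphism $\mathrm H\mathcal C\to\mathcal C$ (equivalently, an $A_n$-isomorphism), and formal if there is such an $A_\infty$-quasi-isomorphism. Let $\overline{\mathrm T}(\mathcal C[1])$ be the reduced tensor cocategory, graded by the shifted degree, and by weight (tensor length). Let $d$ be the degree $1$ coderivation with components $d_i=-s\circ m_i\circ(s^{-1})^{\otimes i}$, where $s:\mathcal C\to\mathcal C[1]$ is the canonical degree $-1$ map; then $d^2=0$. Let $\mathrm{CC}(\mathcal C)=\mathrm{coDer}(1)$ be the complex of coderivations of $\overline{\mathrm T}(\mathcal C[1])$ along the identity, with differential $[d,-]$, and let $W_n\mathrm{coDer}(1)$ be the subcomplex of coderivations vanishing on weights $\le n-1$. Write $W_2\mathrm{HH}^2(\mathcal C)=\mathrm H^1(W_2\mathrm{coDer}(1))$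 for the second cohomology of the subcomplex $W_2$ (there is a shift by one in degree). For minimal $\mathcal C$, the Kaledin class $k_{\mathcal C}\in W_2\mathrm{HH}^2(\mathcal C)$ is the class of the coderivation with components $\sum_{i\ge3}(i-2)d_i=d_3+2d_4+\cdots$, and the truncated Kaledin class $k_{\mathcal C}^{\le n}$ is its image in $\mathrm H^1\big(W_2\mathrm{coDer}(1)/W_{n+1}\mathrm{coDer}(1)\big)$. **Theorem.** Let $\mathcal C$ be a minimal $A_\infty$-category over a commutative $\mathbf Q$-algebra $R$. The following are equivalent: 1. $\mathcal C$ is formal; 2. $\mathcal C$ is $A_n$-formal for all $n\ge1$; 3. for all $n\ge3$, the truncated Kaledin class $k_{\mathcal C}^{\le n}$ vanishes; 4. the Kaledin class $k_{\mathcal C}$ vanishes. -/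

import Mathlib

open scoped DirectSum TensorProduct

universe u v w

noncomputable section

/-- A graded `R`-quiver (graph): a type of objects and, for every two objects `X`, `Y`, a
`ℤ`-graded `R`-module of morphisms, given by its homogeneous pieces `Hom X Y p`. -/
structure GradedQuiver (R : Type u) [CommRing R] where
  Ob : Type v
  Hom : Ob → Ob → ℤ → Type w
  [acg : ∀ X Y p, AddCommGroup (Hom X Y p)]
  [mod : ∀ X Y p, Module R (Hom X Y p)]

attribute [instance] GradedQuiver.acg GradedQuiver.mod

namespace GradedQuiver

variable {R : Type u} [CommRing R]

/-- The graded module of morphisms `𝒞(X, Y) = ⨁ p, 𝒞^p(X, Y)`. -/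
abbrev Mor (Q : GradedQuiver.{u, v, w} R) (X Y : Q.Ob) : Type w := ⨁ p : ℤ, Q.Hom X Y p

/-- The homogeneous elements of degree `p`. -/
def gr (Q : GradedQuiver.{u, v, w} R) (X Y : Q.Ob) (p : ℤ) : Submodule R (Q.Mor X Y) :=
  LinearMap.range (DirectSum.lof R ℤ (fun p => Q.Hom X Y p) p)

/-- The linear map `f ↦ (-1) ^ (a * (|f| + c)) f`. -/
def signMap (Q : GradedQuiver.{u, v, w} R) (c a : ℤ) (X Y : Q.Ob) :
    Q.Mor X Y →ₗ[R] Q.Mor X Y :=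
  DirectSum.lmap fun p : ℤ =>
    (((a * (p + c)).negOnePow : ℤˣ) : ℤ) • (LinearMap.id : Q.Hom X Y p →ₗ[R] Q.Hom X Y p)

/-- Composable strings of morphisms `X = X₀ → X₁ → ⋯ → Xₙ = Y`, written from left to right as
`f₁ ⊗ ⋯ ⊗ fₙ` with `f₁ ∈ 𝒞(Xₙ₋₁, Xₙ)`, …, `fₙ ∈ 𝒞(X₀, X₁)`. -/
inductive Str (Q : GradedQuiver.{u, v, w} R) (X : Q.Ob) : Q.Ob → Type (max v w)
  | nil : Str Q X X
  | cons {Y Z : Q.Ob} (f : Q.Mor Y Z) (t : Str Q X Y) : Str Q X Z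

namespace Str

variable {Q : GradedQuiver.{u, v, w} R}

/-- The number of morphisms in a string. -/
def length {X : Q.Ob} : {Y : Q.Ob} → Str Q X Y → ℕ
  | _, nil => 0
  | _, cons _ t => length t + 1

/-- Concatenation of strings. -/
def append {X Y : Q.Ob} : {Z : Q.Ob} → Str Q Y Z → Str Q X Y → Str Q X Z
  | _, nil, t => t
  | _, cons f s, t => cons f (append s t)

/-- The string consisting of one morphism. -/
def single {X Y : Q.Ob} (f : Q.Mor X Y) : Str Q X Y := cons f nil

/-- Apply an endomorphism of each morphism module to all entries of a string. -/
def map (e : ∀ X Y : Q.Ob, Q.Mor X Y →ₗ[R] Q.Mor X Y) {X : Q.Ob} :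
    {Y : Q.Ob} → Str Q X Y → Str Q X Y
  | _, nil => nil
  | _, cons f t => cons (e _ _ f) (map e t)

/-- `s.HasDeg q`: all entries of `s` are homogeneous, and their degrees add up to `q`. -/
inductive HasDeg : {X Y : Q.Ob} → Str Q X Y → ℤ → Prop
  | nil (X : Q.Ob) : HasDeg (Str.nil : Str Q X X) 0
  | cons {X Y Z : Q.Ob} {f : Q.Mor Y Z} {t : Str Q X Y} {p q : ℤ} :
      f ∈ Q.gr Y Z p → HasDeg t q → HasDeg (Str.cons f t) (p + q)

/-- All ways to write a string as a concatenation `s = a ⊗ b` (with `a` or `b` possibly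
empty). -/
def splits {X : Q.Ob} : {Z : Q.Ob} → Str Q X Z → List (Σ Y : Q.Ob, Str Q Y Z × Str Q X Y)
  | _, nil => [⟨X, nil, nil⟩]
  | _, cons f t => ⟨_, nil, cons f t⟩ :: (splits t).map fun s => ⟨s.1, cons f s.2.1, s.2.2⟩

/-- The sum of `g a b` over all ways to write `s = a ⊗ b`. -/
def sum₂ {M : Type*} [AddCommMonoid M] {X Z : Q.Ob} (s : Str Q X Z)
    (g : ∀ Y : Q.Ob, Str Q Y Z → Str Q X Y → M) : M :=
  ((splits s).map fun r => g r.1 r.2.1 r.2.2).sum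

/-- The sum of `g a b c` over all ways to write `s = a ⊗ b ⊗ c`. -/
def sum₃ {M : Type*} [AddCommMonoid M] {X Z : Q.Ob} (s : Str Q X Z)
    (g : ∀ Y Y' : Q.Ob, Str Q Y' Z → Str Q Y Y' → Str Q X Y → M) : M :=
  s.sum₂ fun Y' a r => r.sum₂ fun Y b c => g Y Y' a b c

/-- A function on composable strings from `X` to `Y` is multilinear if it is linear in every
entry of the string: it is a family of `R`-linear maps on the tensor products
`𝒞(Xₙ₋₁, Xₙ) ⊗ ⋯ ⊗ 𝒞(X₀, X₁)`. -/
structure IsMultilinear {M : Type*} [AddCommGroup M] [Module R M] {X Y : Q.Ob}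
    (φ : Str Q X Y → M) : Prop where
  map_add : ∀ {Z W : Q.Ob} (a : Str Q W Y) (f g : Q.Mor Z W) (b : Str Q X Z),
    φ (a.append (cons (f + g) b)) = φ (a.append (cons f b)) + φ (a.append (cons g b))
  map_smul : ∀ {Z W : Q.Ob} (a : Str Q W Y) (r : R) (f : Q.Mor Z W) (b : Str Q X Z),
    φ (a.append (cons (r • f) b)) = r • φ (a.append (cons f b))

/-! Elementary facts about strings. -/

@[simp] lemma length_nil (X : Q.Ob) : (nil : Str Q X X).length = 0 := rfl

@[simp] lemma length_cons {X Y Z : Q.Ob} (f : Q.Mor Y Z) (t : Str Q X Y) :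
    (cons f t).length = t.length + 1 := rfl

@[simp] lemma nil_append {X Y : Q.Ob} (t : Str Q X Y) : (nil : Str Q Y Y).append t = t := rfl

@[simp] lemma cons_append {X Y Z W : Q.Ob} (f : Q.Mor Z W) (s : Str Q Y Z) (t : Str Q X Y) :
    (cons f s).append t = cons f (s.append t) := rfl

@[simp] lemma length_append {X Y Z : Q.Ob} (s : Str Q Y Z) (t : Str Q X Y) :
    (s.append t).length = s.length + t.length := by
  induction s with
  | nil => simp
  | cons f s ih => simp [ih]; omega

lemma append_assoc {X Y Z W : Q.Ob} (r : Str Q Z W) (s : Str Q Y Z) (t : Str Q X Y) :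
    (r.append s).append t = r.append (s.append t) := by
  induction r with
  | nil => rfl
  | cons f r ih => simp [ih]

@[simp] lemma map_nil (e : ∀ X Y : Q.Ob, Q.Mor X Y →ₗ[R] Q.Mor X Y) (X : Q.Ob) :
    map e (nil : Str Q X X) = nil := rfl

@[simp] lemma map_cons (e : ∀ X Y : Q.Ob, Q.Mor X Y →ₗ[R] Q.Mor X Y) {X Y Z : Q.Ob}
    (f : Q.Mor Y Z) (t : Str Q X Y) : map e (cons f t) = cons (e _ _ f) (map e t) := rfl

@[simp] lemma map_append (e : ∀ X Y : Q.Ob, Q.Mor X Y →ₗ[R] Q.Mor X Y) {X Y Z : Q.Ob}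
    (s : Str Q Y Z) (t : Str Q X Y) : map e (s.append t) = (map e s).append (map e t) := by
  induction s with
  | nil => rfl
  | cons f s ih => simp [ih]

@[simp] lemma length_map (e : ∀ X Y : Q.Ob, Q.Mor X Y →ₗ[R] Q.Mor X Y) {X Y : Q.Ob}
    (s : Str Q X Y) : (map e s).length = s.length := by
  induction s with
  | nil => rfl
  | cons f s ih => simp [ih]

lemma sum₂_cons {M : Type*} [AddCommMonoid M] {X Y Z : Q.Ob} (f : Q.Mor Y Z) (t : Str Q X Y)
    (g : ∀ Y : Q.Ob, Str Q Y Z → Str Q X Y → M) :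
    (cons f t).sum₂ g = g _ nil (cons f t) + t.sum₂ fun W a b => g W (cons f a) b := by
  simp [sum₂, splits, Function.comp_def]

lemma sum₂_congr {M : Type*} [AddCommMonoid M] {X Z : Q.Ob} (s : Str Q X Z)
    {g g' : ∀ Y : Q.Ob, Str Q Y Z → Str Q X Y → M}
    (h : ∀ (Y : Q.Ob) (a : Str Q Y Z) (b : Str Q X Y), a.append b = s → g Y a b = g' Y a b) :
    s.sum₂ g = s.sum₂ g' := by
  induction s with
  | nil => simpa [sum₂, splits] using h X nil nil rfl
  | cons f t ih =>
    rw [sum₂_cons, sum₂_cons, h _ nil (cons f t) rfl]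
    congr 1
    exact ih fun W a b hab => h W (cons f a) b (by simp [hab])

lemma sum₃_congr {M : Type*} [AddCommMonoid M] {X Z : Q.Ob} (s : Str Q X Z)
    {g g' : ∀ Y Y' : Q.Ob, Str Q Y' Z → Str Q Y Y' → Str Q X Y → M}
    (h : ∀ (Y Y' : Q.Ob) (a : Str Q Y' Z) (b : Str Q Y Y') (c : Str Q X Y),
      a.append (b.append c) = s → g Y Y' a b c = g' Y Y' a b c) :
    s.sum₃ g = s.sum₃ g' := by
  refine sum₂_congr s fun Y' a r hr => sum₂_congr r fun Y b c hbc => h Y Y' a b c ?_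
  rw [hbc, hr]

lemma sum₂_zero {M : Type*} [AddCommMonoid M] {X Z : Q.Ob} (s : Str Q X Z) :
    (s.sum₂ fun _ _ _ => (0 : M)) = 0 := by
  simp [sum₂]

lemma sum₃_zero {M : Type*} [AddCommMonoid M] {X Z : Q.Ob} (s : Str Q X Z) :
    (s.sum₃ fun _ _ _ _ _ => (0 : M)) = 0 := by
  simp [sum₃, sum₂_zero]

namespace IsMultilinear

variable {M N : Type*} [AddCommGroup M] [Module R M] [AddCommGroup N] [Module R N]

lemma cons_left {X Y Z : Q.Ob} {φ : Str Q X Z → M} (h : IsMultilinear φ) (f : Q.Mor Y Z) :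
    IsMultilinear fun t : Str Q X Y => φ (cons f t) where
  map_add a f' g b := h.map_add (cons f a) f' g b
  map_smul a r f' b := h.map_smul (cons f a) r f' b

lemma head_add {X Y Z : Q.Ob} {φ : Str Q X Z → M} (h : IsMultilinear φ) (f g : Q.Mor Y Z)
    (t : Str Q X Y) : φ (cons (f + g) t) = φ (cons f t) + φ (cons g t) :=
  h.map_add nil f g t

lemma head_smul {X Y Z : Q.Ob} {φ : Str Q X Z → M} (h : IsMultilinear φ) (r : R) (f : Q.Mor Y Z)
    (t : Str Q X Y) : φ (cons (r • f) t) = r • φ (cons f t) :=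
  h.map_smul nil r f t

lemma append_left {X Y Z : Q.Ob} {φ : Str Q X Z → M} (h : IsMultilinear φ) (a : Str Q Y Z) :
    IsMultilinear fun t : Str Q X Y => φ (a.append t) where
  map_add a' f g b := by simpa [append_assoc] using h.map_add (a.append a') f g b
  map_smul a' r f b := by simpa [append_assoc] using h.map_smul (a.append a') r f b

lemma append_right {X Y Z : Q.Ob} {φ : Str Q X Z → M} (h : IsMultilinear φ) (b : Str Q X Y) :
    IsMultilinear fun t : Str Q Y Z => φ (t.append b) where
  map_add a f g b' := by simpa [append_assoc] using h.map_add a f g (b'.append b)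
  map_smul a r f b' := by simpa [append_assoc] using h.map_smul a r f (b'.append b)

lemma comp_map {X Y : Q.Ob} {φ : Str Q X Y → M} (h : IsMultilinear φ)
    (e : ∀ X Y : Q.Ob, Q.Mor X Y →ₗ[R] Q.Mor X Y) :
    IsMultilinear fun t : Str Q X Y => φ (map e t) where
  map_add a f g b := by simpa using h.map_add (map e a) (e _ _ f) (e _ _ g) (map e b)
  map_smul a r f b := by simpa using h.map_smul (map e a) r (e _ _ f) (map e b)

lemma linear_comp {X Y : Q.Ob} {φ : Str Q X Y → M} (h : IsMultilinear φ) (l : M →ₗ[R] N) :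
    IsMultilinear fun t : Str Q X Y => l (φ t) where
  map_add a f g b := by rw [h.map_add, _root_.map_add]
  map_smul a r f b := by rw [h.map_smul, _root_.map_smul]

/-- A sum over splittings is multilinear if the summand is multilinear in both parts. -/
lemma sum₂ {X Z : Q.Ob} {g : ∀ Y : Q.Ob, Str Q Y Z → Str Q X Y → M}
    (h₁ : ∀ (Y : Q.Ob) (b : Str Q X Y), IsMultilinear fun a => g Y a b)
    (h₂ : ∀ (Y : Q.Ob) (a : Str Q Y Z), IsMultilinear fun b => g Y a b) :
    IsMultilinear fun s : Str Q X Z => s.sum₂ g where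
  map_add {W' W} a f f' b := by
    induction a with
    | nil =>
      simp only [nil_append, sum₂_cons]
      have e : (b.sum₂ fun W a c => g W (cons (f + f') a) c)
          = (b.sum₂ fun W a c => g W (cons f a) c)
            + b.sum₂ fun W a c => g W (cons f' a) c := by
        simp only [Str.sum₂]
        rw [← List.sum_map_add]
        congr 1
        refine List.map_congr_left fun r _ => ?_
        exact (h₁ r.1 r.2.2).head_add f f' r.2.1
      rw [e, (h₂ _ nil).head_add]
      abel
    | cons k a ih =>
      simp only [cons_append, sum₂_cons]
      rw [ih (fun Y c => (h₁ Y c).cons_left k) (fun Y c => h₂ Y (cons k c)),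
        ((h₂ _ nil).cons_left k).map_add]
      abel
  map_smul {W' W} a r f b := by
    induction a with
    | nil =>
      simp only [nil_append, sum₂_cons]
      have e : (b.sum₂ fun W a c => g W (cons (r • f) a) c)
          = r • (b.sum₂ fun W a c => g W (cons f a) c) := by
        simp only [Str.sum₂]
        rw [List.smul_sum, List.map_map]
        congr 1
        refine List.map_congr_left fun q _ => ?_
        exact (h₁ q.1 q.2.2).head_smul r f q.2.1
      rw [e, (h₂ _ nil).head_smul, smul_add]
    | cons k a ih =>
      simp only [cons_append, sum₂_cons]
      rw [ih (fun Y c => (h₁ Y c).cons_left k) (fun Y c => h₂ Y (cons k c)),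
        ((h₂ _ nil).cons_left k).map_smul, smul_add]

lemma sum₃ {X Z : Q.Ob} {g : ∀ Y Y' : Q.Ob, Str Q Y' Z → Str Q Y Y' → Str Q X Y → M}
    (h₁ : ∀ (Y Y' : Q.Ob) (b : Str Q Y Y') (c : Str Q X Y), IsMultilinear fun a => g Y Y' a b c)
    (h₂ : ∀ (Y Y' : Q.Ob) (a : Str Q Y' Z) (c : Str Q X Y), IsMultilinear fun b => g Y Y' a b c)
    (h₃ : ∀ (Y Y' : Q.Ob) (a : Str Q Y' Z) (b : Str Q Y Y'), IsMultilinear fun c => g Y Y' a b c) :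
    IsMultilinear fun s : Str Q X Z => s.sum₃ g := by
  refine IsMultilinear.sum₂ (fun Y' r => ?_)
    (fun Y' a => IsMultilinear.sum₂ (fun Y c => h₂ Y Y' a c) fun Y b => h₃ Y Y' a b)
  constructor
  · intro Z' W a f f' b
    simp only [Str.sum₂]
    rw [← List.sum_map_add]
    congr 1
    exact List.map_congr_left fun q _ => (h₁ q.1 Y' q.2.1 q.2.2).map_add a f f' b
  · intro Z' W a s f b
    simp only [Str.sum₂]
    rw [List.smul_sum, List.map_map]
    congr 1
    exact List.map_congr_left fun q _ => (h₁ q.1 Y' q.2.1 q.2.2).map_smul a s f b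

end IsMultilinear

/-- Decompositions of a string into consecutive blocks `v₁ ⊗ ⋯ ⊗ vᵣ`. -/
inductive Blocks (Q : GradedQuiver.{u, v, w} R) (X : Q.Ob) : Q.Ob → Type (max v w)
  | nil : Blocks Q X X
  | cons {Y Z : Q.Ob} (a : Str Q Y Z) (B : Blocks Q X Y) : Blocks Q X Z

/-- All decompositions of a string into consecutive nonempty blocks: the first entry either is a
block of its own or belongs to the first block of a decomposition of the rest. -/
def blockings {X : Q.Ob} : {Z : Q.Ob} → Str Q X Z → List (Blocks Q X Z)
  | _, nil => [Blocks.nil]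
  | _, cons f t => (blockings t).flatMap fun B =>
      Blocks.cons (single f) B ::
        (match B, f with
          | Blocks.nil, _ => []
          | Blocks.cons a B', f => [Blocks.cons (cons f a) B'])

namespace Blocks

/-- `∑ᵤ (iᵤ + 1)`, which has the parity of `∑ᵤ (1 - iᵤ)`; `iᵤ` are the lengths of the blocks. -/
def deg {X : Q.Ob} : {Z : Q.Ob} → Blocks Q X Z → ℕ
  | _, nil => 0
  | _, cons a B => (a.length + 1) + deg B

/-- A number with the parity of `s(i₁, …, iᵣ) = ∑_{2 ≤ u ≤ r} (1 - iᵤ) ∑_{1 ≤ v ≤ u} iᵥ`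
(the terms with `v = u` are even). -/
def sgn {X : Q.Ob} : {Z : Q.Ob} → Blocks Q X Z → ℕ
  | _, nil => 0
  | _, cons a B => a.length * deg B + sgn B

/-- The string `(F_{i₁} ⊗ ⋯ ⊗ F_{iᵣ})(v₁ ⊗ ⋯ ⊗ vᵣ)` for maps `Fᵢ` of degree `1 - i`, with the
Koszul sign: each entry `x` of `vₐ` contributes `(-1) ^ (|x| (1 - iᵤ))` for every `u > a`. -/
def image {Q' : GradedQuiver.{u, v, w} R} (obj : Q.Ob → Q'.Ob)
    (F : ∀ {X Y : Q.Ob}, Str Q X Y → Q'.Mor (obj X) (obj Y)) {X : Q.Ob} :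
    {Z : Q.Ob} → Blocks Q X Z → Str Q' (obj X) (obj Z)
  | _, nil => Str.nil
  | _, cons a B => Str.cons (F (a.map (Q.signMap 0 B.deg))) (image obj F B)

end Blocks

/-- The image of `s₁ ⊗ ⋯ ⊗ sₙ` in `𝒞[1]^{⊗ n}` under `(s⁻¹)^{⊗ n}`, where `s : 𝒞 → 𝒞[1]` is the
degree `-1` identification of underlying modules: the `a`-th entry `x` is multiplied by
`(-1) ^ ((n - a) (|x| - 1))`. -/
def desuspend {X : Q.Ob} : {Y : Q.Ob} → Str Q X Y → Str Q X Y
  | _, nil => nil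
  | _, cons f t => cons (Q.signMap (-1) t.length _ _ f) (desuspend t)

@[simp] lemma length_desuspend {X Y : Q.Ob} (s : Str Q X Y) : s.desuspend.length = s.length := by
  induction s with
  | nil => rfl
  | cons f s ih => simp [desuspend, ih]

/-- Desuspension of a concatenation: the entries of the left part get further signs. -/
lemma desuspend_append_cons {X Y Z W : Q.Ob} (s : Str Q Z W) (t : Str Q X Y) :
    ∃ s' : Str Q Z W, ∀ f' : Q.Mor Y Z, (s.append (cons f' t)).desuspend
      = s'.append (cons (Q.signMap (-1) t.length _ _ f') t.desuspend) := by
  induction s with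
  | nil => exact ⟨nil, fun f' => rfl⟩
  | cons g s ih =>
    obtain ⟨s', hs'⟩ := ih
    refine ⟨cons (Q.signMap (-1) (s.length + (t.length + 1) : ℕ) _ _ g) s', fun f' => ?_⟩
    simp [desuspend, hs']

lemma IsMultilinear.comp_desuspend {M : Type*} [AddCommGroup M] [Module R M] {X Y : Q.Ob}
    {φ : Str Q X Y → M} (h : IsMultilinear φ) :
    IsMultilinear fun t : Str Q X Y => φ t.desuspend where
  map_add a f g b := by
    obtain ⟨a', ha'⟩ := desuspend_append_cons a b
    simp only [ha', _root_.map_add, h.map_add]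
  map_smul a r f b := by
    obtain ⟨a', ha'⟩ := desuspend_append_cons a b
    simp only [ha', _root_.map_smul, h.map_smul]

end Str

/-! ### The reduced tensor cocategory of the shifted quiver

The underlying modules of `𝒞[1]` are those of `𝒞`; a morphism of degree `p` in `𝒞` has degree
`p - 1` in `𝒞[1]`. -/

variable (Q : GradedQuiver.{u, v, w} R)

/-- The relations of multilinearity, together with the vanishing of the empty strings. -/
def tensorRel (X Y : Q.Ob) : Submodule R (Str Q X Y →₀ R) :=
  Submodule.span R
    ({x | ∃ (Z W : Q.Ob) (a : Str Q W Y) (f g : Q.Mor Z W) (b : Str Q X Z),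
        x = Finsupp.single (a.append (Str.cons (f + g) b)) 1
          - (Finsupp.single (a.append (Str.cons f b)) 1
            + Finsupp.single (a.append (Str.cons g b)) 1)} ∪
     {x | ∃ (Z W : Q.Ob) (a : Str Q W Y) (r : R) (f : Q.Mor Z W) (b : Str Q X Z),
        x = Finsupp.single (a.append (Str.cons (r • f) b)) 1
          - r • Finsupp.single (a.append (Str.cons f b)) 1} ∪
     {x | ∃ s : Str Q X Y, s.length = 0 ∧ x = Finsupp.single s 1})

/-- The reduced tensor cocategory
`T̄𝒞[1](X, Y) = ⨁_{n ≥ 1} ⨁_{X = X₀, …, Xₙ = Y} 𝒞(Xₙ₋₁, Xₙ)[1] ⊗ ⋯ ⊗ 𝒞(X₀, X₁)[1]`: the module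
generated by the nonempty composable strings from `X` to `Y`, modulo multilinearity. -/
def TBar (X Y : Q.Ob) : Type (max u v w) := (Str Q X Y →₀ R) ⧸ Q.tensorRel X Y

instance (X Y : Q.Ob) : AddCommGroup (Q.TBar X Y) :=
  inferInstanceAs (AddCommGroup ((Str Q X Y →₀ R) ⧸ Q.tensorRel X Y))

instance (X Y : Q.Ob) : Module R (Q.TBar X Y) :=
  inferInstanceAs (Module R ((Str Q X Y →₀ R) ⧸ Q.tensorRel X Y))

variable {Q}

/-- The quotient map from the free module on the composable strings. -/
def TBar.mk (X Y : Q.Ob) : (Str Q X Y →₀ R) →ₗ[R] Q.TBar X Y := (Q.tensorRel X Y).mkQ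

lemma TBar.mk_eq_zero {X Y : Q.Ob} {x : Str Q X Y →₀ R} (hx : x ∈ Q.tensorRel X Y) :
    TBar.mk X Y x = 0 :=
  (Submodule.Quotient.mk_eq_zero _).2 hx

/-- The pure tensor `f₁ ⊗ ⋯ ⊗ fₙ` of a string (zero for an empty string). -/
def tprod {X Y : Q.Ob} (s : Str Q X Y) : Q.TBar X Y := TBar.mk X Y (Finsupp.single s 1)

lemma tprod_of_length_eq_zero {X Y : Q.Ob} (s : Str Q X Y) (h : s.length = 0) :
    (tprod s : Q.TBar X Y) = 0 :=
  TBar.mk_eq_zero (Submodule.subset_span (Or.inr ⟨s, h, rfl⟩))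

lemma isMultilinear_tprod (X Y : Q.Ob) :
    Str.IsMultilinear (fun s : Str Q X Y => (tprod s : Q.TBar X Y)) where
  map_add a f g b := by
    simp only [tprod]
    rw [← _root_.map_add, ← sub_eq_zero, ← map_sub]
    exact TBar.mk_eq_zero (Submodule.subset_span (Or.inl (Or.inl ⟨_, _, a, f, g, b, rfl⟩)))
  map_smul a r f b := by
    simp only [tprod]
    rw [← _root_.map_smul, ← sub_eq_zero, ← map_sub]
    exact TBar.mk_eq_zero (Submodule.subset_span (Or.inl (Or.inr ⟨_, _, a, r, f, b, rfl⟩)))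

/-- The linear map on the tensor cocategory determined by its values on pure tensors. -/
def TBar.lift {M : Type*} [AddCommGroup M] [Module R M] {X Y : Q.Ob} (φ : Str Q X Y → M)
    (h : Str.IsMultilinear φ) (h₀ : ∀ s : Str Q X Y, s.length = 0 → φ s = 0) :
    Q.TBar X Y →ₗ[R] M :=
  (Q.tensorRel X Y).liftQ (Finsupp.linearCombination R φ) (by
    rw [tensorRel, Submodule.span_le]
    rintro x ((⟨Z, W, a, f, g, b, rfl⟩ | ⟨Z, W, a, r, f, b, rfl⟩) | ⟨s, hs, rfl⟩)
    · simp [h.map_add]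
    · simp [h.map_smul]
    · simp [h₀ s hs])

@[simp] lemma TBar.lift_tprod {M : Type*} [AddCommGroup M] [Module R M] {X Y : Q.Ob}
    (φ : Str Q X Y → M) (h : Str.IsMultilinear φ)
    (h₀ : ∀ s : Str Q X Y, s.length = 0 → φ s = 0) (s : Str Q X Y) :
    TBar.lift φ h h₀ (tprod s) = φ s :=
  ((Q.tensorRel X Y).liftQ_apply _ _).trans (by simp)

variable (Q)

/-- The submodule of elements of weight (tensor length) at most `n`. -/
def weightLE (n : ℕ) (X Y : Q.Ob) : Submodule R (Q.TBar X Y) :=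
  Submodule.span R {x | ∃ s : Str Q X Y, s.length ≤ n ∧ x = tprod s}

/-- The elements of internal degree `q` of the tensor cocategory of `𝒞[1]`. -/
def tensorDeg (q : ℤ) (X Y : Q.Ob) : Submodule R (Q.TBar X Y) :=
  Submodule.span R {x | ∃ (s : Str Q X Y) (p : ℤ), s.HasDeg p ∧ p - s.length = q ∧ x = tprod s}

/-- `x ↦ (-1) ^ (a |x|) x` on the tensor cocategory of `𝒞[1]`. -/
def tensorSign (a : ℤ) (X Y : Q.Ob) : Q.TBar X Y →ₗ[R] Q.TBar X Y :=
  TBar.lift (fun s => tprod (s.map (Q.signMap (-1) a)))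
    ((isMultilinear_tprod X Y).comp_map _)
    (fun s hs => tprod_of_length_eq_zero _ (by simpa using hs))

open Classical in
/-- The comultiplication, by deconcatenation:
`f₁ ⊗ ⋯ ⊗ fₙ ↦ ∑_{0 < i < n} (f₁ ⊗ ⋯ ⊗ fᵢ) ⊗ (fᵢ₊₁ ⊗ ⋯ ⊗ fₙ)`. -/
def comul (X Y : Q.Ob) : Q.TBar X Y →ₗ[R] ⨁ Z : Q.Ob, Q.TBar Z Y ⊗[R] Q.TBar X Z :=
  TBar.lift
    (fun s => s.sum₂ fun Z a b =>
      DirectSum.lof R Q.Ob (fun Z => Q.TBar Z Y ⊗[R] Q.TBar X Z) Z (tprod a ⊗ₜ[R] tprod b))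
    (Str.IsMultilinear.sum₂
      (fun Z b => (isMultilinear_tprod Z Y).linear_comp
        (DirectSum.lof R Q.Ob (fun Z => Q.TBar Z Y ⊗[R] Q.TBar X Z) Z ∘ₗ
          (TensorProduct.mk R (Q.TBar Z Y) (Q.TBar X Z)).flip (tprod b)))
      (fun Z a => (isMultilinear_tprod X Z).linear_comp
        (DirectSum.lof R Q.Ob (fun Z => Q.TBar Z Y ⊗[R] Q.TBar X Z) Z ∘ₗ
          TensorProduct.mk R (Q.TBar Z Y) (Q.TBar X Z) (tprod a))))
    (fun s hs => by
      cases s with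
      | nil =>
        simp [Str.sum₂, Str.splits, tprod_of_length_eq_zero (Str.nil : Str Q X X) rfl]
      | cons f t => simp at hs)

/-- Families of endomorphisms of the modules `T̄𝒞[1](X, Y)`. -/
abbrev TEnd : Type (max u v w) := ∀ X Y : Q.Ob, Q.TBar X Y →ₗ[R] Q.TBar X Y

/-- `coDer^p(1)`: the coderivations of degree `p` of the tensor cocategory of `𝒞[1]` along the
identity cofunctor, `Δ ∘ D = (1 ⊗ D + D ⊗ 1) ∘ Δ`, where `1 ⊗ D` carries the Koszul sign
`(1 ⊗ D)(x ⊗ y) = (-1) ^ (p |x|) x ⊗ D y`. -/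
def coDer (p : ℤ) : Submodule R Q.TEnd where
  carrier := {D |
    (∀ (q : ℤ) (X Y : Q.Ob), ∀ x ∈ Q.tensorDeg q X Y, D X Y x ∈ Q.tensorDeg (q + p) X Y) ∧
    ∀ X Y : Q.Ob, Q.comul X Y ∘ₗ D X Y =
      (DirectSum.lmap fun Z : Q.Ob =>
        TensorProduct.map (Q.tensorSign p Z Y) (D X Z)
          + TensorProduct.map (D Z Y) LinearMap.id) ∘ₗ Q.comul X Y}
  add_mem' := by
    rintro D E ⟨hD, hD'⟩ ⟨hE, hE'⟩
    refine ⟨fun q X Y x hx => add_mem (hD q X Y x hx) (hE q X Y x hx), fun X Y => ?_⟩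
    have e : (DirectSum.lmap fun Z : Q.Ob =>
          TensorProduct.map (Q.tensorSign p Z Y) ((D + E) X Z)
            + TensorProduct.map ((D + E) Z Y) (LinearMap.id : Q.TBar X Z →ₗ[R] Q.TBar X Z))
        = (DirectSum.lmap fun Z : Q.Ob =>
            TensorProduct.map (Q.tensorSign p Z Y) (D X Z)
              + TensorProduct.map (D Z Y) LinearMap.id)
          + DirectSum.lmap fun Z : Q.Ob =>
            TensorProduct.map (Q.tensorSign p Z Y) (E X Z)
              + TensorProduct.map (E Z Y) LinearMap.id := by
      classical
      refine DirectSum.linearMap_ext R fun Z => LinearMap.ext fun x => ?_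
      simp only [LinearMap.comp_apply, LinearMap.add_apply, DirectSum.lmap_lof, Pi.add_apply,
        TensorProduct.map_add_left, TensorProduct.map_add_right, map_add]
      abel
    rw [e, LinearMap.add_comp, ← hD', ← hE']
    simp [LinearMap.comp_add]
  zero_mem' := by
    refine ⟨fun q X Y x hx => by simp, fun X Y => ?_⟩
    classical
    have e : (DirectSum.lmap fun Z : Q.Ob =>
        TensorProduct.map (Q.tensorSign p Z Y) ((0 : Q.TEnd) X Z)
          + TensorProduct.map ((0 : Q.TEnd) Z Y)
            (LinearMap.id : Q.TBar X Z →ₗ[R] Q.TBar X Z)) = 0 := by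
      refine DirectSum.linearMap_ext R fun Z => LinearMap.ext fun x => ?_
      simp
    rw [e]
    simp
  smul_mem' := by
    rintro r D ⟨hD, hD'⟩
    refine ⟨fun q X Y x hx => Submodule.smul_mem _ r (hD q X Y x hx), fun X Y => ?_⟩
    classical
    have e : (DirectSum.lmap fun Z : Q.Ob =>
          TensorProduct.map (Q.tensorSign p Z Y) ((r • D) X Z)
            + TensorProduct.map ((r • D) Z Y) (LinearMap.id : Q.TBar X Z →ₗ[R] Q.TBar X Z))
        = r • DirectSum.lmap fun Z : Q.Ob =>
            TensorProduct.map (Q.tensorSign p Z Y) (D X Z)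
              + TensorProduct.map (D Z Y) LinearMap.id := by
      refine DirectSum.linearMap_ext R fun Z => LinearMap.ext fun x => ?_
      simp [TensorProduct.map_smul_left, TensorProduct.map_smul_right]
    rw [e, LinearMap.smul_comp, ← hD']
    simp [LinearMap.comp_smul]

/-- The families of endomorphisms that vanish on weights `≤ n - 1`; the coderivations among them
form the `n`-th step of the weight filtration. -/
def weightFil (n : ℕ) : Submodule R Q.TEnd where
  carrier := {D | ∀ (X Y : Q.Ob), ∀ x ∈ Q.weightLE (n - 1) X Y, D X Y x = 0}
  add_mem' hD hE X Y x hx := by simp [hD X Y x hx, hE X Y x hx]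
  zero_mem' X Y x hx := by simp
  smul_mem' r D hD X Y x hx := by simp [hD X Y x hx]

variable {Q}

/-- The endomorphism of the tensor cocategory of `𝒞[1]` with components
`φₖ : 𝒞[1]^{⊗ k} → 𝒞[1]` of degree `p`, namely `∑ 1^{⊗ j} ⊗ φₖ ⊗ 1^{⊗ l}` with the Koszul sign:
this is the unique coderivation that corestricts to `φ`. -/
def coderOf (p : ℤ) (φ : ∀ {X Y : Q.Ob}, Str Q X Y → Q.Mor X Y)
    (hφ : ∀ X Y : Q.Ob, Str.IsMultilinear (φ : Str Q X Y → Q.Mor X Y))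
    (h₀ : ∀ X : Q.Ob, φ (Str.nil : Str Q X X) = 0) : Q.TEnd := fun X Y =>
  TBar.lift
    (fun s => s.sum₃ fun Z Z' a b c =>
      (tprod ((a.map (Q.signMap (-1) p)).append (Str.cons (φ b) c)) : Q.TBar X Y))
    (Str.IsMultilinear.sum₃
      (fun Z Z' b c =>
        ((isMultilinear_tprod X Y).append_right (Str.cons (φ b) c)).comp_map (Q.signMap (-1) p))
      (fun Z Z' a c =>
        (hφ Z Z').linear_comp
          { toFun := fun f => (tprod ((a.map (Q.signMap (-1) p)).append (Str.cons f c)) :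
              Q.TBar X Y)
            map_add' := fun f g => (isMultilinear_tprod X Y).map_add _ f g c
            map_smul' := fun r f => (isMultilinear_tprod X Y).map_smul _ r f c })
      (fun Z Z' a b =>
        ((isMultilinear_tprod X Y).append_left (a.map (Q.signMap (-1) p))).cons_left (φ b)))
    (fun s hs => by
      cases s with
      | nil =>
        have := (isMultilinear_tprod X X).head_smul (0 : R) (0 : Q.Mor X X) Str.nil
        simp only [zero_smul] at this
        simpa [Str.sum₃, Str.sum₂, Str.splits, h₀] using this
      | cons f t => simp at hs)

end GradedQuiver

open GradedQuiver

/-- An `A∞`-category over `R`. The structure morphism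
`mᵢ : 𝒞(Xᵢ₋₁, Xᵢ) ⊗ ⋯ ⊗ 𝒞(X₀, X₁) → 𝒞(X₀, Xᵢ)[2 - i]` is the restriction of `m` to the strings
of length `i ≥ 1`; there is no `m₀`. In `rel`, the decomposition `s = a ⊗ b ⊗ c` has parts of
lengths `j`, `k`, `l`, and the Koszul sign of `id^{⊗ j} ⊗ mₖ ⊗ id^{⊗ l}` multiplies the entries
`x` of `a` by `(-1) ^ (k |x|)`. -/
structure AInfCategory (R : Type u) [CommRing R] extends GradedQuiver.{u, v, w} R where
  m : ∀ {X Y : Ob}, Str toGradedQuiver X Y → toGradedQuiver.Mor X Y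
  m_multilinear : ∀ X Y : Ob,
    Str.IsMultilinear (m : Str toGradedQuiver X Y → toGradedQuiver.Mor X Y)
  m_nil : ∀ X : Ob, m (Str.nil : Str toGradedQuiver X X) = 0
  m_deg : ∀ {X Y : Ob} (s : Str toGradedQuiver X Y) (q : ℤ), s.HasDeg q →
    m s ∈ toGradedQuiver.gr X Y (q + 2 - s.length)
  rel : ∀ {X Y : Ob} (s : Str toGradedQuiver X Y),
    (s.sum₃ fun _ _ a b c =>
      ((-1 : ℤ) ^ (a.length * b.length + c.length)) •
        m ((a.map (toGradedQuiver.signMap 0 b.length)).append (Str.cons (m b) c))) = 0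

/-- An `A_n`-functor `(F, F₁, …, F_n)` between `A∞`-categories, regarded as `A_n`-categories
(`n = ⊤` gives the `A∞`-functors). `Fᵢ` is the restriction of `F` to the strings of length
`1 ≤ i ≤ n`; the remaining values of `F` are set to zero. -/
structure AnFunctor {R : Type u} [CommRing R] (n : ℕ∞) (C D : AInfCategory.{u, v, w} R) where
  obj : C.Ob → D.Ob
  F : ∀ {X Y : C.Ob}, Str C.toGradedQuiver X Y → D.Mor (obj X) (obj Y)
  F_multilinear : ∀ X Y : C.Ob,
    Str.IsMultilinear (F : Str C.toGradedQuiver X Y → D.Mor (obj X) (obj Y))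
  F_nil : ∀ X : C.Ob, F (Str.nil : Str C.toGradedQuiver X X) = 0
  F_of_lt : ∀ {X Y : C.Ob} (s : Str C.toGradedQuiver X Y), n < s.length → F s = 0
  F_deg : ∀ {X Y : C.Ob} (s : Str C.toGradedQuiver X Y) (q : ℤ), s.HasDeg q →
    F s ∈ D.gr (obj X) (obj Y) (q + 1 - s.length)
  rel : ∀ {X Y : C.Ob} (s : Str C.toGradedQuiver X Y), (s.length : ℕ∞) ≤ n →
    (s.sum₃ fun _ _ a b c =>
      ((-1 : ℤ) ^ (a.length * b.length + c.length)) •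
        F ((a.map (C.signMap 0 b.length)).append (Str.cons (C.m b) c)))
    = (s.blockings.map fun B => ((-1 : ℤ) ^ B.sgn) • D.m (B.image obj F)).sum

/-- A quasi-isomorphism: a bijection on objects such that all
`F₁ : 𝒞(X, Y) → 𝒟(FX, FY)` induce bijections on the cohomology of `m₁`. -/
def AnFunctor.IsQuasiIso {R : Type u} [CommRing R] {n : ℕ∞} {C D : AInfCategory.{u, v, w} R}
    (F : AnFunctor n C D) : Prop :=
  Function.Bijective F.obj ∧ ∀ X Y : C.Ob,
    (∀ f : C.Mor X Y, C.m (Str.single f) = 0 →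
      (∃ g : D.Mor (F.obj X) (F.obj Y), D.m (Str.single g) = F.F (Str.single f)) →
        ∃ g : C.Mor X Y, C.m (Str.single g) = f) ∧
    (∀ g : D.Mor (F.obj X) (F.obj Y), D.m (Str.single g) = 0 →
      ∃ f : C.Mor X Y, C.m (Str.single f) = 0 ∧
        ∃ h : D.Mor (F.obj X) (F.obj Y), D.m (Str.single h) = F.F (Str.single f) - g)

namespace AInfCategory

variable {R : Type u} [CommRing R] (C : AInfCategory.{u, v, w} R)

/-- Minimality: `m₁ = 0`. -/
def IsMinimal : Prop := ∀ (X Y : C.Ob) (f : C.Mor X Y), C.m (Str.single f) = 0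

lemma m_of_length_le_one (hC : C.IsMinimal) {X Y : C.Ob} (s : Str C.toGradedQuiver X Y)
    (hs : s.length ≤ 1) : C.m s = 0 := by
  cases s with
  | nil => exact C.m_nil X
  | cons f t =>
    cases t with
    | nil => exact hC _ _ f
    | cons g t => simp at hs

lemma m_append_cons_zero {X Y Z W : C.Ob} (a : Str C.toGradedQuiver Z W)
    (c : Str C.toGradedQuiver X Y) : C.m (a.append (Str.cons (0 : C.Mor Y Z) c)) = 0 := by
  simpa using (C.m_multilinear X W).map_smul a (0 : R) (0 : C.Mor Y Z) c

/-- The cohomology category `H𝒞` of a minimal `A∞`-category `𝒞`, regarded as an `A∞`-category.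
As `m₁ = 0`, its graded modules of morphisms are those of `𝒞`; its composition is `m₂`, and all
other operations are zero. -/
def cohomology (hC : C.IsMinimal) : AInfCategory.{u, v, w} R where
  toGradedQuiver := C.toGradedQuiver
  m s := if s.length = 2 then C.m s else 0
  m_multilinear X Y :=
    { map_add := fun a f g b => by
        simp only [Str.length_append, Str.length_cons]
        split_ifs
        · exact (C.m_multilinear X Y).map_add a f g b
        · simp
      map_smul := fun a r f b => by
        simp only [Str.length_append, Str.length_cons]
        split_ifs
        · exact (C.m_multilinear X Y).map_smul a r f b
        · simp }
  m_nil X := by simp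
  m_deg s q hs := by
    split_ifs
    · exact C.m_deg s q hs
    · exact Submodule.zero_mem _
  rel s := by
    by_cases h3 : s.length = 3
    · refine (Str.sum₃_congr s fun Y Y' a b c habc => ?_).trans (C.rel s)
      congr 1
      have hl : a.length + (b.length + c.length) = 3 := by
        rw [← h3, ← habc, Str.length_append, Str.length_append]
      by_cases hb : b.length = 2
      · rw [if_pos hb, if_pos]
        simp only [Str.length_append, Str.length_map, Str.length_cons]
        omega
      · rw [if_neg hb, C.m_append_cons_zero]
        simp only [ite_self]
        by_cases hb' : b.length ≤ 1
        · rw [C.m_of_length_le_one hC b hb', C.m_append_cons_zero]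
        · rw [C.m_of_length_le_one hC]
          simp only [Str.length_append, Str.length_map, Str.length_cons]
          omega
    · refine (Str.sum₃_congr (g' := fun _ _ _ _ _ => 0) s fun Y Y' a b c habc => ?_).trans (Str.sum₃_zero s)
      have hl : a.length + (b.length + c.length) ≠ 3 := by
        rwa [← Str.length_append, ← Str.length_append, habc]
      by_cases hb : b.length = 2
      · rw [if_neg, smul_zero]
        simp only [Str.length_append, Str.length_map, Str.length_cons]
        omega
      · rw [if_neg hb, C.m_append_cons_zero, ite_self, smul_zero]

/-- `A_n`-formality: there is an `A_n`-quasi-isomorphism `H𝒞 → 𝒞`. -/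
def IsAnFormal (hC : C.IsMinimal) (n : ℕ∞) : Prop :=
  ∃ F : AnFunctor n (C.cohomology hC) C, F.IsQuasiIso

/-- Formality: there is an `A∞`-quasi-isomorphism `H𝒞 → 𝒞`. -/
def IsFormal (hC : C.IsMinimal) : Prop := C.IsAnFormal hC ⊤

/-- The components `dᵢ = -s ∘ mᵢ ∘ (s⁻¹)^{⊗ i} : 𝒞[1]^{⊗ i} → 𝒞[1]` of the bar codifferential. -/
def d {X Y : C.Ob} (s : Str C.toGradedQuiver X Y) : C.Mor X Y := -C.m s.desuspend

lemma d_multilinear (X Y : C.Ob) :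
    Str.IsMultilinear (C.d : Str C.toGradedQuiver X Y → C.Mor X Y) :=
  (C.m_multilinear X Y).comp_desuspend.linear_comp (-LinearMap.id)

lemma d_nil (X : C.Ob) : C.d (Str.nil : Str C.toGradedQuiver X X) = 0 := by
  simp [d, Str.desuspend, C.m_nil]

/-- The codifferential of the bar construction `ℬ(𝒞)`. -/
def barD : C.TEnd := coderOf 1 (fun s => C.d s) C.d_multilinear C.d_nil

/-- The Kaledin cochain `k_𝒞 = d₃ + 2 d₄ + 3 d₅ + ⋯`, a coderivation of degree `1`: its `i`-th
component is `(i - 2) dᵢ` for `i ≥ 3`, and zero for `i ≤ 2`. -/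
def kaledin : C.TEnd :=
  coderOf 1 (fun s => ((s.length - 2 : ℕ) : R) • C.d s)
    (fun X Y =>
      { map_add := fun a f g b => by
          simp only [Str.length_append, Str.length_cons, (C.d_multilinear X Y).map_add, smul_add]
        map_smul := fun a r f b => by
          simp only [Str.length_append, Str.length_cons, (C.d_multilinear X Y).map_smul]
          rw [smul_comm] })
    (fun X => by simp)

/-- The Hochschild differential `D ↦ [d, D] = d ∘ D - (-1) ^ p D ∘ d` on endomorphisms of
degree `p`. -/
def hochD (p : ℤ) (D : C.TEnd) : C.TEnd := fun X Y =>
  C.barD X Y ∘ₗ D X Y - ((p.negOnePow : ℤˣ) : ℤ) • (D X Y ∘ₗ C.barD X Y)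

/-- `W_n CC`: the `n`-th step of the weight filtration of the Hochschild complex
`CC(𝒞) = coDer(1)`, in coderivation degree `p`. Its cohomology at `p` is `W_n HH^{p + 1}(𝒞)`. -/
def weightCC (n : ℕ) (p : ℤ) : Submodule R C.TEnd :=
  C.toGradedQuiver.coDer p ⊓ C.toGradedQuiver.weightFil n

/-- The Kaledin class vanishes in `W₂HH²(𝒞)`, the second cohomology of the complex `W₂CC(𝒞)`:
the Kaledin cochain is the Hochschild coboundary of an element of `W₂coDer⁰(1)`. -/
def KaledinClassVanishes : Prop :=
  ∃ τ ∈ C.weightCC 2 0, C.hochD 0 τ = C.kaledin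

/-- The truncated Kaledin class `k_𝒞^{≤ n}` vanishes: in the quotient complex
`W₂coDer(1) / W_{n + 1}coDer(1)`, the Kaledin cochain is a coboundary. -/
def TruncatedKaledinClassVanishes (n : ℕ) : Prop :=
  ∃ τ ∈ C.weightCC 2 0, C.hochD 0 τ - C.kaledin ∈ C.weightCC (n + 1) 1

end AInfCategory

end

/-!
A minimal `A∞`-structure is encoded by a codifferential `d = d₂ + d₃ + ⋯` on the reduced tensor
cocategory `T̄(𝒞[1])`. The argument revolves around the Euler coderivation `E`, the coderivation of
degree zero whose only component is the linear map `f ↦ |f| f` (with the degree in `𝒞`); it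
multiplies a tensor by its total degree in `𝒞`. As `mᵢ` has degree `2 - i`, the bracket `[dᵢ, E]`
is `(i - 2) dᵢ`, and therefore `[d, E]` is the Kaledin cochain `k` (`bracket_barD_euler`). So
`k = [d, τ]` with `τ ∈ W₂` if and only if `δ = E - τ` is a coderivation with linear part `E` that
commutes with `d`; vanishing of the truncated class asks for `[d, δ]` to vanish on weights `≤ n`.

* An `A_n`-quasi-isomorphism `H𝒞 → 𝒞` is, in the bar picture, an isomorphism of tensor cocategories
  that intertwines `d₂` and `d` up to weight `n`. Since `[d₂, E] = 0`, the transport of `E` along it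
  is a lift `δ` as above (`exists_transport_euler`).
* The truncated classes control the full class: if `[d, δ] = c` lies in `W_{n+1}` and `-c` is the
  coboundary of `σ ∈ W₂` modulo `W_{n+2}`, then `[-, δ]` acts on `W_{k+1} / W_{k+2}` in degree `p`
  as multiplication by `k - p`, so that rational multiples of `[σ, δ] - k σ` move `σ` step by step
  deeper into the weight filtration without changing its coboundary modulo `W_{n+2}`, until it lies
  in `W_n`. The corrected lifts then converge, and their limit commutes with `d`
  (`kaledinClassVanishes_of_truncated`).
* Conversely, given a lift `δ = E - τ`, one solves `δ F = F E` for a cocategory automorphism `F` with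
  identical linear part, weight by weight: the component of weight `n ≥ 2` only enters multiplied by
  `n - 1` (`Components.exists_conj`). Then `K = d F - F d₂` satisfies `δ K = K E`. On the first
  weight `n` where `K` could be nonzero its values have weight one, and comparing degrees gives
  `(n - 2) K = 0`; for `n = 2` the map `K` is zero by construction. Hence `F` is an
  `A∞`-isomorphism `H𝒞 → 𝒞` (`isFormal_of_kaledinClassVanishes`).

The coordinate form of `A_n`-functors, with its signs, is translated into the bar picture by
`functor_rel_iff`. Coderivations are handled through their corestrictions: over the rationals, a
tensor is recovered from its component of weight one and its comultiplication
(`eq_incl_add_concat`), so that a coderivation along a morphism that corestricts to zero is zero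
(`IsCoderAlong.eq_zero_of_corestrict`).
-/

noncomputable section

namespace GradedQuiver

variable {R : Type u} [CommRing R] {Q : GradedQuiver.{u, v, w} R}

/-! ### Sums over splittings of strings -/

namespace Str

lemma sum₂_nil {M : Type*} [AddCommMonoid M] {X : Q.Ob}
    (g : ∀ Y : Q.Ob, Str Q Y X → Str Q X Y → M) :
    (nil : Str Q X X).sum₂ g = g X nil nil := by
  simp [sum₂, splits]

lemma sum₂_add {M : Type*} [AddCommMonoid M] {X Z : Q.Ob} (s : Str Q X Z)
    (g g' : ∀ Y : Q.Ob, Str Q Y Z → Str Q X Y → M) :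
    (s.sum₂ fun Y a b => g Y a b + g' Y a b) = s.sum₂ g + s.sum₂ g' := by
  simp [sum₂, List.sum_map_add]

lemma map_sum₂ {M N G : Type*} [AddCommMonoid M] [AddCommMonoid N] [FunLike G M N]
    [AddMonoidHomClass G M N] (l : G) {X Z : Q.Ob} (s : Str Q X Z)
    (g : ∀ Y : Q.Ob, Str Q Y Z → Str Q X Y → M) :
    l (s.sum₂ g) = s.sum₂ fun Y a b => l (g Y a b) := by
  simp [sum₂, map_list_sum, Function.comp_def]

lemma map_sum₃ {M N G : Type*} [AddCommMonoid M] [AddCommMonoid N] [FunLike G M N]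
    [AddMonoidHomClass G M N] (l : G) {X Z : Q.Ob} (s : Str Q X Z)
    (g : ∀ Y Y' : Q.Ob, Str Q Y' Z → Str Q Y Y' → Str Q X Y → M) :
    l (s.sum₃ g) = s.sum₃ fun Y Y' a b c => l (g Y Y' a b c) := by
  simp [sum₃, map_sum₂]

/-- Coassociativity of deconcatenation. -/
lemma sum₂_sum₂ {M : Type*} [AddCommMonoid M] {X Z : Q.Ob} (s : Str Q X Z)
    (g : ∀ Y Y' : Q.Ob, Str Q Y' Z → Str Q Y Y' → Str Q X Y → M) :
    (s.sum₂ fun Y r c => r.sum₂ fun Y' a b => g Y Y' a b c) = s.sum₃ g := by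
  unfold sum₃
  induction s with
  | nil => simp [sum₂_nil]
  | cons f t ih =>
    rw [sum₂_cons, sum₂_cons, sum₂_cons, sum₂_nil]
    simp only [sum₂_cons, sum₂_add]
    rw [ih fun Y Y' a b c => g Y Y' (cons f a) b c, add_assoc]

/-- The splittings of `a ⊗ f ⊗ c` cut either inside `a` or inside `c`. -/
lemma sum₂_append_cons {M : Type*} [AddCommMonoid M] {X Y Z W : Q.Ob} (a : Str Q Z W)
    (f : Q.Mor Y Z) (c : Str Q X Y) (g : ∀ V : Q.Ob, Str Q V W → Str Q X V → M) :
    (a.append (cons f c)).sum₂ g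
      = (a.sum₂ fun V a₁ a₂ => g V a₁ (a₂.append (cons f c)))
        + c.sum₂ fun V c₁ c₂ => g V (a.append (cons f c₁)) c₂ := by
  induction a with
  | nil => simp [sum₂_nil, sum₂_cons]
  | cons k a ih =>
    simp only [cons_append, sum₂_cons]
    rw [ih fun V a b => g V (cons k a) b, add_assoc]

lemma sum₂_map {M : Type*} [AddCommMonoid M] (e : ∀ X Y : Q.Ob, Q.Mor X Y →ₗ[R] Q.Mor X Y)
    {X Z : Q.Ob} (s : Str Q X Z) (g : ∀ Y : Q.Ob, Str Q Y Z → Str Q X Y → M) :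
    (s.map e).sum₂ g = s.sum₂ fun Y a b => g Y (a.map e) (b.map e) := by
  induction s with
  | nil => simp [sum₂_nil]
  | cons f t ih => simp [sum₂_cons, ih]

lemma map_map (e e' : ∀ X Y : Q.Ob, Q.Mor X Y →ₗ[R] Q.Mor X Y) {X Y : Q.Ob} (s : Str Q X Y) :
    (s.map e).map e' = s.map fun X Y => e' X Y ∘ₗ e X Y := by
  induction s with
  | nil => rfl
  | cons f s ih => simp [ih]

lemma map_id {X Y : Q.Ob} (s : Str Q X Y) : (s.map fun _ _ => LinearMap.id) = s := by
  induction s with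
  | nil => rfl
  | cons f s ih => simp [ih]

lemma HasDeg.of_append {X Y Z : Q.Ob} {a : Str Q Y Z} {b : Str Q X Y} {q : ℤ}
    (h : (a.append b).HasDeg q) : ∃ i j, a.HasDeg i ∧ b.HasDeg j ∧ i + j = q := by
  induction a generalizing q with
  | nil => exact ⟨0, q, .nil _, h, zero_add q⟩
  | cons f a ih =>
    rw [cons_append] at h
    cases h with
    | cons hf ht =>
      obtain ⟨i, j, hi, hj, rfl⟩ := ih ht
      exact ⟨_, j, .cons hf hi, hj, by ring⟩

lemma HasDeg.append {X Y Z : Q.Ob} {a : Str Q Y Z} {b : Str Q X Y} {i j : ℤ}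
    (ha : a.HasDeg i) (hb : b.HasDeg j) : (a.append b).HasDeg (i + j) := by
  induction a generalizing i with
  | nil => cases ha; simpa using hb
  | cons f a ih =>
    cases ha with
    | cons hf ha => rw [cons_append, add_assoc]; exact .cons hf (ih ha)

/-! ### Multilinear functions on strings -/

namespace IsMultilinear

variable {M : Type*} [AddCommGroup M] [Module R M]

lemma head_zero {X Y Z : Q.Ob} {φ : Str Q X Z → M} (h : IsMultilinear φ) (t : Str Q X Y) :
    φ (cons (0 : Q.Mor Y Z) t) = 0 := by
  simpa using h.head_smul 0 (0 : Q.Mor Y Z) t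

lemma head_zsmul {X Y Z : Q.Ob} {φ : Str Q X Z → M} (h : IsMultilinear φ) (n : ℤ)
    (f : Q.Mor Y Z) (t : Str Q X Y) : φ (cons (n • f) t) = n • φ (cons f t) := by
  have := h.head_smul (n : R) f t
  simpa [Int.cast_smul_eq_zsmul] using this

lemma add {X Y : Q.Ob} {φ ψ : Str Q X Y → M} (h : IsMultilinear φ) (h' : IsMultilinear ψ) :
    IsMultilinear fun s => φ s + ψ s where
  map_add a f g b := by rw [h.map_add, h'.map_add]; abel
  map_smul a r f b := by rw [h.map_smul, h'.map_smul, smul_add]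

lemma sub {X Y : Q.Ob} {φ ψ : Str Q X Y → M} (h : IsMultilinear φ) (h' : IsMultilinear ψ) :
    IsMultilinear fun s => φ s - ψ s where
  map_add a f g b := by rw [h.map_add, h'.map_add]; abel
  map_smul a r f b := by rw [h.map_smul, h'.map_smul, smul_sub]

lemma zero {X Y : Q.Ob} : IsMultilinear fun _ : Str Q X Y => (0 : M) where
  map_add a f g b := by simp
  map_smul a r f b := by simp

/-- The relations of multilinearity compare strings of the same length, so that a family of
multilinear functions may be spliced together along the length. -/
lemma of_length {X Y : Q.Ob} {φ : ℕ → Str Q X Y → M} (h : ∀ n, IsMultilinear (φ n)) :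
    IsMultilinear fun s => φ s.length s where
  map_add a f g b := by
    simp only [length_append, length_cons]
    exact (h _).map_add a f g b
  map_smul a r f b := by
    simp only [length_append, length_cons]
    exact (h _).map_smul a r f b

lemma length_smul {X Y : Q.Ob} {φ : Str Q X Y → M} (h : IsMultilinear φ) (c : ℕ → R) :
    IsMultilinear fun s => c s.length • φ s :=
  of_length (φ := fun n s => c n • φ s) fun n => h.linear_comp (c n • LinearMap.id)

/-- A multilinear function is determined by its values on strings of homogeneous morphisms. -/
lemma eq_zero_of_homogeneous {X Y : Q.Ob} {φ : Str Q X Y → M} (h : IsMultilinear φ) (n : ℕ)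
    (h₀ : ∀ (s : Str Q X Y) (q : ℤ), s.HasDeg q → s.length = n → φ s = 0) (s : Str Q X Y)
    (hs : s.length = n) : φ s = 0 := by
  induction s generalizing n with
  | nil => exact h₀ _ 0 (.nil _) hs
  | @cons Y Z f t ih =>
    induction f using DirectSum.induction_on with
    | zero => exact h.head_zero t
    | of p x =>
      refine ih (h.cons_left _) (n - 1) (fun t' q ht' hn => h₀ _ (p + q) (.cons ⟨x, rfl⟩ ht') ?_) ?_
      · simp only [length_cons] at hs ⊢; omega
      · simp only [length_cons] at hs; omega
    | add f g hf hg =>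
      rw [h.head_add, hf hs, hg hs, add_zero]

lemma ext_homogeneous {X Y : Q.Ob} {φ ψ : Str Q X Y → M} (h : IsMultilinear φ)
    (h' : IsMultilinear ψ) (h₀ : ∀ (s : Str Q X Y) (q : ℤ), s.HasDeg q → φ s = ψ s)
    (s : Str Q X Y) : φ s = ψ s :=
  sub_eq_zero.1 <| (h.sub h').eq_zero_of_homogeneous s.length
    (fun s q hs _ => sub_eq_zero.2 (h₀ s q hs)) s rfl

end IsMultilinear

end Str

/-! ### Signs -/

lemma signMap_of_mem {X Y : Q.Ob} {p : ℤ} (c a : ℤ) {f : Q.Mor X Y} (hf : f ∈ Q.gr X Y p) :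
    Q.signMap c a X Y f = ((a * (p + c)).negOnePow : ℤ) • f := by
  obtain ⟨x, rfl⟩ := hf
  rw [signMap, DirectSum.lmap_lof, LinearMap.smul_apply, LinearMap.id_apply, map_zsmul]

lemma signMap_mem {X Y : Q.Ob} {p : ℤ} (c a : ℤ) {f : Q.Mor X Y} (hf : f ∈ Q.gr X Y p) :
    Q.signMap c a X Y f ∈ Q.gr X Y p := by
  rw [signMap_of_mem c a hf]
  exact zsmul_mem hf _

/-- Linear maps on a morphism module agree if they agree on homogeneous morphisms. -/
lemma mor_ext {M : Type*} [AddCommGroup M] [Module R M] {X Y : Q.Ob} {l l' : Q.Mor X Y →ₗ[R] M}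
    (h : ∀ (p : ℤ), ∀ f ∈ Q.gr X Y p, l f = l' f) : l = l' :=
  DirectSum.linearMap_ext R fun p => LinearMap.ext fun x => h p _ ⟨x, rfl⟩

lemma signMap_zero (c : ℤ) (X Y : Q.Ob) : Q.signMap c 0 X Y = LinearMap.id :=
  mor_ext fun p f hf => by simp [signMap_of_mem c 0 hf]

lemma signMap_comp (c a b : ℤ) (X Y : Q.Ob) :
    Q.signMap c a X Y ∘ₗ Q.signMap c b X Y = Q.signMap c (a + b) X Y :=
  mor_ext fun p f hf => by
    rw [LinearMap.comp_apply, signMap_of_mem c b hf, map_zsmul, signMap_of_mem c a hf,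
      signMap_of_mem c _ hf, smul_smul, add_mul, Int.negOnePow_add, Units.val_mul, mul_comm]

/-- The sign maps depend on the parity of the exponent only. -/
lemma signMap_add_two_mul (c a b : ℤ) (X Y : Q.Ob) :
    Q.signMap c (a + 2 * b) X Y = Q.signMap c a X Y :=
  mor_ext fun p f hf => by
    rw [signMap_of_mem c _ hf, signMap_of_mem c _ hf, add_mul, mul_assoc, Int.negOnePow_add,
      Int.negOnePow_even _ (even_two_mul _), mul_one]

lemma signMap_zero_eq (a : ℤ) (X Y : Q.Ob) :
    Q.signMap 0 a X Y = (a.negOnePow : ℤ) • Q.signMap (-1) a X Y :=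
  mor_ext fun p f hf => by
    rw [LinearMap.smul_apply, signMap_of_mem 0 _ hf, signMap_of_mem (-1) _ hf, smul_smul,
      ← Units.val_mul, ← Int.negOnePow_add]
    ring_nf

namespace Str

lemma HasDeg.map_signMap {X Y : Q.Ob} {s : Str Q X Y} {q : ℤ} (hs : s.HasDeg q) (c a : ℤ) :
    (s.map (Q.signMap c a)).HasDeg q := by
  induction hs with
  | nil => exact .nil _
  | cons hf _ ih => exact .cons (signMap_mem c a hf) ih

lemma HasDeg.desuspend {X Y : Q.Ob} {s : Str Q X Y} {q : ℤ} (hs : s.HasDeg q) :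
    s.desuspend.HasDeg q := by
  induction hs with
  | nil => exact .nil _
  | cons hf _ ih => exact .cons (signMap_mem _ _ hf) ih

lemma IsMultilinear.map_signMap {M : Type*} [AddCommGroup M] [Module R M] {X Y : Q.Ob}
    {φ : Str Q X Y → M} (h : IsMultilinear φ) (c a : ℤ) {s : Str Q X Y} {q : ℤ}
    (hs : s.HasDeg q) :
    φ (s.map (Q.signMap c a)) = ((a * (q + c * s.length)).negOnePow : ℤ) • φ s := by
  induction hs with
  | nil => simp
  | cons hf ht ih =>
    rw [map_cons, signMap_of_mem c a hf, h.head_zsmul, ih (h.cons_left _), smul_smul,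
      ← Units.val_mul, ← Int.negOnePow_add, length_cons]
    congr 3
    push_cast
    ring

/-- Scaling every entry by the same sign. -/
lemma IsMultilinear.map_zsmul {M : Type*} [AddCommGroup M] [Module R M] {X Y : Q.Ob}
    {φ : Str Q X Y → M} (h : IsMultilinear φ) (n : ℤ)
    (e : ∀ X Y : Q.Ob, Q.Mor X Y →ₗ[R] Q.Mor X Y) (s : Str Q X Y) :
    φ (s.map fun X Y => n • e X Y) = n ^ s.length • φ (s.map e) := by
  induction s with
  | nil => simp
  | cons f t ih =>
    rw [map_cons, LinearMap.smul_apply, h.head_zsmul, ih (h.cons_left _), smul_smul, length_cons,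
      pow_succ', map_cons]

/-- A multilinear function of degree `k - n` on strings of length `n` commutes with the signs
up to `(-1) ^ (a (k - 1))`. -/
lemma IsMultilinear.map_signMap_of_deg {Q' : GradedQuiver.{u, v, w} R} {X Y : Q.Ob} {X' Y' : Q'.Ob}
    {φ : Str Q X Y → Q'.Mor X' Y'} (h : IsMultilinear φ) (k : ℤ)
    (hd : ∀ (s : Str Q X Y) (q : ℤ), s.HasDeg q → φ s ∈ Q'.gr X' Y' (q + k - s.length)) (a : ℤ)
    (s : Str Q X Y) :
    φ (s.map (Q.signMap (-1) a))
      = ((a * (k - 1)).negOnePow : ℤ) • Q'.signMap (-1) a X' Y' (φ s) := by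
  refine IsMultilinear.ext_homogeneous (h.comp_map _)
    (h.linear_comp (((a * (k - 1)).negOnePow : ℤ) • Q'.signMap (-1) a X' Y')) (fun s q hs => ?_) s
  rw [h.map_signMap (-1) a hs, LinearMap.smul_apply, signMap_of_mem (-1) a (hd s q hs), smul_smul,
    ← Units.val_mul, ← Int.negOnePow_add]
  have : a * (k - 1) + a * (q + k - s.length + -1)
      = a * (q + -1 * s.length) + 2 * (a * (k - 1)) := by ring
  rw [this, Int.negOnePow_add _ (2 * _), Int.negOnePow_even _ (even_two_mul _), mul_one]

/-- Desuspension is an involution, since every entry receives the same sign twice. -/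
@[simp] lemma desuspend_desuspend {X Y : Q.Ob} (s : Str Q X Y) : s.desuspend.desuspend = s := by
  induction s with
  | nil => rfl
  | cons f t ih =>
    simp only [desuspend, length_desuspend, ih]
    rw [← LinearMap.comp_apply, signMap_comp, ← two_mul, ← zero_add (2 * _), signMap_add_two_mul,
      signMap_zero, LinearMap.id_apply]

lemma desuspend_append {X Y Z : Q.Ob} (a : Str Q Y Z) (b : Str Q X Y) :
    (a.append b).desuspend
      = (a.desuspend.map (Q.signMap (-1) b.length)).append b.desuspend := by
  induction a with
  | nil => rfl
  | cons f a ih =>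
    simp only [cons_append, desuspend, map_cons, ih]
    rw [← LinearMap.comp_apply, signMap_comp, length_append, Nat.cast_add, add_comm (a.length : ℤ)]

end Str

end GradedQuiver

namespace GradedQuiver

variable {R : Type u} [CommRing R] {Q Q' Q'' : GradedQuiver.{u, v, w} R}

/-! ### Linear maps out of the tensor cocategory -/

namespace Str

/-- The morphism of a string of length one; zero for all other strings. -/
def entry {X : Q.Ob} : {Y : Q.Ob} → Str Q X Y → Q.Mor X Y
  | _, nil => 0
  | _, cons f nil => f
  | _, cons _ (cons _ _) => 0

@[simp] lemma entry_nil (X : Q.Ob) : (nil : Str Q X X).entry = 0 := rfl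

@[simp] lemma entry_single {X Y : Q.Ob} (f : Q.Mor X Y) : (single f).entry = f := rfl

lemma entry_of_length_ne_one {X Y : Q.Ob} (s : Str Q X Y) (hs : s.length ≠ 1) : s.entry = 0 := by
  cases s with
  | nil => rfl
  | cons f t =>
    cases t with
    | nil => simp at hs
    | cons g t => rfl

lemma exists_eq_single {X Y : Q.Ob} (s : Str Q X Y) (hs : s.length = 1) : ∃ f, s = single f := by
  cases s with
  | nil => simp at hs
  | cons f t =>
    cases t with
    | nil => exact ⟨f, rfl⟩
    | cons g t => simp at hs

lemma isMultilinear_entry (X Y : Q.Ob) :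
    IsMultilinear (entry : Str Q X Y → Q.Mor X Y) where
  map_add a f g b := by
    cases a with
    | nil =>
      cases b with
      | nil => rfl
      | cons k b => exact (add_zero _).symm
    | cons k a =>
      have h (f : Q.Mor _ _) : (((cons k a).append (cons f b))).entry = 0 :=
        entry_of_length_ne_one _ (by simp)
      simp only [h, add_zero]
  map_smul a r f b := by
    cases a with
    | nil =>
      cases b with
      | nil => rfl
      | cons k b => exact (smul_zero _).symm
    | cons k a =>
      have h (f : Q.Mor _ _) : (((cons k a).append (cons f b))).entry = 0 :=
        entry_of_length_ne_one _ (by simp)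
      simp only [h, smul_zero]

end Str

lemma tprod_nil (X : Q.Ob) : (tprod (Str.nil : Str Q X X) : Q.TBar X X) = 0 :=
  tprod_of_length_eq_zero _ rfl

namespace TBar

variable {M : Type*} [AddCommGroup M] [Module R M]

lemma hom_ext {X Y : Q.Ob} {l l' : Q.TBar X Y →ₗ[R] M}
    (h : ∀ s : Str Q X Y, l (tprod s) = l' (tprod s)) : l = l' := by
  have e : l ∘ₗ mk X Y = l' ∘ₗ mk X Y := by
    refine Finsupp.lhom_ext' fun s => LinearMap.ext_ring ?_
    exact h s
  refine LinearMap.ext fun x => ?_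
  obtain ⟨y, rfl⟩ := (Q.tensorRel X Y).mkQ_surjective x
  exact LinearMap.congr_fun e y

lemma isMultilinear_comp {X Y : Q.Ob} (l : Q.TBar X Y →ₗ[R] M) :
    Str.IsMultilinear fun s : Str Q X Y => l (tprod s) :=
  (isMultilinear_tprod X Y).linear_comp l

lemma hom_ext_homogeneous {X Y : Q.Ob} {l l' : Q.TBar X Y →ₗ[R] M}
    (h : ∀ (s : Str Q X Y) (q : ℤ), s.HasDeg q → l (tprod s) = l' (tprod s)) : l = l' :=
  hom_ext fun s => (isMultilinear_comp l).ext_homogeneous (isMultilinear_comp l') h s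

/-- Maps that are prescribed in each weight separately: on weight `n` the `n`-th map is used. -/
def ofWeights {X Y : Q.Ob} (G : ℕ → Q.TBar X Y →ₗ[R] M) : Q.TBar X Y →ₗ[R] M :=
  lift (fun s => G s.length (tprod s))
    (Str.IsMultilinear.of_length (φ := fun n s => G n (tprod s)) fun n => isMultilinear_comp (G n))
    fun s hs => by rw [tprod_of_length_eq_zero s hs, map_zero]

@[simp] lemma ofWeights_tprod {X Y : Q.Ob} (G : ℕ → Q.TBar X Y →ₗ[R] M) (s : Str Q X Y) :
    ofWeights G (tprod s) = G s.length (tprod s) := lift_tprod _ _ _ s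

/-- The corestriction `T̄𝒞[1] → 𝒞[1]`, projection onto weight one. -/
def corestrict (X Y : Q.Ob) : Q.TBar X Y →ₗ[R] Q.Mor X Y :=
  lift Str.entry (Str.isMultilinear_entry X Y)
    fun s hs => Str.entry_of_length_ne_one s (by omega)

@[simp] lemma corestrict_tprod {X Y : Q.Ob} (s : Str Q X Y) :
    corestrict X Y (tprod s) = s.entry := lift_tprod _ _ _ s

/-- The inclusion `𝒞[1] → T̄𝒞[1]` of weight one. -/
def incl (X Y : Q.Ob) : Q.Mor X Y →ₗ[R] Q.TBar X Y where
  toFun f := tprod (Str.single f)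
  map_add' f g := (isMultilinear_tprod X Y).head_add f g Str.nil
  map_smul' r f := (isMultilinear_tprod X Y).head_smul r f Str.nil

lemma incl_apply {X Y : Q.Ob} (f : Q.Mor X Y) : incl X Y f = tprod (Str.single f) := rfl

@[simp] lemma corestrict_incl {X Y : Q.Ob} (f : Q.Mor X Y) :
    corestrict X Y (incl X Y f) = f := by
  rw [incl_apply, corestrict_tprod, Str.entry_single]

lemma isMultilinear_nonempty {X Y : Q.Ob} {φ : Str Q X Y → M} (h : Str.IsMultilinear φ) :
    Str.IsMultilinear fun s => if s.length = 0 then 0 else φ s :=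
  Str.IsMultilinear.of_length (φ := fun n s => if n = 0 then 0 else φ s) fun n => by
    by_cases hn : n = 0
    · simpa [hn] using Str.IsMultilinear.zero
    · simpa [hn] using h

/-- Concatenation with a fixed string. -/
def mulStr {Y Z : Q.Ob} (a : Str Q Y Z) (X : Q.Ob) : Q.TBar X Y →ₗ[R] Q.TBar X Z :=
  lift (fun b => if b.length = 0 then 0 else tprod (a.append b))
    (isMultilinear_nonempty ((isMultilinear_tprod X Z).append_left a)) fun _ hb => if_pos hb

lemma mulStr_tprod {X Y Z : Q.Ob} (a : Str Q Y Z) (b : Str Q X Y) :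
    mulStr a X (tprod b) = if b.length = 0 then 0 else tprod (a.append b) := lift_tprod _ _ _ b

/-- Concatenation of tensors (zero if one of the two strings is empty). -/
def mul {X Y Z : Q.Ob} : Q.TBar Y Z →ₗ[R] Q.TBar X Y →ₗ[R] Q.TBar X Z :=
  lift (fun a => if a.length = 0 then 0 else mulStr a X)
    (isMultilinear_nonempty
      { map_add := fun a f g b => hom_ext fun c => by
          simp only [LinearMap.add_apply, mulStr_tprod]
          split_ifs
          · simp
          · simpa only [Str.append_assoc, Str.cons_append] using
              (isMultilinear_tprod X Z).map_add a f g (b.append c)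
        map_smul := fun a r f b => hom_ext fun c => by
          simp only [LinearMap.smul_apply, mulStr_tprod]
          split_ifs
          · simp
          · simpa only [Str.append_assoc, Str.cons_append] using
              (isMultilinear_tprod X Z).map_smul a r f (b.append c) })
    fun _ ha => if_pos ha

lemma mul_tprod {X Y Z : Q.Ob} {a : Str Q Y Z} {b : Str Q X Y} (ha : a.length ≠ 0)
    (hb : b.length ≠ 0) : mul (tprod a) (tprod b) = (tprod (a.append b) : Q.TBar X Z) := by
  rw [mul, lift_tprod, if_neg ha, mulStr_tprod, if_neg hb]

end TBar

/-! ### The weight filtration -/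

open TBar

lemma tprod_mem_weightLE {X Y : Q.Ob} {s : Str Q X Y} {n : ℕ} (hs : s.length ≤ n) :
    tprod s ∈ Q.weightLE n X Y := Submodule.subset_span ⟨s, hs, rfl⟩

lemma weightLE_mono {m n : ℕ} (h : m ≤ n) (X Y : Q.Ob) : Q.weightLE m X Y ≤ Q.weightLE n X Y :=
  Submodule.span_mono fun _ ⟨s, hs, e⟩ => ⟨s, hs.trans h, e⟩

/-- The weight filtration is spanned by the tensors of homogeneous morphisms. -/
lemma weightLE_le {n : ℕ} {X Y : Q.Ob} {S : Submodule R (Q.TBar X Y)}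
    (h : ∀ (s : Str Q X Y) (q : ℤ), s.HasDeg q → s.length ≤ n → tprod s ∈ S) :
    Q.weightLE n X Y ≤ S := by
  refine Submodule.span_le.2 ?_
  rintro _ ⟨s, hs, rfl⟩
  refine (Submodule.Quotient.mk_eq_zero S).1 ?_
  refine (isMultilinear_comp S.mkQ).eq_zero_of_homogeneous s.length (fun s' q hq hl => ?_) s rfl
  exact (Submodule.Quotient.mk_eq_zero S).2 (h s' q hq (hl ▸ hs))

lemma eq_zero_of_mem_weightLE {M : Type*} [AddCommGroup M] [Module R M] {n : ℕ} {X Y : Q.Ob}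
    {l : Q.TBar X Y →ₗ[R] M}
    (h : ∀ (s : Str Q X Y) (q : ℤ), s.HasDeg q → s.length ≤ n → l (tprod s) = 0)
    {x : Q.TBar X Y} (hx : x ∈ Q.weightLE n X Y) : l x = 0 :=
  weightLE_le (S := LinearMap.ker l) h hx

lemma exists_mem_weightLE {X Y : Q.Ob} (x : Q.TBar X Y) : ∃ n, x ∈ Q.weightLE n X Y := by
  obtain ⟨y, rfl⟩ := (Q.tensorRel X Y).mkQ_surjective x
  induction y using Finsupp.induction_linear with
  | zero => exact ⟨0, by rw [map_zero]; exact zero_mem _⟩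
  | add f g hf hg =>
    obtain ⟨m, hm⟩ := hf
    obtain ⟨n, hn⟩ := hg
    refine ⟨max m n, ?_⟩
    rw [map_add]
    exact add_mem (weightLE_mono (le_max_left _ _) _ _ hm) (weightLE_mono (le_max_right _ _) _ _ hn)
  | single s r =>
    refine ⟨s.length, ?_⟩
    have : (Finsupp.single s r : Str Q X Y →₀ R) = r • Finsupp.single s 1 := by simp
    rw [this, map_smul]
    exact Submodule.smul_mem _ _ (tprod_mem_weightLE le_rfl)

lemma weightLE_zero (X Y : Q.Ob) : Q.weightLE 0 X Y = ⊥ := by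
  refine eq_bot_iff.2 (weightLE_le fun s q _ hl => ?_)
  rw [tprod_of_length_eq_zero s (by omega)]
  exact zero_mem _

lemma incl_mem_weightLE {X Y : Q.Ob} (f : Q.Mor X Y) {n : ℕ} (hn : 1 ≤ n) :
    incl X Y f ∈ Q.weightLE n X Y := tprod_mem_weightLE hn

lemma mul_mem_weightLE {X Y Z : Q.Ob} {m n : ℕ} {x : Q.TBar Y Z} {y : Q.TBar X Y}
    (hx : x ∈ Q.weightLE m Y Z) (hy : y ∈ Q.weightLE n X Y) :
    mul x y ∈ Q.weightLE (m + n) X Z := by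
  have h₁ : Q.weightLE m Y Z ≤ (Q.weightLE (m + n) X Z).comap (mul.flip y) := by
    refine weightLE_le fun a _ _ ha => ?_
    have h₂ : Q.weightLE n X Y ≤ (Q.weightLE (m + n) X Z).comap (mul (tprod a)) := by
      refine weightLE_le fun b _ _ hb => ?_
      rw [Submodule.mem_comap]
      by_cases ha' : a.length = 0
      · simp [tprod_of_length_eq_zero a ha']
      by_cases hb' : b.length = 0
      · simp [tprod_of_length_eq_zero b hb']
      rw [mul_tprod ha' hb']
      exact tprod_mem_weightLE (by rw [Str.length_append]; omega)
    exact h₂ hy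
  exact h₁ hx

lemma tensorSign_tprod (a : ℤ) {X Y : Q.Ob} (s : Str Q X Y) :
    Q.tensorSign a X Y (tprod s) = tprod (s.map (Q.signMap (-1) a)) := lift_tprod _ _ _ s

lemma tensorSign_tprod_of_hasDeg (a : ℤ) {X Y : Q.Ob} {s : Str Q X Y} {q : ℤ} (hs : s.HasDeg q) :
    Q.tensorSign a X Y (tprod s) = ((a * (q - s.length)).negOnePow : ℤ) • tprod s := by
  rw [tensorSign_tprod, (isMultilinear_tprod X Y).map_signMap (-1) a hs, neg_one_mul,
    sub_eq_add_neg]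

lemma tensorSign_of_mem (a : ℤ) {X Y : Q.Ob} {q : ℤ} {x : Q.TBar X Y}
    (hx : x ∈ Q.tensorDeg q X Y) :
    Q.tensorSign a X Y x = ((a * q).negOnePow : ℤ) • x := by
  induction hx using Submodule.span_induction with
  | mem x h =>
    obtain ⟨s, p, hs, rfl, rfl⟩ := h
    exact tensorSign_tprod_of_hasDeg a hs
  | zero => simp
  | add x y _ _ hx hy => rw [map_add, hx, hy, smul_add]
  | smul r x _ hx => rw [map_smul, hx, smul_comm]

lemma tensorSign_zero (X Y : Q.Ob) : Q.tensorSign 0 X Y = LinearMap.id :=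
  hom_ext_homogeneous fun s q hs => by simp [tensorSign_tprod_of_hasDeg 0 hs]

lemma tensorSign_mem_weightLE (a : ℤ) {X Y : Q.Ob} {n : ℕ} {x : Q.TBar X Y}
    (hx : x ∈ Q.weightLE n X Y) : Q.tensorSign a X Y x ∈ Q.weightLE n X Y := by
  refine (weightLE_le (S := (Q.weightLE n X Y).comap (Q.tensorSign a X Y)) fun s _ _ hs => ?_) hx
  rw [Submodule.mem_comap, tensorSign_tprod]
  exact tprod_mem_weightLE (by simpa using hs)

lemma tprod_mem_tensorDeg {X Y : Q.Ob} {s : Str Q X Y} {p : ℤ} (hs : s.HasDeg p) :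
    tprod s ∈ Q.tensorDeg (p - s.length) X Y := Submodule.subset_span ⟨s, p, hs, rfl, rfl⟩

lemma tensorDeg_le {q : ℤ} {X Y : Q.Ob} {S : Submodule R (Q.TBar X Y)}
    (h : ∀ (s : Str Q X Y) (p : ℤ), s.HasDeg p → p - s.length = q → tprod s ∈ S) :
    Q.tensorDeg q X Y ≤ S := by
  refine Submodule.span_le.2 ?_
  rintro _ ⟨s, p, hs, hp, rfl⟩
  exact h s p hs hp

lemma incl_mem_tensorDeg {X Y : Q.Ob} {f : Q.Mor X Y} {p : ℤ} (hf : f ∈ Q.gr X Y p) :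
    incl X Y f ∈ Q.tensorDeg (p - 1) X Y := by
  have := tprod_mem_tensorDeg (.cons hf (.nil X))
  rwa [add_zero] at this

lemma corestrict_mem_gr {X Y : Q.Ob} {q : ℤ} {x : Q.TBar X Y} (hx : x ∈ Q.tensorDeg q X Y) :
    corestrict X Y x ∈ Q.gr X Y (q + 1) := by
  refine (tensorDeg_le (S := (Q.gr X Y (q + 1)).comap (corestrict X Y)) fun s p hs hp => ?_) hx
  rw [Submodule.mem_comap, corestrict_tprod]
  by_cases hl : s.length = 1
  · obtain ⟨f, rfl⟩ := s.exists_eq_single hl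
    rw [hl] at hp
    rw [Str.entry_single]
    cases hs with
    | cons hf ht =>
      cases ht
      convert hf using 2
      push_cast at hp
      omega
  · rw [Str.entry_of_length_ne_one s hl]
    exact zero_mem _

lemma mul_mem_tensorDeg {X Y Z : Q.Ob} {m n : ℤ} {x : Q.TBar Y Z} {y : Q.TBar X Y}
    (hx : x ∈ Q.tensorDeg m Y Z) (hy : y ∈ Q.tensorDeg n X Y) :
    mul x y ∈ Q.tensorDeg (m + n) X Z := by
  have h₁ : Q.tensorDeg m Y Z ≤ (Q.tensorDeg (m + n) X Z).comap (mul.flip y) := by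
    refine tensorDeg_le fun a p ha hp => ?_
    have h₂ : Q.tensorDeg n X Y ≤ (Q.tensorDeg (m + n) X Z).comap (mul (tprod a)) := by
      refine tensorDeg_le fun b p' hb hp' => ?_
      rw [Submodule.mem_comap]
      by_cases ha' : a.length = 0
      · simp [tprod_of_length_eq_zero a ha']
      by_cases hb' : b.length = 0
      · simp [tprod_of_length_eq_zero b hb']
      rw [mul_tprod ha' hb']
      convert tprod_mem_tensorDeg (ha.append hb) using 2
      rw [Str.length_append]
      push_cast
      omega
    exact h₂ hy
  exact h₁ hx

/-! ### The comultiplication -/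

variable (Q) in
/-- The target `⨁ Z, T̄𝒞[1](Z, Y) ⊗ T̄𝒞[1](X, Z)` of the comultiplication. -/
abbrev TBar₂ (X Y : Q.Ob) : Type (max u v w) := ⨁ Z : Q.Ob, Q.TBar Z Y ⊗[R] Q.TBar X Z

open scoped Classical in
/-- The pure tensors `x ⊗ y` in the target of the comultiplication. -/
def pure₂ {X Y : Q.Ob} (Z : Q.Ob) : Q.TBar Z Y →ₗ[R] Q.TBar X Z →ₗ[R] Q.TBar₂ X Y :=
  (TensorProduct.mk R (Q.TBar Z Y) (Q.TBar X Z)).compr₂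
    (DirectSum.lof R Q.Ob (fun Z => Q.TBar Z Y ⊗[R] Q.TBar X Z) Z)

lemma TBar₂.hom_ext {M : Type*} [AddCommGroup M] [Module R M] {X Y : Q.Ob}
    {l l' : Q.TBar₂ X Y →ₗ[R] M} (h : ∀ Z x y, l (pure₂ Z x y) = l' (pure₂ Z x y)) : l = l' := by
  classical
  refine DirectSum.linearMap_ext R fun Z => TensorProduct.ext' fun x y => ?_
  exact h Z x y

lemma comul_tprod {X Y : Q.Ob} (s : Str Q X Y) :
    Q.comul X Y (tprod s) = s.sum₂ fun Z a b => pure₂ Z (tprod a) (tprod b) := lift_tprod _ _ _ s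

open scoped Classical in
/-- The map `x ⊗ y ↦ A x ⊗ B y` along a map `o` on objects. -/
def map₂ (o : Q.Ob → Q'.Ob) {X Y : Q.Ob} {X' Y' : Q'.Ob}
    (A : ∀ Z, Q.TBar Z Y →ₗ[R] Q'.TBar (o Z) Y') (B : ∀ Z, Q.TBar X Z →ₗ[R] Q'.TBar X' (o Z)) :
    Q.TBar₂ X Y →ₗ[R] Q'.TBar₂ X' Y' :=
  DirectSum.toModule R Q.Ob _ fun Z => TensorProduct.lift ((pure₂ (o Z)).compl₁₂ (A Z) (B Z))

@[simp] lemma map₂_pure₂ (o : Q.Ob → Q'.Ob) {X Y : Q.Ob} {X' Y' : Q'.Ob}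
    (A : ∀ Z, Q.TBar Z Y →ₗ[R] Q'.TBar (o Z) Y') (B : ∀ Z, Q.TBar X Z →ₗ[R] Q'.TBar X' (o Z))
    (Z : Q.Ob) (x : Q.TBar Z Y) (y : Q.TBar X Z) :
    map₂ o A B (pure₂ Z x y) = pure₂ (o Z) (A Z x) (B Z y) := by
  simp [map₂, pure₂]

lemma map₂_map₂ (o : Q.Ob → Q'.Ob) (o' : Q'.Ob → Q''.Ob) {X Y : Q.Ob} {X' Y' : Q'.Ob}
    {X'' Y'' : Q''.Ob}
    (A : ∀ Z, Q.TBar Z Y →ₗ[R] Q'.TBar (o Z) Y') (B : ∀ Z, Q.TBar X Z →ₗ[R] Q'.TBar X' (o Z))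
    (A' : ∀ Z, Q'.TBar Z Y' →ₗ[R] Q''.TBar (o' Z) Y'')
    (B' : ∀ Z, Q'.TBar X' Z →ₗ[R] Q''.TBar X'' (o' Z)) (x : Q.TBar₂ X Y) :
    map₂ o' A' B' (map₂ o A B x)
      = map₂ (fun Z => o' (o Z)) (fun Z => A' (o Z) ∘ₗ A Z) (fun Z => B' (o Z) ∘ₗ B Z) x := by
  rw [← LinearMap.comp_apply]
  congr 1
  exact TBar₂.hom_ext fun Z x y => by simp

lemma map₂_comul (o : Q.Ob → Q'.Ob) {X Y : Q.Ob} {X' Y' : Q'.Ob}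
    (A : ∀ Z, Q.TBar Z Y →ₗ[R] Q'.TBar (o Z) Y') (B : ∀ Z, Q.TBar X Z →ₗ[R] Q'.TBar X' (o Z))
    (s : Str Q X Y) :
    map₂ o A B (Q.comul X Y (tprod s))
      = s.sum₂ fun Z a b => pure₂ (o Z) (A Z (tprod a)) (B Z (tprod b)) := by
  rw [comul_tprod, Str.map_sum₂]
  simp

lemma map₂_sub_left (o : Q.Ob → Q'.Ob) {X Y : Q.Ob} {X' Y' : Q'.Ob}
    (A A' : ∀ Z, Q.TBar Z Y →ₗ[R] Q'.TBar (o Z) Y') (B : ∀ Z, Q.TBar X Z →ₗ[R] Q'.TBar X' (o Z)) :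
    map₂ o (fun Z => A Z - A' Z) B = map₂ o A B - map₂ o A' B :=
  TBar₂.hom_ext fun Z x y => by simp

lemma map₂_sub_right (o : Q.Ob → Q'.Ob) {X Y : Q.Ob} {X' Y' : Q'.Ob}
    (A : ∀ Z, Q.TBar Z Y →ₗ[R] Q'.TBar (o Z) Y')
    (B B' : ∀ Z, Q.TBar X Z →ₗ[R] Q'.TBar X' (o Z)) :
    map₂ o A (fun Z => B Z - B' Z) = map₂ o A B - map₂ o A B' :=
  TBar₂.hom_ext fun Z x y => by simp

open scoped Classical in
/-- Concatenation as a map on the target of the comultiplication. -/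
def concat (X Y : Q.Ob) : Q.TBar₂ X Y →ₗ[R] Q.TBar X Y :=
  DirectSum.toModule R Q.Ob _ fun _ => TensorProduct.lift mul

@[simp] lemma concat_pure₂ {X Y : Q.Ob} (Z : Q.Ob) (x : Q.TBar Z Y) (y : Q.TBar X Z) :
    concat X Y (pure₂ Z x y) = mul x y := by
  simp [concat, pure₂]

/-- A string of length `n` has `n - 1` splittings into two nonempty parts. -/
lemma concat_comul_tprod {X Y : Q.Ob} (s : Str Q X Y) :
    concat X Y (Q.comul X Y (tprod s)) = ((s.length - 1 : ℕ) : R) • tprod s := by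
  have key : ∀ {Z W : Q.Ob} (f : Q.Mor Z W) (t : Str Q X Z),
      (t.sum₂ fun V a b => mul (tprod (Str.cons f a)) (tprod b))
        = (t.length : R) • (tprod (Str.cons f t) : Q.TBar X W) := by
    intro Z W f t
    induction t generalizing W with
    | nil => simp [Str.sum₂_nil, tprod_nil]
    | cons g t ih =>
      have e : (t.sum₂ fun V a b => mul (tprod (Str.cons f (Str.cons g a))) (tprod b))
          = mulStr (Str.single f) X
              (t.sum₂ fun V a b => mul (tprod (Str.cons g a)) (tprod b)) := by
        rw [Str.map_sum₂]
        refine Str.sum₂_congr _ fun V a b _ => ?_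
        by_cases hb : b.length = 0
        · simp [tprod_of_length_eq_zero b hb]
        · rw [mul_tprod (by simp) hb, mul_tprod (by simp) hb, mulStr_tprod, if_neg (by simp)]
          rfl
      rw [Str.sum₂_cons, e, ih, map_smul, mulStr_tprod, if_neg (by simp),
        mul_tprod (by simp) (by simp)]
      simp only [Str.single, Str.cons_append, Str.nil_append, Str.length_cons, Nat.cast_add,
        Nat.cast_one, add_smul, one_smul]
      exact add_comm _ _
  rw [comul_tprod, Str.map_sum₂]
  simp only [concat_pure₂]
  cases s with
  | nil => simp [Str.sum₂_nil, tprod_nil]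
  | cons f t => simp [Str.sum₂_cons, tprod_nil, key]

variable [Algebra ℚ R]

/-- Division by `n - 1` on weight `n`. -/
def divWeight (X Y : Q.Ob) : Q.TBar X Y →ₗ[R] Q.TBar X Y :=
  ofWeights fun n => algebraMap ℚ R ((n - 1 : ℕ) : ℚ)⁻¹ • LinearMap.id

/-- In characteristic zero every tensor is recovered from its component of weight one and its
comultiplication. In particular all primitive elements have weight one. -/
lemma eq_incl_add_concat {X Y : Q.Ob} (x : Q.TBar X Y) :
    x = incl X Y (corestrict X Y x) + divWeight X Y (concat X Y (Q.comul X Y x)) := by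
  have e : LinearMap.id = incl X Y ∘ₗ corestrict X Y
      + divWeight X Y ∘ₗ concat X Y ∘ₗ Q.comul X Y := by
    refine hom_ext fun s => ?_
    simp only [LinearMap.id_apply, LinearMap.add_apply, LinearMap.comp_apply, corestrict_tprod,
      concat_comul_tprod, map_smul, divWeight, ofWeights_tprod, LinearMap.smul_apply, smul_smul]
    rcases Nat.lt_or_ge 1 s.length with h | h
    · rw [Str.entry_of_length_ne_one s (by omega), map_zero, zero_add,
        ← map_natCast (algebraMap ℚ R), ← map_mul, mul_inv_cancel₀, map_one, one_smul]
      exact_mod_cast (by omega : s.length - 1 ≠ 0)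
    · rw [Nat.sub_eq_zero_of_le h, Nat.cast_zero, zero_mul, zero_smul, add_zero]
      rcases Nat.lt_or_ge s.length 1 with h' | h'
      · rw [tprod_of_length_eq_zero s (by omega), Str.entry_of_length_ne_one s (by omega), map_zero]
      · obtain ⟨f, rfl⟩ := s.exists_eq_single (le_antisymm h h')
        rfl
  exact LinearMap.congr_fun e x

lemma divWeight_mem_weightLE {X Y : Q.Ob} {n : ℕ} {x : Q.TBar X Y}
    (hx : x ∈ Q.weightLE n X Y) : divWeight X Y x ∈ Q.weightLE n X Y := by
  refine (weightLE_le (S := (Q.weightLE n X Y).comap (divWeight X Y)) fun s _ _ hs => ?_) hx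
  rw [Submodule.mem_comap, divWeight, ofWeights_tprod]
  exact Submodule.smul_mem _ _ (tprod_mem_weightLE hs)

end GradedQuiver

namespace GradedQuiver

variable {R : Type u} [CommRing R] {Q Q' : GradedQuiver.{u, v, w} R}

/-! ### Coderivations -/

open TBar

namespace Str

lemma sum₂_mem {M : Type*} [AddCommGroup M] [Module R M] (S : Submodule R M) {X Z : Q.Ob}
    (s : Str Q X Z) {g : ∀ Y : Q.Ob, Str Q Y Z → Str Q X Y → M}
    (h : ∀ (Y : Q.Ob) (a : Str Q Y Z) (b : Str Q X Y), a.append b = s → g Y a b ∈ S) :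
    s.sum₂ g ∈ S := by
  refine (Submodule.Quotient.mk_eq_zero S).1 ?_
  change S.mkQ _ = 0
  rw [map_sum₂, ← sum₂_zero s]
  exact sum₂_congr s fun Y a b hab => (Submodule.Quotient.mk_eq_zero S).2 (h Y a b hab)

lemma sum₃_mem {M : Type*} [AddCommGroup M] [Module R M] (S : Submodule R M) {X Z : Q.Ob}
    (s : Str Q X Z) {g : ∀ Y Y' : Q.Ob, Str Q Y' Z → Str Q Y Y' → Str Q X Y → M}
    (h : ∀ (Y Y' : Q.Ob) (a : Str Q Y' Z) (b : Str Q Y Y') (c : Str Q X Y),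
      a.append (b.append c) = s → g Y Y' a b c ∈ S) :
    s.sum₃ g ∈ S :=
  sum₂_mem S s fun Y' a r hr => sum₂_mem S r fun Y b c hbc => h Y Y' a b c (by rw [hbc, hr])

lemma sum₂_comm {M : Type*} [AddCommMonoid M] {X Z X' Z' : Q.Ob} (s : Str Q X Z)
    (t : Str Q X' Z')
    (g : ∀ Y : Q.Ob, Str Q Y Z → Str Q X Y → ∀ Y' : Q.Ob, Str Q Y' Z' → Str Q X' Y' → M) :
    (s.sum₂ fun Y a b => t.sum₂ fun Y' a' b' => g Y a b Y' a' b')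
      = t.sum₂ fun Y' a' b' => s.sum₂ fun Y a b => g Y a b Y' a' b' := by
  induction s with
  | nil => simp [sum₂_nil]
  | cons f s ih => simp only [sum₂_cons, sum₂_add, ih]

lemma sum₃_add {M : Type*} [AddCommMonoid M] {X Z : Q.Ob} (s : Str Q X Z)
    (g g' : ∀ Y Y' : Q.Ob, Str Q Y' Z → Str Q Y Y' → Str Q X Y → M) :
    (s.sum₃ fun Y Y' a b c => g Y Y' a b c + g' Y Y' a b c) = s.sum₃ g + s.sum₃ g' := by
  simp only [sum₃, sum₂_add]

/-- Splittings into four parts, where the first part is cut last or first. -/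
lemma sum₃_sum₂_left {M : Type*} [AddCommMonoid M] {X Z : Q.Ob} (s : Str Q X Z)
    (g : ∀ Y Y' Y'' : Q.Ob, Str Q Y'' Z → Str Q Y' Y'' → Str Q Y Y' → Str Q X Y → M) :
    (s.sum₃ fun Y Y' a b c => a.sum₂ fun Y'' a₁ a₂ => g Y Y' Y'' a₁ a₂ b c)
      = s.sum₂ fun Y'' a₁ r => r.sum₃ fun Y Y' a₂ b c => g Y Y' Y'' a₁ a₂ b c := by
  calc _ = s.sum₂ fun Y' a r => a.sum₂ fun Y'' a₁ a₂ => r.sum₂ fun Y b c =>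
        g Y Y' Y'' a₁ a₂ b c := sum₂_congr s fun Y' a r _ => sum₂_comm _ _ _
    _ = _ := sum₂_sum₂ s fun Y' Y'' a₁ a₂ r => r.sum₂ fun Y b c => g Y Y' Y'' a₁ a₂ b c

/-- Splittings into four parts, where the last part is cut last or first. -/
lemma sum₃_sum₂_right {M : Type*} [AddCommMonoid M] {X Z : Q.Ob} (s : Str Q X Z)
    (g : ∀ Y Y' Y'' : Q.Ob, Str Q Y'' Z → Str Q Y' Y'' → Str Q Y Y' → Str Q X Y → M) :
    (s.sum₃ fun Y' Y'' a b c => c.sum₂ fun Y c₁ c₂ => g Y Y' Y'' a b c₁ c₂)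
      = s.sum₂ fun Y r c₂ => r.sum₃ fun Y' Y'' a b c₁ => g Y Y' Y'' a b c₁ c₂ := by
  calc _ = s.sum₂ fun Y'' a r => r.sum₂ fun Y r' c₂ => r'.sum₂ fun Y' b c₁ =>
        g Y Y' Y'' a b c₁ c₂ := sum₂_congr s fun Y'' a r _ => (sum₂_sum₂ r _).symm
    _ = _ := (sum₂_sum₂ s fun Y Y'' a r c₂ => r.sum₂ fun Y' b c₁ => g Y Y' Y'' a b c₁ c₂).symm

/-- Only the splitting with empty right part contributes an entry. -/
lemma sum₂_entry {X Z W : Q.Ob} (s : Str Q X Z) (φ : ∀ Y : Q.Ob, Str Q Y Z → Q.Mor Y W) :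
    (s.sum₂ fun Y b c => (cons (φ Y b) c).entry) = φ X s := by
  induction s with
  | nil => simp [sum₂_nil, entry]
  | cons f t ih =>
    rw [sum₂_cons, ih fun Y b => φ Y (cons f b), entry_of_length_ne_one _ (by simp), zero_add]

end Str

/-- Families `K` with `Δ ∘ K = (A ⊗ K + K ⊗ B) ∘ Δ`, covering the map `o` on objects. -/
def IsCoderAlong (o : Q.Ob → Q'.Ob) (A B K : ∀ X Y : Q.Ob, Q.TBar X Y →ₗ[R] Q'.TBar (o X) (o Y)) :
    Prop :=
  ∀ (X Y : Q.Ob) (x : Q.TBar X Y), Q'.comul _ _ (K X Y x)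
    = map₂ o (fun Z => A Z Y) (fun Z => K X Z) (Q.comul X Y x)
      + map₂ o (fun Z => K Z Y) (fun Z => B X Z) (Q.comul X Y x)

lemma mem_coDer_iff {p : ℤ} {D : Q.TEnd} :
    D ∈ Q.coDer p ↔
      (∀ (q : ℤ) (X Y : Q.Ob), ∀ x ∈ Q.tensorDeg q X Y, D X Y x ∈ Q.tensorDeg (q + p) X Y) ∧
      IsCoderAlong (fun X => X) (Q.tensorSign p) (fun _ _ => LinearMap.id) D := by
  have e (X Y : Q.Ob) : (DirectSum.lmap fun Z : Q.Ob =>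
        TensorProduct.map (Q.tensorSign p Z Y) (D X Z)
          + TensorProduct.map (D Z Y) LinearMap.id)
      = map₂ (fun X => X) (fun Z => Q.tensorSign p Z Y) (fun Z => D X Z)
        + map₂ (fun X => X) (fun Z => D Z Y) (fun Z => LinearMap.id) := by
    refine TBar₂.hom_ext fun Z x y => ?_
    rw [LinearMap.add_apply, map₂_pure₂, map₂_pure₂]
    simp [pure₂]
  change (_ ∧ ∀ X Y, _ = _) ↔ _
  refine and_congr_right fun _ => forall_congr' fun X => forall_congr' fun Y => ?_
  rw [e, LinearMap.ext_iff]
  rfl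

namespace IsCoderAlong

variable {o : Q.Ob → Q'.Ob} {A B K : ∀ X Y : Q.Ob, Q.TBar X Y →ₗ[R] Q'.TBar (o X) (o Y)}

lemma sub {K' : ∀ X Y : Q.Ob, Q.TBar X Y →ₗ[R] Q'.TBar (o X) (o Y)}
    (h : IsCoderAlong o A B K) (h' : IsCoderAlong o A B K') :
    IsCoderAlong o A B fun X Y => K X Y - K' X Y := fun X Y x => by
  rw [LinearMap.sub_apply, map_sub, h, h', map₂_sub_left, map₂_sub_right]
  simp only [LinearMap.sub_apply]
  abel

lemma comul_tprod_eq (h : IsCoderAlong o A B K) {X Y : Q.Ob} (s : Str Q X Y) :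
    Q'.comul _ _ (K X Y (tprod s)) = s.sum₂ fun Z a b =>
      (pure₂ (o Z) (A Z Y (tprod a)) (K X Z (tprod b)) +
        pure₂ (o Z) (K Z Y (tprod a)) (B X Z (tprod b))) := by
  rw [h, map₂_comul, map₂_comul, ← Str.sum₂_add]

lemma comul_eq_zero (h : IsCoderAlong o A B K) {n : ℕ}
    (h₀ : ∀ X Y, ∀ x ∈ Q.weightLE n X Y, K X Y x = 0) {X Y : Q.Ob} {x : Q.TBar X Y}
    (hx : x ∈ Q.weightLE (n + 1) X Y) : Q'.comul _ _ (K X Y x) = 0 := by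
  refine eq_zero_of_mem_weightLE (l := Q'.comul _ _ ∘ₗ K X Y) (fun s _ _ hs => ?_) hx
  rw [LinearMap.comp_apply, h.comul_tprod_eq, ← Str.sum₂_zero s]
  refine Str.sum₂_congr s fun Z a b hab => ?_
  have hl : a.length + b.length ≤ n + 1 := by rwa [← Str.length_append, hab]
  have ha : K Z Y (tprod a) = 0 ∨ tprod b = 0 := by
    by_cases hb : b.length = 0
    · exact .inr (tprod_of_length_eq_zero b hb)
    · exact .inl (h₀ _ _ _ (tprod_mem_weightLE (by omega)))
  have hb : K X Z (tprod b) = 0 ∨ tprod a = 0 := by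
    by_cases ha : a.length = 0
    · exact .inr (tprod_of_length_eq_zero a ha)
    · exact .inl (h₀ _ _ _ (tprod_mem_weightLE (by omega)))
  rcases ha with ha | ha <;> rcases hb with hb | hb <;> simp [ha, hb]

variable [Algebra ℚ R]

/-- A coderivation takes values in weight one on the first weight on which it does not vanish. -/
lemma eq_incl (h : IsCoderAlong o A B K) {n : ℕ}
    (h₀ : ∀ X Y, ∀ x ∈ Q.weightLE n X Y, K X Y x = 0) {X Y : Q.Ob} {x : Q.TBar X Y}
    (hx : x ∈ Q.weightLE (n + 1) X Y) : K X Y x = incl _ _ (corestrict _ _ (K X Y x)) := by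
  conv_lhs => rw [eq_incl_add_concat (K X Y x), h.comul_eq_zero h₀ hx]
  rw [map_zero, map_zero, add_zero]

/-- A coderivation is determined by its corestriction, on each step of the weight filtration. -/
lemma eq_zero_of_corestrict (h : IsCoderAlong o A B K) {n : ℕ}
    (h₀ : ∀ (X Y : Q.Ob) (s : Str Q X Y) (q : ℤ), s.HasDeg q → s.length ≤ n →
      corestrict _ _ (K X Y (tprod s)) = 0) {X Y : Q.Ob} {x : Q.TBar X Y}
    (hx : x ∈ Q.weightLE n X Y) : K X Y x = 0 := by
  induction n generalizing X Y with
  | zero =>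
    rw [weightLE_zero, Submodule.mem_bot] at hx
    rw [hx, map_zero]
  | succ n ih =>
    rw [h.eq_incl (fun X Y x hx => ih (fun X Y s q hs hl => h₀ X Y s q hs (by omega)) hx) hx,
      ← LinearMap.comp_apply (corestrict _ _),
      eq_zero_of_mem_weightLE (l := corestrict _ _ ∘ₗ K X Y) (h₀ X Y) hx, map_zero]

end IsCoderAlong

/-! ### The Lie algebra of coderivations -/

/-- The commutator of families of endomorphisms. -/
def bracket (D D' : Q.TEnd) : Q.TEnd := fun X Y => D X Y ∘ₗ D' X Y - D' X Y ∘ₗ D X Y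

lemma bracket_apply (D D' : Q.TEnd) {X Y : Q.Ob} (x : Q.TBar X Y) :
    bracket D D' X Y x = D X Y (D' X Y x) - D' X Y (D X Y x) := rfl

lemma tensorSign_comm {K : Q.TEnd}
    (hK : ∀ (q : ℤ) (X Y : Q.Ob), ∀ x ∈ Q.tensorDeg q X Y, K X Y x ∈ Q.tensorDeg q X Y) (a : ℤ)
    (X Y : Q.Ob) : Q.tensorSign a X Y ∘ₗ K X Y = K X Y ∘ₗ Q.tensorSign a X Y :=
  hom_ext_homogeneous fun s q hs => by
    have h := tprod_mem_tensorDeg hs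
    rw [LinearMap.comp_apply, LinearMap.comp_apply, tensorSign_of_mem a h, map_zsmul,
      tensorSign_of_mem a (hK _ _ _ _ h)]

lemma bracket_mem_coDer {p : ℤ} {D τ : Q.TEnd} (hD : D ∈ Q.coDer p) (hτ : τ ∈ Q.coDer 0) :
    bracket D τ ∈ Q.coDer p := by
  rw [mem_coDer_iff] at hD hτ ⊢
  have hτ' : ∀ (q : ℤ) (X Y : Q.Ob), ∀ x ∈ Q.tensorDeg q X Y, τ X Y x ∈ Q.tensorDeg q X Y := by
    simpa using hτ.1
  refine ⟨fun q X Y x hx => sub_mem (hD.1 _ _ _ _ (hτ' _ _ _ _ hx)) (hτ' _ _ _ _ (hD.1 _ _ _ _ hx)),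
    fun X Y x => ?_⟩
  have h₀ : Q.tensorSign 0 = fun X Y => LinearMap.id := by
    funext X Y; exact tensorSign_zero X Y
  simp only [bracket_apply, map_sub, hD.2 X Y, hτ.2 X Y, map_add, map₂_map₂, h₀,
    LinearMap.comp_id, LinearMap.id_comp]
  simp only [bracket, map₂_sub_left, map₂_sub_right, LinearMap.sub_apply]
  have hc : (fun Z => Q.tensorSign p Z Y ∘ₗ τ Z Y) = fun Z => τ Z Y ∘ₗ Q.tensorSign p Z Y := by
    funext Z; exact tensorSign_comm hτ' p Z Y
  simp only [hc]
  abel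

/-- A coderivation that vanishes on weights `≤ k` lowers all weights by `k`. -/
lemma coDer_lowers_weight [Algebra ℚ R] {p : ℤ} {D : Q.TEnd} (hD : D ∈ Q.coDer p) {k : ℕ}
    (h₀ : ∀ X Y, ∀ x ∈ Q.weightLE k X Y, D X Y x = 0) {m : ℕ} {X Y : Q.Ob} {x : Q.TBar X Y}
    (hx : x ∈ Q.weightLE m X Y) : D X Y x ∈ Q.weightLE (m - k) X Y := by
  rw [mem_coDer_iff] at hD
  induction m using Nat.strong_induction_on generalizing X Y with
  | _ m ih =>
    rcases Nat.lt_or_ge k m with hm | hm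
    swap
    · rw [h₀ X Y x (weightLE_mono hm _ _ hx)]
      exact zero_mem _
    refine (weightLE_le (S := (Q.weightLE (m - k) X Y).comap (D X Y)) fun s _ _ hs => ?_) hx
    rw [Submodule.mem_comap, eq_incl_add_concat (D X Y (tprod s))]
    refine add_mem (incl_mem_weightLE _ (by omega)) (divWeight_mem_weightLE ?_)
    rw [hD.2.comul_tprod_eq, Str.map_sum₂]
    refine Str.sum₂_mem _ s fun Z a b hab => ?_
    have hl : a.length + b.length ≤ m := by rwa [← Str.length_append, hab]
    rw [map_add, concat_pure₂, concat_pure₂]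
    by_cases ha' : a.length = 0
    · simp [tprod_of_length_eq_zero a ha']
    by_cases hb' : b.length = 0
    · simp [tprod_of_length_eq_zero b hb']
    refine add_mem ?_ ?_
    · rcases Nat.lt_or_ge k b.length with hb | hb
      · exact weightLE_mono (by omega) _ _
          (mul_mem_weightLE (tensorSign_mem_weightLE p (tprod_mem_weightLE (le_refl a.length)))
            (ih b.length (by omega) (tprod_mem_weightLE le_rfl)))
      · rw [h₀ _ _ _ (tprod_mem_weightLE hb), map_zero]
        exact zero_mem _
    · rcases Nat.lt_or_ge k a.length with hb | hb
      · exact weightLE_mono (by omega) _ _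
          (mul_mem_weightLE (ih a.length (by omega) (tprod_mem_weightLE le_rfl))
            (tprod_mem_weightLE (le_refl b.length)))
      · rw [h₀ _ _ _ (tprod_mem_weightLE hb), map_zero, LinearMap.zero_apply]
        exact zero_mem _

lemma coDer_preserves_weight [Algebra ℚ R] {p : ℤ} {D : Q.TEnd} (hD : D ∈ Q.coDer p) {m : ℕ}
    {X Y : Q.Ob} {x : Q.TBar X Y} (hx : x ∈ Q.weightLE m X Y) : D X Y x ∈ Q.weightLE m X Y :=
  coDer_lowers_weight hD (k := 0) (fun X Y x hx => by
    rw [weightLE_zero, Submodule.mem_bot] at hx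
    rw [hx, map_zero]) hx

/-! ### Coderivations with prescribed components -/

section coderOf

variable (p : ℤ) (φ : ∀ {X Y : Q.Ob}, Str Q X Y → Q.Mor X Y)
  (hφ : ∀ X Y : Q.Ob, Str.IsMultilinear (φ : Str Q X Y → Q.Mor X Y))
  (h₀ : ∀ X : Q.Ob, φ (Str.nil : Str Q X X) = 0)

lemma coderOf_tprod {X Y : Q.Ob} (s : Str Q X Y) :
    coderOf p φ hφ h₀ X Y (tprod s) = s.sum₃ fun _ _ a b c =>
      tprod ((a.map (Q.signMap (-1) p)).append (Str.cons (φ b) c)) := lift_tprod _ _ _ s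

lemma corestrict_coderOf {X Y : Q.Ob} (s : Str Q X Y) :
    corestrict X Y (coderOf p φ hφ h₀ X Y (tprod s)) = φ s := by
  rw [coderOf_tprod, Str.map_sum₃]
  simp only [corestrict_tprod, Str.sum₃]
  cases s with
  | nil =>
    simp only [Str.sum₂_nil, h₀]
    rfl
  | cons f t =>
    rw [Str.sum₂_cons]
    simp only [Str.map_nil, Str.nil_append]
    rw [Str.sum₂_entry (Str.cons f t) fun Y b => φ b]
    refine add_eq_left.2 (.trans (Str.sum₂_congr t fun Y a r _ => ?_) (Str.sum₂_zero t))
    refine (Str.sum₂_congr r fun Y a c _ => ?_).trans (Str.sum₂_zero r)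
    exact Str.entry_of_length_ne_one _ (by simp)

lemma isCoderAlong_coderOf :
    IsCoderAlong (fun X => X) (Q.tensorSign p) (fun _ _ => LinearMap.id)
      (coderOf p φ hφ h₀) := fun X Y x => by
  refine LinearMap.congr_fun (f := Q.comul X Y ∘ₗ coderOf p φ hφ h₀ X Y)
    (g := map₂ (fun X => X) (fun Z => Q.tensorSign p Z Y) (fun Z => coderOf p φ hφ h₀ X Z)
        ∘ₗ Q.comul X Y
      + map₂ (fun X => X) (fun Z => coderOf p φ hφ h₀ Z Y) (fun Z => LinearMap.id)
        ∘ₗ Q.comul X Y) (hom_ext fun s => ?_) x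
  rw [LinearMap.comp_apply, LinearMap.add_apply, LinearMap.comp_apply, LinearMap.comp_apply,
    map₂_comul, map₂_comul, coderOf_tprod, Str.map_sum₃]
  simp only [comul_tprod, Str.sum₂_append_cons, Str.sum₃_add, Str.sum₂_map]
  rw [Str.sum₃_sum₂_left s fun Y Y' Y'' a₁ a₂ b c =>
      pure₂ Y'' (tprod (a₁.map (Q.signMap (-1) p)))
        (tprod ((a₂.map (Q.signMap (-1) p)).append (Str.cons (φ b) c))),
    Str.sum₃_sum₂_right s fun Y Y' Y'' a b c₁ c₂ =>
      pure₂ Y (tprod ((a.map (Q.signMap (-1) p)).append (Str.cons (φ b) c₁))) (tprod c₂)]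
  congr 1
  · refine Str.sum₂_congr s fun Z a r _ => ?_
    rw [coderOf_tprod, Str.map_sum₃, tensorSign_tprod]
  · refine Str.sum₂_congr s fun Z r c _ => ?_
    rw [coderOf_tprod, ← LinearMap.flip_apply (pure₂ Z), Str.map_sum₃]
    rfl

lemma coderOf_mem_coDer
    (hd : ∀ {X Y : Q.Ob} (s : Str Q X Y) (q : ℤ), s.HasDeg q →
      φ s ∈ Q.gr X Y (q + (p + 1) - s.length)) :
    coderOf p φ hφ h₀ ∈ Q.coDer p := by
  refine mem_coDer_iff.2 ⟨fun q X Y x hx => ?_, isCoderAlong_coderOf p φ hφ h₀⟩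
  refine (tensorDeg_le (S := (Q.tensorDeg (q + p) X Y).comap _) fun s r hs hr => ?_) hx
  rw [Submodule.mem_comap, coderOf_tprod]
  refine Str.sum₃_mem _ s fun Y Y' a b c habc => ?_
  have hl : a.length + (b.length + c.length) = s.length := by
    rw [← habc, Str.length_append, Str.length_append]
  obtain ⟨i, j, hi, hj, hij⟩ := (habc ▸ hs).of_append
  obtain ⟨k, l, hk, hl', hkl⟩ := hj.of_append
  have := tprod_mem_tensorDeg ((hi.map_signMap (-1) p).append (.cons (hd b k hk) hl'))
  convert this using 2
  simp only [Str.length_append, Str.length_map, Str.length_cons]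
  push_cast
  omega

end coderOf

/-! ### The Euler coderivation -/

variable (Q) in
/-- Multiplication by the degree on a morphism module. -/
def degMap (X Y : Q.Ob) : Q.Mor X Y →ₗ[R] Q.Mor X Y :=
  DirectSum.lmap fun p : ℤ => p • (LinearMap.id : Q.Hom X Y p →ₗ[R] Q.Hom X Y p)

lemma degMap_of_mem {X Y : Q.Ob} {p : ℤ} {f : Q.Mor X Y} (hf : f ∈ Q.gr X Y p) :
    Q.degMap X Y f = p • f := by
  obtain ⟨x, rfl⟩ := hf
  rw [degMap, DirectSum.lmap_lof, LinearMap.smul_apply, LinearMap.id_apply, map_zsmul]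

variable (Q) in
/-- The Euler coderivation: multiplication by the total degree of a string, before the shift. -/
def euler : Q.TEnd :=
  coderOf 0 (fun s => Q.degMap _ _ s.entry)
    (fun X Y => (Str.isMultilinear_entry X Y).linear_comp (Q.degMap X Y))
    fun X => by rw [Str.entry_nil, map_zero]

lemma euler_mem_coDer : Q.euler ∈ Q.coDer 0 :=
  coderOf_mem_coDer _ _ _ _ fun {X Y} s q hs => by
    have h := corestrict_mem_gr (tprod_mem_tensorDeg hs)
    rw [corestrict_tprod] at h
    rw [degMap_of_mem h]
    convert zsmul_mem h _ using 2
    ring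

lemma sum₃_degMap {X Y : Q.Ob} {s : Str Q X Y} {q : ℤ} (hs : s.HasDeg q)
    {M : Type*} [AddCommGroup M] [Module R M] {Φ : Str Q X Y → M} (hΦ : Str.IsMultilinear Φ) :
    (s.sum₃ fun _ _ a b c => Φ (a.append (Str.cons (Q.degMap _ _ b.entry) c))) = q • Φ s := by
  induction hs with
  | nil =>
    simp only [Str.sum₃, Str.sum₂_nil, Str.entry_nil, map_zero, Str.nil_append, zero_smul]
    exact hΦ.head_zero _
  | @cons X' Y' f t p q hf ht ih =>
    have e : (t.sum₂ fun _ b c => Φ (Str.cons (Q.degMap _ _ (Str.cons f b).entry) c))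
        = Φ (Str.cons (Q.degMap _ _ f) t) := by
      cases t with
      | nil => rw [Str.sum₂_nil]; rfl
      | cons g u =>
        rw [Str.sum₂_cons]
        refine add_eq_left.2 (.trans (Str.sum₂_congr u fun Y a r _ => ?_) (Str.sum₂_zero u))
        rw [Str.entry_of_length_ne_one _ (by simp), map_zero, hΦ.head_zero]
    rw [Str.sum₃, Str.sum₂_cons, Str.sum₂_cons]
    simp only [Str.nil_append, Str.entry_nil, map_zero, hΦ.head_zero, zero_add]
    rw [e, degMap_of_mem hf, hΦ.head_zsmul, add_smul]
    congr 1
    exact ih (hΦ.cons_left f)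

lemma euler_tprod {X Y : Q.Ob} {s : Str Q X Y} {q : ℤ} (hs : s.HasDeg q) :
    Q.euler X Y (tprod s) = q • tprod s := by
  refine (coderOf_tprod _ _ _ _ s).trans ?_
  rw [← sum₃_degMap hs (isMultilinear_tprod X Y)]
  have h : Q.signMap (-1) 0 = fun _ _ => LinearMap.id := by
    funext X Y; exact signMap_zero _ X Y
  simp only [h, Str.map_id]

lemma euler_incl {X Y : Q.Ob} {p : ℤ} {f : Q.Mor X Y} (hf : f ∈ Q.gr X Y p) :
    Q.euler X Y (incl X Y f) = p • incl X Y f := by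
  have h := euler_tprod (.cons hf (.nil X))
  rwa [add_zero] at h

end GradedQuiver

namespace AInfCategory

open GradedQuiver TBar

variable {R : Type u} [CommRing R] (C : AInfCategory.{u, v, w} R)

/-! ### The codifferential and the Kaledin cochain -/

lemma d_deg {X Y : C.Ob} (s : Str C.toGradedQuiver X Y) (q : ℤ) (hs : s.HasDeg q) :
    C.d s ∈ C.gr X Y (q + (1 + 1) - s.length) := by
  have h := C.m_deg _ _ hs.desuspend
  rw [Str.length_desuspend] at h
  exact neg_mem h

lemma barD_tprod {X Y : C.Ob} (s : Str C.toGradedQuiver X Y) :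
    C.barD X Y (tprod s) = s.sum₃ fun _ _ a b c =>
      tprod ((a.map (C.signMap (-1) 1)).append (Str.cons (C.d b) c)) :=
  coderOf_tprod _ _ _ _ s

lemma kaledin_tprod {X Y : C.Ob} (s : Str C.toGradedQuiver X Y) :
    C.kaledin X Y (tprod s) = s.sum₃ fun _ _ a b c =>
      tprod ((a.map (C.signMap (-1) 1)).append (Str.cons (((b.length - 2 : ℕ) : R) • C.d b) c)) :=
  coderOf_tprod _ _ _ _ s

lemma corestrict_barD {X Y : C.Ob} (s : Str C.toGradedQuiver X Y) :
    corestrict X Y (C.barD X Y (tprod s)) = C.d s :=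
  corestrict_coderOf _ _ _ _ s

lemma barD_mem_coDer : C.barD ∈ C.coDer 1 :=
  coderOf_mem_coDer _ _ _ _ fun s q hs => C.d_deg s q hs

lemma hochD_zero (τ : C.TEnd) : C.hochD 0 τ = bracket C.barD τ := by
  funext X Y
  simp [hochD, bracket]

variable {C}

lemma d_of_length_le_one (hC : C.IsMinimal) {X Y : C.Ob} (s : Str C.toGradedQuiver X Y)
    (hs : s.length ≤ 1) : C.d s = 0 := by
  rw [d, C.m_of_length_le_one hC _ (by simpa using hs), neg_zero]

/-- For minimal `𝒞`, the codifferential vanishes on weight one. -/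
lemma barD_vanish (hC : C.IsMinimal) {X Y : C.Ob} {x : C.TBar X Y} (hx : x ∈ C.weightLE 1 X Y) :
    C.barD X Y x = 0 := by
  refine eq_zero_of_mem_weightLE (fun s _ _ hs => ?_) hx
  rw [barD_tprod, ← Str.sum₃_zero s]
  refine Str.sum₃_congr s fun Y Y' a b c habc => ?_
  have hl : a.length + (b.length + c.length) = s.length := by
    rw [← habc, Str.length_append, Str.length_append]
  rw [d_of_length_le_one hC b (by omega)]
  simpa using (isMultilinear_tprod _ _).map_smul (a.map (C.signMap (-1) 1)) (0 : R) 0 c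

/-- The Kaledin cochain is the coboundary of the Euler coderivation, which is not in `W₂`. -/
lemma bracket_barD_euler (hC : C.IsMinimal) : bracket C.barD C.euler = C.kaledin := by
  funext X Y
  refine hom_ext_homogeneous fun s q hs => ?_
  rw [bracket_apply, euler_tprod hs, map_zsmul, barD_tprod, kaledin_tprod, Str.map_sum₃,
    sub_eq_iff_eq_add, ← Str.sum₃_add, ← LinearMap.id_apply (R := R) (Str.sum₃ s _)]
  have e (z : ℤ) (x : C.TBar X Y) : z • x = (z • (LinearMap.id : C.TBar X Y →ₗ[R] _)) x := rfl
  rw [LinearMap.id_apply, e q, Str.map_sum₃]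
  refine Str.sum₃_congr s fun Y Y' a b c habc => ?_
  obtain ⟨i, j, hi, hj, hij⟩ := (habc ▸ hs).of_append
  obtain ⟨k, l, hk, hl, hkl⟩ := hj.of_append
  rw [euler_tprod ((hi.map_signMap (-1) 1).append (.cons (C.d_deg b k hk) hl)),
    (isMultilinear_tprod _ _).map_smul, ← e]
  rcases Nat.lt_or_ge b.length 2 with hb | hb
  · have h0 : (tprod ((a.map (C.signMap (-1) 1)).append (Str.cons (0 : C.Mor _ _) c))
        : C.TBar X _) = 0 := by
      simpa using (isMultilinear_tprod _ _).map_smul (a.map (C.signMap (-1) 1)) (0 : R) 0 c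
    rw [d_of_length_le_one hC b (by omega), h0]
    simp
  · rw [Nat.cast_smul_eq_nsmul, ← natCast_zsmul, ← add_smul]
    congr 1
    push_cast [hb]
    omega

lemma kaledin_mem_coDer (hC : C.IsMinimal) : C.kaledin ∈ C.coDer 1 := by
  rw [← bracket_barD_euler hC]
  exact bracket_mem_coDer C.barD_mem_coDer euler_mem_coDer

lemma kaledin_vanish {X Y : C.Ob} {x : C.TBar X Y} (hx : x ∈ C.weightLE 2 X Y) :
    C.kaledin X Y x = 0 := by
  refine eq_zero_of_mem_weightLE (fun s _ _ hs => ?_) hx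
  rw [kaledin_tprod, ← Str.sum₃_zero s]
  refine Str.sum₃_congr s fun Y Y' a b c habc => ?_
  have hl : a.length + (b.length + c.length) = s.length := by
    rw [← habc, Str.length_append, Str.length_append]
  rw [(isMultilinear_tprod _ _).map_smul, Nat.sub_eq_zero_of_le (by omega), Nat.cast_zero,
    zero_smul]

end AInfCategory

namespace GradedQuiver

open TBar

variable {R : Type u} [CommRing R] {Q : GradedQuiver.{u, v, w} R}

/-! ### Brackets and limits of coderivations -/

lemma bracket_jacobi (D σ δ : Q.TEnd) :
    bracket D (bracket σ δ) = bracket (bracket D σ) δ - bracket (bracket D δ) σ := by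
  funext X Y
  ext x
  simp only [bracket_apply, Pi.sub_apply, LinearMap.sub_apply, map_sub]
  abel

lemma bracket_add_left (D D' δ : Q.TEnd) :
    bracket (D + D') δ = bracket D δ + bracket D' δ := by
  funext X Y
  ext x
  simp only [bracket_apply, Pi.add_apply, LinearMap.add_apply, map_add]
  abel

lemma bracket_sub_right (D δ δ' : Q.TEnd) :
    bracket D (δ - δ') = bracket D δ - bracket D δ' := by
  funext X Y
  ext x
  simp only [bracket_apply, Pi.sub_apply, LinearMap.sub_apply, map_sub]
  abel

lemma bracket_smul_right (r : R) (D δ : Q.TEnd) :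
    bracket D (r • δ) = r • bracket D δ := by
  funext X Y
  ext x
  simp only [bracket_apply, Pi.smul_apply, LinearMap.smul_apply, map_smul, smul_sub]

/-- Coderivations that stabilize on each weight have a limit. -/
lemma ofWeights_mem_coDer {t : ℕ → Q.TEnd} (ht : ∀ n, t n ∈ Q.coDer 0)
    (hs : ∀ (m n : ℕ), m ≤ n → ∀ (X Y : Q.Ob) (s : Str Q X Y), s.length = m →
      t n X Y (tprod s) = t m X Y (tprod s)) :
    (fun X Y => ofWeights fun n => t n X Y) ∈ Q.coDer 0 := by
  refine mem_coDer_iff.2 ⟨fun q X Y x hx => ?_, fun X Y x => ?_⟩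
  · refine (tensorDeg_le (S := (Q.tensorDeg (q + 0) X Y).comap _) fun s r hs hr => ?_) hx
    rw [Submodule.mem_comap, ofWeights_tprod]
    exact (mem_coDer_iff.1 (ht _)).1 _ _ _ _ (hr ▸ tprod_mem_tensorDeg hs)
  · refine LinearMap.congr_fun (f := Q.comul X Y ∘ₗ _) (g := map₂ _ _ _ ∘ₗ Q.comul X Y
      + map₂ _ _ _ ∘ₗ Q.comul X Y) (hom_ext fun s => ?_) x
    rw [LinearMap.comp_apply, LinearMap.add_apply, LinearMap.comp_apply, LinearMap.comp_apply,
      ofWeights_tprod, (mem_coDer_iff.1 (ht s.length)).2.comul_tprod_eq, map₂_comul, map₂_comul,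
      ← Str.sum₂_add]
    refine Str.sum₂_congr s fun Z a b hab => ?_
    have hl : a.length + b.length = s.length := by rw [← hab, Str.length_append]
    rw [ofWeights_tprod, ofWeights_tprod, hs a.length s.length (by omega) _ _ a rfl,
      hs b.length s.length (by omega) _ _ b rfl]

end GradedQuiver

namespace AInfCategory

open GradedQuiver TBar

variable {R : Type u} [CommRing R] {C : AInfCategory.{u, v, w} R}

/-! ### Kaledin classes and their truncations -/

lemma weightCC_mono {m n : ℕ} (h : m ≤ n) (p : ℤ) : C.weightCC n p ≤ C.weightCC m p :=
  fun _ hD => ⟨hD.1, fun X Y x hx => hD.2 X Y x (weightLE_mono (by omega) X Y hx)⟩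

variable [Algebra ℚ R]

lemma bracket_mem_weightCC {k : ℕ} {p : ℤ} {D δ : C.TEnd} (hD : D ∈ C.weightCC k p)
    (hδ : δ ∈ C.coDer 0) : bracket D δ ∈ C.weightCC k p :=
  ⟨bracket_mem_coDer hD.1 hδ, fun X Y x hx => by
    rw [bracket_apply, hD.2 _ _ _ hx, hD.2 _ _ _ (coDer_preserves_weight hδ hx), map_zero,
      sub_zero]⟩

lemma bracket_mem_weightCC_succ {k : ℕ} {p : ℤ} {D τ : C.TEnd} (hD : D ∈ C.weightCC (k + 1) p)
    (hτ : τ ∈ C.weightCC 2 0) : bracket D τ ∈ C.weightCC (k + 2) p :=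
  ⟨bracket_mem_coDer hD.1 hτ.1, fun X Y x hx => by
    rw [bracket_apply, hD.2 _ _ _ (coDer_lowers_weight hτ.1 (k := 1) hτ.2 hx),
      hτ.2 _ _ _ (weightLE_mono (by omega) _ _ (coDer_lowers_weight hD.1 (k := k) hD.2 hx)),
      sub_zero]⟩

/-- On a coderivation of degree `p` in `W_{k+1}`, the bracket with the Euler coderivation is
multiplication by `k - p`, modulo `W_{k+2}`. -/
lemma bracket_euler {k : ℕ} {p : ℤ} {D : C.TEnd} (hD : D ∈ C.weightCC (k + 1) p) :
    bracket D C.euler - (k - p) • D ∈ C.weightCC (k + 2) p := by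
  refine ⟨sub_mem (bracket_mem_coDer hD.1 euler_mem_coDer) (zsmul_mem hD.1 _), fun X Y x hx => ?_⟩
  refine eq_zero_of_mem_weightLE (fun s q hs hl => ?_) hx
  have hdeg : D X Y (tprod s) ∈ C.tensorDeg (q - s.length + p) X Y :=
    (mem_coDer_iff.1 hD.1).1 _ _ _ _ (tprod_mem_tensorDeg hs)
  rw [Pi.sub_apply, Pi.sub_apply, LinearMap.sub_apply, bracket_apply, euler_tprod hs, map_zsmul,
    Pi.smul_apply, Pi.smul_apply, LinearMap.smul_apply]
  rcases Nat.lt_or_ge k s.length with h | h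
  · have h1 := (mem_coDer_iff.1 hD.1).2.eq_incl (n := k) hD.2 (tprod_mem_weightLE (s := s) hl)
    have hk : s.length = k + 1 := by omega
    have h2 : C.euler X Y (D X Y (tprod s)) = (q - k + p) • D X Y (tprod s) := by
      rw [h1, euler_incl (corestrict_mem_gr hdeg)]
      congr 1
      rw [hk]
      push_cast
      ring
    rw [h2, ← sub_smul, ← sub_smul]
    convert zero_smul ℤ _
    ring
  · rw [hD.2 _ _ _ (tprod_mem_weightLE (by omega))]
    simp

lemma bracket_euler_sub {k : ℕ} {p : ℤ} {D τ : C.TEnd} (hD : D ∈ C.weightCC (k + 1) p)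
    (hτ : τ ∈ C.weightCC 2 0) :
    bracket D (C.euler - τ) - (k - p) • D ∈ C.weightCC (k + 2) p := by
  rw [bracket_sub_right, sub_right_comm]
  exact sub_mem (bracket_euler hD) (bracket_mem_weightCC_succ hD hτ)

/-- Let `δ` lift the Euler coderivation up to an obstruction `c = [d, δ]` in `W_{n+1}`. If `-c` is
the coboundary of some element of `W₂` modulo `W_{n+2}`, then it is the coboundary of an element
of `W_{k+2}`, whenever `k + 2 ≤ n`: the operator `[-, δ] - (k + 1)` takes degree zero elements of
`W_{k+2}` into `W_{k+3}`, and multiplies `c` by `n - 2 - k` modulo `W_{n+2}`, which is invertible if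
`k + 3 ≤ n`. -/
lemma exists_primitive_of_weight {n : ℕ} {τ σ : C.TEnd} (hτ : τ ∈ C.weightCC 2 0)
    (hc : bracket C.barD (C.euler - τ) ∈ C.weightCC (n + 1) 1) (hσ : σ ∈ C.weightCC 2 0)
    (hσc : bracket C.barD σ + bracket C.barD (C.euler - τ) ∈ C.weightCC (n + 2) 1)
    (k : ℕ) (hk : k + 2 ≤ n) :
    ∃ σ' ∈ C.weightCC (k + 2) 0,
      bracket C.barD σ' + bracket C.barD (C.euler - τ) ∈ C.weightCC (n + 2) 1 := by
  induction k with
  | zero => exact ⟨σ, hσ, hσc⟩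
  | succ k ih =>
    obtain ⟨σ, hσ, hσc⟩ := ih (by omega)
    have hδ : C.euler - τ ∈ C.coDer 0 := sub_mem euler_mem_coDer hτ.1
    set δ := C.euler - τ with hδ_def
    set c := bracket C.barD δ with hc_def
    set w := bracket C.barD σ + c with hw_def
    have hρ : bracket σ δ - (((k + 1 : ℕ) : ℤ) - 0) • σ ∈ C.weightCC (k + 1 + 2) 0 :=
      bracket_euler_sub (k := k + 1) hσ hτ
    rw [sub_zero] at hρ
    set ρ := bracket σ δ - ((k + 1 : ℕ) : ℤ) • σ with hρ_def
    -- The coboundary of `ρ` is `-(n - 2 - k) c` up to terms of higher weight.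
    have e : bracket C.barD ρ + ((n : ℤ) - 1 - (k + 1 : ℕ)) • c
        = bracket w δ - (bracket c δ - ((n : ℤ) - 1) • c) - bracket c σ
          - ((k + 1 : ℕ) : ℤ) • w := by
      have hz : bracket C.barD (((k + 1 : ℕ) : ℤ) • σ)
          = ((k + 1 : ℕ) : ℤ) • bracket C.barD σ := by
        simpa only [Int.cast_smul_eq_zsmul] using
          bracket_smul_right (((k + 1 : ℕ) : ℤ) : R) C.barD σ
      rw [hρ_def, bracket_sub_right, bracket_jacobi, hz, hw_def, bracket_add_left, sub_smul,
        smul_add]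
      abel
    have hw : bracket C.barD ρ + ((n : ℤ) - 1 - (k + 1 : ℕ)) • c ∈ C.weightCC (n + 2) 1 := by
      rw [e]
      refine sub_mem (sub_mem (sub_mem (bracket_mem_weightCC hσc hδ) (bracket_euler_sub hc hτ))
        (bracket_mem_weightCC_succ hc (weightCC_mono (by omega) 0 hσ))) (zsmul_mem hσc _)
    set r : R := algebraMap ℚ R ((n : ℚ) - 1 - (k + 1 : ℕ))⁻¹ with hr
    have hn0 : ((n : ℚ) - 1 - (k + 1 : ℕ)) ≠ 0 := by
      have : ((k + 1 + 2 : ℕ) : ℚ) ≤ n := by exact_mod_cast hk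
      push_cast at this ⊢
      intro h
      linarith
    have hr1 : r * (((n : ℤ) - 1 - (k + 1 : ℕ) : ℤ) : R) = 1 := by
      have hz : (((n : ℤ) - 1 - (k + 1 : ℕ) : ℤ) : ℚ) = (n : ℚ) - 1 - (k + 1 : ℕ) := by
        push_cast; rfl
      rw [hr, ← map_intCast (algebraMap ℚ R), ← map_mul, hz, inv_mul_cancel₀ hn0, map_one]
    refine ⟨r • ρ, Submodule.smul_mem _ r hρ, ?_⟩
    have e2 : bracket C.barD (r • ρ) + c
        = r • (bracket C.barD ρ + ((n : ℤ) - 1 - (k + 1 : ℕ)) • c) := by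
      rw [bracket_smul_right, smul_add, ← Int.cast_smul_eq_zsmul R, smul_smul, hr1, one_smul]
    rw [e2]
    exact Submodule.smul_mem _ r hw

/-- Primitives of the truncated Kaledin classes can be improved without changing them in low
weights. -/
lemma exists_primitive_succ (hC : C.IsMinimal) {n : ℕ} (hn : 2 ≤ n) {τ τ' : C.TEnd}
    (hτ : τ ∈ C.weightCC 2 0) (h : bracket C.barD τ - C.kaledin ∈ C.weightCC (n + 1) 1)
    (hτ' : τ' ∈ C.weightCC 2 0) (h' : bracket C.barD τ' - C.kaledin ∈ C.weightCC (n + 2) 1) :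
    ∃ τ'' ∈ C.weightCC 2 0, bracket C.barD τ'' - C.kaledin ∈ C.weightCC (n + 2) 1 ∧
      τ'' - τ ∈ C.weightCC n 0 := by
  have hc : bracket C.barD (C.euler - τ) = -(bracket C.barD τ - C.kaledin) := by
    rw [bracket_sub_right, bracket_barD_euler hC, neg_sub]
  obtain ⟨σ, hσ, hσc⟩ := exists_primitive_of_weight (n := n) (σ := τ - τ') hτ
    (by rw [hc]; exact neg_mem h) (sub_mem hτ hτ') (by
      have e : bracket C.barD (τ - τ') + bracket C.barD (C.euler - τ)
          = -(bracket C.barD τ' - C.kaledin) := by rw [hc, bracket_sub_right]; abel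
      rw [e]
      exact neg_mem h') (n - 2) (by omega)
  rw [Nat.sub_add_cancel hn] at hσ
  refine ⟨τ - σ, sub_mem hτ (weightCC_mono hn 0 hσ), ?_, ?_⟩
  · have e : bracket C.barD (τ - σ) - C.kaledin
        = -(bracket C.barD σ + bracket C.barD (C.euler - τ)) := by
      rw [hc, bracket_sub_right]; abel
    rw [e]
    exact neg_mem hσc
  · rw [sub_sub_cancel_left]
    exact neg_mem hσ

theorem kaledinClassVanishes_of_truncated (hC : C.IsMinimal)
    (h : ∀ n : ℕ, 3 ≤ n → C.TruncatedKaledinClassVanishes n) : C.KaledinClassVanishes := by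
  simp only [TruncatedKaledinClassVanishes, KaledinClassVanishes, hochD_zero] at h ⊢
  let S (i : ℕ) : Type _ :=
    {τ : C.TEnd // τ ∈ C.weightCC 2 0 ∧ bracket C.barD τ - C.kaledin ∈ C.weightCC (i + 2 + 1) 1}
  have step (i : ℕ) (τ : S i) : ∃ τ' : S (i + 1), τ'.1 - τ.1 ∈ C.weightCC (i + 2) 0 := by
    obtain ⟨τ', hτ', h'⟩ := h (i + 3) (by omega)
    obtain ⟨τ'', h1, h2, h3⟩ :=
      exists_primitive_succ hC (n := i + 2) (by omega) τ.2.1 τ.2.2 hτ' h'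
    exact ⟨⟨τ'', h1, h2⟩, h3⟩
  choose next hnext using step
  have h0 : bracket C.barD (0 : C.TEnd) - C.kaledin ∈ C.weightCC 3 1 := by
    have e : bracket C.barD (0 : C.TEnd) = 0 := by
      funext X Y; ext x; simp [bracket_apply]
    rw [e, zero_sub]
    exact neg_mem ⟨kaledin_mem_coDer hC, fun X Y x hx => kaledin_vanish hx⟩
  let t (i : ℕ) : S i := Nat.rec ⟨0, zero_mem _, h0⟩ next i
  have hstep (i : ℕ) : (t (i + 1)).1 - (t i).1 ∈ C.weightCC (i + 2) 0 := hnext i (t i)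
  have hstable (m n : ℕ) (hmn : m ≤ n) (X Y : C.Ob) (x : C.TBar X Y)
      (hx : x ∈ C.weightLE m X Y) : (t n).1 X Y x = (t m).1 X Y x := by
    induction n, hmn using Nat.le_induction with
    | base => rfl
    | succ n hmn ih =>
      rw [← ih]
      exact sub_eq_zero.1 ((hstep n).2 X Y x (weightLE_mono (by omega) X Y hx))
  let τ : C.TEnd := fun X Y => ofWeights fun n => (t n).1 X Y
  have hτ (m : ℕ) {X Y : C.Ob} {x : C.TBar X Y} (hx : x ∈ C.weightLE m X Y) :
      τ X Y x = (t m).1 X Y x := by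
    refine sub_eq_zero.1 (eq_zero_of_mem_weightLE (l := τ X Y - (t m).1 X Y)
      (fun s _ _ hs => ?_) hx)
    rw [LinearMap.sub_apply, sub_eq_zero]
    exact (ofWeights_tprod _ s).trans (hstable _ _ hs _ _ _ (tprod_mem_weightLE le_rfl)).symm
  refine ⟨τ, ⟨ofWeights_mem_coDer (fun n => (t n).2.1.1) fun m n hmn X Y s hs =>
    hstable m n hmn X Y _ (tprod_mem_weightLE hs.le), fun X Y x hx => ?_⟩, ?_⟩
  · rw [hτ 1 hx]
    exact (t 1).2.1.2 X Y x hx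
  · funext X Y
    refine LinearMap.ext fun x => ?_
    obtain ⟨m, hx⟩ := exists_mem_weightLE x
    rw [bracket_apply, hτ m hx, hτ m (coDer_preserves_weight C.barD_mem_coDer hx)]
    exact sub_eq_zero.1 ((t m).2.2.2 X Y x (weightLE_mono (by omega) X Y hx))

end AInfCategory

namespace GradedQuiver

open TBar

variable {R : Type u} [CommRing R] {Q Q' : GradedQuiver.{u, v, w} R}

/-! ### Morphisms of tensor cocategories -/

namespace Str

lemma sum₂_of_right_nonempty {M : Type*} [AddCommMonoid M] {X Z : Q.Ob} (s : Str Q X Z)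
    {g : ∀ Y : Q.Ob, Str Q Y Z → Str Q X Y → M} (h : ∀ Y a b, b.length ≠ 0 → g Y a b = 0) :
    s.sum₂ g = g X s nil := by
  induction s with
  | nil => rw [sum₂_nil]
  | cons f t ih =>
    rw [sum₂_cons, h _ _ _ (by simp), zero_add, ih fun Y a b hb => h Y (cons f a) b hb]

/-- Decompositions into blocks, sorted by their first block. -/
lemma sum_blockings_cons {M : Type*} [AddCommMonoid M] {X Y Z : Q.Ob} (f : Q.Mor Y Z)
    (t : Str Q X Y) (h : Blocks Q X Z → M) :
    ((blockings (cons f t)).map h).sum = t.sum₂ fun _ a b =>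
      ((blockings b).map fun B => h (Blocks.cons (cons f a) B)).sum := by
  induction t generalizing Z with
  | nil => simp [blockings, sum₂_nil, single]
  | @cons Y' Y g u ih =>
    let glue : Blocks Q X Y → M
      | .nil => 0
      | .cons a B => h (.cons (cons f a) B)
    have e : ((blockings (cons f (cons g u))).map h).sum
        = ((blockings (cons g u)).map fun B => h (.cons (single f) B)).sum
          + ((blockings (cons g u)).map glue).sum := by
      rw [← List.sum_map_add, blockings, List.map_flatMap, List.flatMap_def,
        List.sum_flatten, List.map_map]
      congr 1
      refine List.map_congr_left fun B _ => ?_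
      cases B <;> simp [glue]
    rw [e, sum₂_cons, ih g glue]
    rfl

/-- The string of the images of the blocks, without signs. -/
def Blocks.img (o : Q.Ob → Q'.Ob) (F : ∀ {X Y : Q.Ob}, Str Q X Y → Q'.Mor (o X) (o Y)) {X : Q.Ob} :
    {Z : Q.Ob} → Blocks Q X Z → Str Q' (o X) (o Z)
  | _, nil => Str.nil
  | _, cons a B => Str.cons (F a) (img o F B)

end Str

lemma corestrict_mul {X Y Z : Q.Ob} (x : Q.TBar Y Z) (y : Q.TBar X Y) :
    corestrict X Z (mul x y) = 0 := by
  have h : (mul : Q.TBar Y Z →ₗ[R] Q.TBar X Y →ₗ[R] _).compr₂ (corestrict X Z) = 0 := by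
    refine hom_ext fun a => hom_ext fun b => ?_
    rw [LinearMap.compr₂_apply]
    by_cases ha : a.length = 0
    · simp [tprod_of_length_eq_zero a ha]
    by_cases hb : b.length = 0
    · simp [tprod_of_length_eq_zero b hb]
    rw [mul_tprod ha hb, corestrict_tprod, Str.entry_of_length_ne_one]
    · rfl
    · rw [Str.length_append]
      omega
  exact LinearMap.congr_fun₂ h x y

lemma mul_incl_tprod {X Y Z : Q.Ob} (f : Q.Mor Y Z) {b : Str Q X Y} (hb : b.length ≠ 0) :
    mul (incl Y Z f) (tprod b) = tprod (Str.cons f b) :=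
  mul_tprod (by simp [Str.single]) hb

lemma comul_incl {X Y : Q.Ob} (f : Q.Mor X Y) : Q.comul X Y (incl X Y f) = 0 := by
  rw [incl_apply, comul_tprod, Str.single, Str.sum₂_cons, Str.sum₂_nil]
  simp [tprod_nil]

lemma comul_mul_incl {X Y Z : Q.Ob} (f : Q.Mor Y Z) (y : Q.TBar X Y) :
    Q.comul X Z (mul (incl Y Z f) y) = pure₂ Y (incl Y Z f) y
      + map₂ (fun V => V) (fun _ => mul (incl Y Z f)) (fun _ => LinearMap.id) (Q.comul X Y y) := by
  refine LinearMap.congr_fun (f := Q.comul X Z ∘ₗ mul (incl Y Z f)) (g := pure₂ Y (incl Y Z f)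
      + map₂ (fun V => V) (fun _ => mul (incl Y Z f)) (fun _ => LinearMap.id) ∘ₗ Q.comul X Y)
    (hom_ext fun b => ?_) y
  rw [LinearMap.comp_apply, LinearMap.add_apply, LinearMap.comp_apply, map₂_comul]
  by_cases hb : b.length = 0
  · cases b with
    | nil => simp [tprod_nil, Str.sum₂_nil]
    | cons g u => simp at hb
  · cases b with
    | nil => simp at hb
    | cons g u =>
      rw [mul_incl_tprod f hb, comul_tprod, Str.sum₂_cons, Str.sum₂_cons, Str.sum₂_cons, tprod_nil,
        tprod_nil, map_zero, map_zero, LinearMap.zero_apply, map_zero, LinearMap.zero_apply,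
        zero_add, zero_add]
      refine congrArg₂ (· + ·) rfl (Str.sum₂_congr u fun V a b _ => ?_)
      rw [mul_incl_tprod f (by simp), LinearMap.id_apply]

variable (Q Q') in
/-- The components `𝒞[1]^{⊗ n} → 𝒟[1]` of a morphism of reduced tensor cocategories that covers
the map `o` on objects. -/
structure Components (o : Q.Ob → Q'.Ob) where
  F : ∀ {X Y : Q.Ob}, Str Q X Y → Q'.Mor (o X) (o Y)
  multilinear : ∀ X Y : Q.Ob, Str.IsMultilinear (F : Str Q X Y → Q'.Mor (o X) (o Y))
  map_nil : ∀ X : Q.Ob, F (Str.nil : Str Q X X) = 0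

namespace Components

variable {o : Q.Ob → Q'.Ob} (Φ : Components Q Q' o)

/-- The image of a string under the morphism of tensor cocategories. -/
def onStr {X Y : Q.Ob} (s : Str Q X Y) : Q'.TBar (o X) (o Y) :=
  (s.blockings.map fun B => tprod (B.img o Φ.F)).sum

lemma onStr_nil (X : Q.Ob) : Φ.onStr (Str.nil : Str Q X X) = 0 := by
  simp [onStr, Str.blockings, Str.Blocks.img, tprod_nil]

/-- The image of a string is computed recursively, by splitting off the first block. -/
lemma onStr_eq {X Y : Q.Ob} (s : Str Q X Y) :
    Φ.onStr s = incl _ _ (Φ.F s)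
      + s.sum₂ fun _ a b => mul (incl _ _ (Φ.F a)) (Φ.onStr b) := by
  cases s with
  | nil => simp [Str.sum₂_nil, onStr_nil, Φ.map_nil]
  | @cons W _ f t =>
    let g (V : Q.Ob) (a : Str Q V W) (b : Str Q X V) : Q'.TBar (o X) (o Y) :=
      (b.blockings.map fun B => tprod (Str.cons (Φ.F (Str.cons f a)) (B.img o Φ.F))).sum
    have hg : t.sum₂ (fun V a b => g V a b - mul (incl _ _ (Φ.F (Str.cons f a))) (Φ.onStr b))
        = incl _ _ (Φ.F (Str.cons f t)) := by
      rw [Str.sum₂_of_right_nonempty]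
      · simp only [g, onStr_nil, map_zero, sub_zero]
        simp [Str.blockings, Str.Blocks.img, incl_apply, Str.single]
      · intro V a b hb
        cases b with
        | nil => simp at hb
        | cons k u =>
          rw [sub_eq_zero]
          simp only [g, onStr]
          rw [Str.sum_blockings_cons, Str.sum_blockings_cons, Str.map_sum₂]
          refine Str.sum₂_congr u fun V' a' b' _ => ?_
          rw [map_list_sum, List.map_map]
          congr 1
          refine List.map_congr_left fun B _ => ?_
          rw [Function.comp_apply, mul_incl_tprod _ (by simp [Str.Blocks.img])]
    rw [onStr, Str.sum_blockings_cons, Str.sum₂_cons, Φ.map_nil, map_zero, map_zero,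
      LinearMap.zero_apply, zero_add, ← hg, ← Str.sum₂_add]
    refine Str.sum₂_congr t fun V a b _ => ?_
    rw [sub_add_cancel]
    rfl

/-- The recursion for the image of a string, cut off after finitely many steps. -/
def onStrAux : ℕ → ∀ {X Y : Q.Ob}, Str Q X Y → Q'.TBar (o X) (o Y)
  | 0, _, _, _ => 0
  | n + 1, _, _, s => incl _ _ (Φ.F s)
      + s.sum₂ fun _ a b => mul (incl _ _ (Φ.F a)) (onStrAux n b)

lemma isMultilinear_onStrAux (n : ℕ) (X Y : Q.Ob) :
    Str.IsMultilinear (Φ.onStrAux n : Str Q X Y → Q'.TBar (o X) (o Y)) := by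
  induction n generalizing X Y with
  | zero => exact Str.IsMultilinear.zero
  | succ n ih =>
    refine ((Φ.multilinear X Y).linear_comp (incl _ _)).add
      (Str.IsMultilinear.sum₂ (fun Z b => ?_) fun Z a => ?_)
    · exact (Φ.multilinear Z Y).linear_comp (mul.flip (Φ.onStrAux n b) ∘ₗ incl _ _)
    · exact (ih X Z).linear_comp (mul (incl _ _ (Φ.F a)))

lemma F_of_length_eq_zero {X Y : Q.Ob} (s : Str Q X Y) (hs : s.length = 0) : Φ.F s = 0 := by
  cases s with
  | nil => exact Φ.map_nil X
  | cons f t => simp at hs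

lemma onStr_eq_onStrAux {n : ℕ} {X Y : Q.Ob} (s : Str Q X Y) (hs : s.length ≤ n) :
    Φ.onStr s = Φ.onStrAux n s := by
  induction n generalizing X Y with
  | zero =>
    cases s with
    | nil => exact Φ.onStr_nil X
    | cons f t => simp at hs
  | succ n ih =>
    rw [onStr_eq, onStrAux]
    congr 1
    refine Str.sum₂_congr s fun Z a b hab => ?_
    have hl : a.length + b.length = s.length := by rw [← hab, Str.length_append]
    by_cases ha : a.length = 0
    · simp [Φ.F_of_length_eq_zero a ha]
    · rw [ih b (by omega)]

/-- The morphism of reduced tensor cocategories with the given components. -/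
def tensor (X Y : Q.Ob) : Q.TBar X Y →ₗ[R] Q'.TBar (o X) (o Y) :=
  TBar.lift Φ.onStr
    (by
      have h : (Φ.onStr : Str Q X Y → _) = fun s => Φ.onStrAux s.length s :=
        funext fun s => Φ.onStr_eq_onStrAux s le_rfl
      rw [h]
      exact Str.IsMultilinear.of_length (φ := fun n s => Φ.onStrAux n s)
        fun n => Φ.isMultilinear_onStrAux n X Y)
    fun s hs => by
      cases s with
      | nil => exact Φ.onStr_nil X
      | cons f t => simp at hs

lemma tensor_tprod' {X Y : Q.Ob} (s : Str Q X Y) :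
    Φ.tensor X Y (tprod s) = (s.blockings.map fun B => tprod (B.img o Φ.F)).sum :=
  lift_tprod _ _ _ s

lemma tensor_tprod {X Y : Q.Ob} (s : Str Q X Y) :
    Φ.tensor X Y (tprod s) = incl _ _ (Φ.F s)
      + s.sum₂ fun Z a b => mul (incl _ _ (Φ.F a)) (Φ.tensor X Z (tprod b)) :=
  ((lift_tprod _ _ _ s).trans (Φ.onStr_eq s)).trans <| congrArg _ <|
    Str.sum₂_congr s fun Z _ b _ =>
      congrArg _ (lift_tprod (Φ.onStr : Str Q X Z → _) _ _ b).symm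

@[simp] lemma corestrict_tensor {X Y : Q.Ob} (s : Str Q X Y) :
    corestrict _ _ (Φ.tensor X Y (tprod s)) = Φ.F s := by
  rw [tensor_tprod, map_add, corestrict_incl, Str.map_sum₂]
  simp [corestrict_mul, Str.sum₂_zero]

lemma tensor_mem_weightLE {n : ℕ} {X Y : Q.Ob} {x : Q.TBar X Y} (hx : x ∈ Q.weightLE n X Y) :
    Φ.tensor X Y x ∈ Q'.weightLE n (o X) (o Y) := by
  have key {n : ℕ} {X Y : Q.Ob} (s : Str Q X Y) (hs : s.length ≤ n) :
      Φ.tensor X Y (tprod s) ∈ Q'.weightLE n (o X) (o Y) := by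
    induction n generalizing X Y with
    | zero => rw [tprod_of_length_eq_zero s (by omega), map_zero]; exact zero_mem _
    | succ n ih =>
      rw [tensor_tprod]
      refine add_mem (incl_mem_weightLE _ (by omega)) (Str.sum₂_mem _ s fun Z a b hab => ?_)
      have hl : a.length + b.length = s.length := by rw [← hab, Str.length_append]
      by_cases ha : a.length = 0
      · rw [Φ.F_of_length_eq_zero a ha, map_zero, map_zero]
        exact zero_mem _
      · exact weightLE_mono (by omega) _ _ (mul_mem_weightLE (incl_mem_weightLE _ le_rfl)
          (ih b (by omega)))
  exact (weightLE_le (S := (Q'.weightLE n _ _).comap (Φ.tensor X Y)) fun s _ _ hs => key s hs) hx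

lemma comul_tensor {X Y : Q.Ob} (x : Q.TBar X Y) :
    Q'.comul _ _ (Φ.tensor X Y x)
      = map₂ o (fun Z => Φ.tensor Z Y) (fun Z => Φ.tensor X Z) (Q.comul X Y x) := by
  have key (n : ℕ) {X Y : Q.Ob} (s : Str Q X Y) (hs : s.length ≤ n) :
      Q'.comul _ _ (Φ.tensor X Y (tprod s))
        = s.sum₂ fun Z a b => pure₂ (o Z) (Φ.tensor Z Y (tprod a)) (Φ.tensor X Z (tprod b)) := by
    induction n generalizing X Y with
    | zero =>
      cases s with
      | nil => simp [Str.sum₂_nil, tprod_nil]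
      | cons f t => simp at hs
    | succ n ih =>
      have e : (s.sum₂ fun Z a b => pure₂ (o Z) (Φ.tensor Z Y (tprod a)) (Φ.tensor X Z (tprod b)))
          = (s.sum₂ fun Z a b => pure₂ (o Z) (incl _ _ (Φ.F a)) (Φ.tensor X Z (tprod b)))
            + s.sum₃ fun Z Z' a b c => pure₂ (o Z)
              (mul (incl _ _ (Φ.F a)) (Φ.tensor Z Z' (tprod b))) (Φ.tensor X Z (tprod c)) := by
        rw [← Str.sum₂_sum₂, ← Str.sum₂_add]
        refine Str.sum₂_congr s fun Z r c _ => ?_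
        rw [Φ.tensor_tprod r, map_add, LinearMap.add_apply, ← LinearMap.flip_apply (pure₂ (o Z)),
          ← LinearMap.flip_apply (pure₂ (o Z)), Str.map_sum₂]
        rfl
      rw [e, Φ.tensor_tprod s, map_add, comul_incl, zero_add, Str.map_sum₂, Str.sum₃,
        ← Str.sum₂_add]
      refine Str.sum₂_congr s fun Z a b hab => ?_
      have hl : a.length + b.length = s.length := by rw [← hab, Str.length_append]
      rw [comul_mul_incl]
      congr 1
      by_cases ha : a.length = 0
      · rw [Φ.F_of_length_eq_zero a ha]
        have h0 : map₂ (fun V => V) (fun V => (mul (incl (o Z) (o Y) 0) : Q'.TBar V _ →ₗ[R] _))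
            (fun V => (LinearMap.id : Q'.TBar (o X) V →ₗ[R] _)) = 0 :=
          TBar₂.hom_ext fun V x y => by simp
        rw [h0, LinearMap.zero_apply]
        simp [Str.sum₂_zero]
      · rw [ih b (by omega), Str.map_sum₂]
        simp
  refine LinearMap.congr_fun (f := Q'.comul _ _ ∘ₗ Φ.tensor X Y)
    (g := map₂ o (fun Z => Φ.tensor Z Y) (fun Z => Φ.tensor X Z) ∘ₗ Q.comul X Y)
    (hom_ext fun s => ?_) x
  rw [LinearMap.comp_apply, LinearMap.comp_apply, map₂_comul, key _ s le_rfl]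

lemma tensor_congr {Φ Ψ : Components Q Q' o} {n : ℕ}
    (h : ∀ (X Y : Q.Ob) (s : Str Q X Y), s.length ≤ n → Φ.F s = Ψ.F s) {X Y : Q.Ob}
    (s : Str Q X Y) (hs : s.length ≤ n) : Φ.tensor X Y (tprod s) = Ψ.tensor X Y (tprod s) := by
  induction n generalizing X Y with
  | zero => rw [tprod_of_length_eq_zero s (by omega), map_zero, map_zero]
  | succ n ih =>
    rw [tensor_tprod, tensor_tprod, h _ _ s hs]
    congr 1
    refine Str.sum₂_congr s fun Z a b hab => ?_
    have hl : a.length + b.length = s.length := by rw [← hab, Str.length_append]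
    by_cases ha : a.length = 0
    · simp [F_of_length_eq_zero _ a ha]
    · rw [h _ _ a (by omega), ih (fun X Y s hs => h X Y s (by omega)) b (by omega)]

/-- The part of weight at least two only depends on the components on shorter strings. -/
lemma tensor_sub_mem {Φ Ψ : Components Q Q' o} {n : ℕ}
    (h : ∀ (X Y : Q.Ob) (s : Str Q X Y), s.length ≤ n → Φ.F s = Ψ.F s) {X Y : Q.Ob}
    (s : Str Q X Y) (hs : s.length = n + 1) :
    Φ.tensor X Y (tprod s) - Ψ.tensor X Y (tprod s) ∈ Q'.weightLE 1 (o X) (o Y) := by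
  have e : (s.sum₂ fun Z a b => mul (incl _ _ (Φ.F a)) (Φ.tensor X Z (tprod b)))
      = s.sum₂ fun Z a b => mul (incl _ _ (Ψ.F a)) (Ψ.tensor X Z (tprod b)) := by
    refine Str.sum₂_congr s fun Z a b hab => ?_
    have hl : a.length + b.length = s.length := by rw [← hab, Str.length_append]
    by_cases ha : a.length = 0
    · simp [F_of_length_eq_zero _ a ha]
    by_cases hb : b.length = 0
    · simp [tprod_of_length_eq_zero b hb]
    rw [h _ _ a (by omega), tensor_congr h b (by omega)]
  rw [tensor_tprod, tensor_tprod, e, add_sub_add_right_eq_sub]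
  exact sub_mem (incl_mem_weightLE _ le_rfl) (incl_mem_weightLE _ le_rfl)

/-- On weight `n`, morphisms with the same linear components agree up to weight `n - 1`. -/
lemma tensor_sub_mem_of_linear {Φ Ψ : Components Q Q' o}
    (h : ∀ (X Y : Q.Ob) (f : Q.Mor X Y), Φ.F (Str.single f) = Ψ.F (Str.single f)) {n : ℕ}
    {X Y : Q.Ob} (s : Str Q X Y) (hs : s.length ≤ n + 1) :
    Φ.tensor X Y (tprod s) - Ψ.tensor X Y (tprod s) ∈ Q'.weightLE n (o X) (o Y) := by
  induction n generalizing X Y with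
  | zero =>
    rw [tensor_congr (n := 1) (fun X Y s hs => ?_) s hs, sub_self]
    · exact zero_mem _
    · rcases Nat.lt_or_ge s.length 1 with h' | h'
      · rw [F_of_length_eq_zero _ s (by omega), F_of_length_eq_zero _ s (by omega)]
      · obtain ⟨f, rfl⟩ := s.exists_eq_single (le_antisymm hs h')
        exact h _ _ f
  | succ n ih =>
    rw [tensor_tprod, tensor_tprod, add_sub_add_comm]
    refine add_mem (sub_mem (incl_mem_weightLE _ (by omega)) (incl_mem_weightLE _ (by omega))) ?_
    have e : (s.sum₂ fun Z a b => mul (incl _ _ (Φ.F a)) (Φ.tensor X Z (tprod b)))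
        = (s.sum₂ fun Z a b => (mul (incl _ _ (Φ.F a)) (Φ.tensor X Z (tprod b))
            - mul (incl _ _ (Ψ.F a)) (Ψ.tensor X Z (tprod b))))
          + s.sum₂ fun Z a b => mul (incl _ _ (Ψ.F a)) (Ψ.tensor X Z (tprod b)) := by
      rw [← Str.sum₂_add]
      simp
    rw [e, add_sub_cancel_right]
    refine Str.sum₂_mem _ s fun Z a b hab => ?_
    have hl : a.length + b.length = s.length := by rw [← hab, Str.length_append]
    have hm (Θ : Components Q Q' o) (m : ℕ) (hb : b.length ≤ m) (hmn : m ≤ n) :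
        mul (incl _ _ (Θ.F a)) (Θ.tensor X Z (tprod b)) ∈ Q'.weightLE (n + 1) (o X) (o Y) :=
      weightLE_mono (by omega) _ _ (mul_mem_weightLE (m := 1) (n := m) (incl_mem_weightLE _ le_rfl)
        (Θ.tensor_mem_weightLE (tprod_mem_weightLE hb)))
    rcases Nat.lt_trichotomy a.length 1 with ha | ha | ha
    · rw [F_of_length_eq_zero _ a (by omega), F_of_length_eq_zero _ a (by omega)]
      simp
    · obtain ⟨f, rfl⟩ := a.exists_eq_single ha
      rw [h, ← map_sub, add_comm n]
      exact mul_mem_weightLE (incl_mem_weightLE _ le_rfl) (ih b (by omega))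
    · exact sub_mem (hm Φ b.length le_rfl (by omega)) (hm Ψ b.length le_rfl (by omega))

/-- The components are of degree zero with respect to the shifted gradings. -/
def IsHomogeneous : Prop :=
  ∀ {X Y : Q.Ob} (s : Str Q X Y) (q : ℤ), s.HasDeg q → Φ.F s ∈ Q'.gr (o X) (o Y) (q + 1 - s.length)

variable {Φ}

lemma IsHomogeneous.tensor_mem_tensorDeg (hΦ : Φ.IsHomogeneous) {X Y : Q.Ob} {q : ℤ}
    {x : Q.TBar X Y} (hx : x ∈ Q.tensorDeg q X Y) :
    Φ.tensor X Y x ∈ Q'.tensorDeg q (o X) (o Y) := by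
  have key (n : ℕ) {X Y : Q.Ob} {s : Str Q X Y} {q : ℤ} (hs : s.HasDeg q) (hn : s.length ≤ n) :
      Φ.tensor X Y (tprod s) ∈ Q'.tensorDeg (q - s.length) (o X) (o Y) := by
    induction n generalizing X Y q with
    | zero => rw [tprod_of_length_eq_zero s (by omega), map_zero]; exact zero_mem _
    | succ n ih =>
      rw [tensor_tprod]
      refine add_mem ?_ (Str.sum₂_mem _ s fun Z a b hab => ?_)
      · convert incl_mem_tensorDeg (hΦ s q hs) using 2
        ring
      · have hl : a.length + b.length = s.length := by rw [← hab, Str.length_append]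
        obtain ⟨i, j, hi, hj, hij⟩ := (hab ▸ hs).of_append
        by_cases ha : a.length = 0
        · rw [F_of_length_eq_zero _ a ha, map_zero, map_zero]
          exact zero_mem _
        · convert mul_mem_tensorDeg (incl_mem_tensorDeg (hΦ a i hi)) (ih hj (by omega)) using 2
          omega
  refine (tensorDeg_le (S := (Q'.tensorDeg q _ _).comap (Φ.tensor X Y)) fun s p hs hp => ?_) hx
  rw [Submodule.mem_comap, ← hp]
  exact key s.length hs le_rfl

lemma IsHomogeneous.tensor_comp_tensorSign (hΦ : Φ.IsHomogeneous) (a : ℤ) (X Y : Q.Ob) :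
    Φ.tensor X Y ∘ₗ Q.tensorSign a X Y = Q'.tensorSign a _ _ ∘ₗ Φ.tensor X Y :=
  hom_ext_homogeneous fun s q hs => by
    have h := tprod_mem_tensorDeg hs
    rw [LinearMap.comp_apply, LinearMap.comp_apply, tensorSign_of_mem a h, map_zsmul,
      tensorSign_of_mem a (hΦ.tensor_mem_tensorDeg h)]

lemma IsHomogeneous.isCoderAlong_tensor_comp (hΦ : Φ.IsHomogeneous) {p : ℤ} {D : Q.TEnd}
    (hD : D ∈ Q.coDer p) :
    IsCoderAlong o (fun X Y => Q'.tensorSign p _ _ ∘ₗ Φ.tensor X Y) Φ.tensor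
      fun X Y => Φ.tensor X Y ∘ₗ D X Y := fun X Y x => by
  rw [LinearMap.comp_apply, comul_tensor, (mem_coDer_iff.1 hD).2 X Y x, map_add, map₂_map₂,
    map₂_map₂]
  simp only [hΦ.tensor_comp_tensorSign, LinearMap.comp_id]

lemma isCoderAlong_comp_tensor (Φ : Components Q Q' o) {p : ℤ} {D : Q'.TEnd}
    (hD : D ∈ Q'.coDer p) :
    IsCoderAlong o (fun X Y => Q'.tensorSign p _ _ ∘ₗ Φ.tensor X Y) Φ.tensor
      fun X Y => D (o X) (o Y) ∘ₗ Φ.tensor X Y := fun X Y x => by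
  rw [LinearMap.comp_apply, (mem_coDer_iff.1 hD).2, comul_tensor, map₂_map₂, map₂_map₂]
  simp only [LinearMap.id_comp]

end Components

end GradedQuiver

namespace GradedQuiver

open TBar

variable {R : Type u} [CommRing R] {Q Q' : GradedQuiver.{u, v, w} R}

/-! ### Signs of the suspension -/

namespace Str

lemma sum₂_desuspend {M : Type*} [AddCommMonoid M] {X Z : Q.Ob} (s : Str Q X Z)
    (g : ∀ Y : Q.Ob, Str Q Y Z → Str Q X Y → M) :
    s.desuspend.sum₂ g = s.sum₂ fun Y a b =>
      g Y (a.desuspend.map (Q.signMap (-1) b.length)) b.desuspend := by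
  induction s with
  | nil => simp [sum₂_nil, desuspend]
  | cons f t ih =>
    rw [desuspend, sum₂_cons, sum₂_cons, ih]
    refine congrArg₂ (· + ·) rfl (sum₂_congr t fun Y a b hab => ?_)
    have hl : a.length + b.length = t.length := by rw [← hab, length_append]
    rw [desuspend, map_cons, ← LinearMap.comp_apply (Q.signMap _ _ _ _), signMap_comp, ← hl,
      Nat.cast_add, add_comm (a.length : ℤ)]

lemma sum₃_desuspend {M : Type*} [AddCommMonoid M] {X Z : Q.Ob} (s : Str Q X Z)
    (g : ∀ Y Y' : Q.Ob, Str Q Y' Z → Str Q Y Y' → Str Q X Y → M) :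
    s.desuspend.sum₃ g = s.sum₃ fun Y Y' a b c =>
      g Y Y' (a.desuspend.map (Q.signMap (-1) (b.length + c.length)))
        (b.desuspend.map (Q.signMap (-1) c.length)) c.desuspend := by
  rw [sum₃, sum₂_desuspend]
  refine sum₂_congr s fun Y' a r _ => ?_
  rw [sum₂_desuspend]
  refine sum₂_congr r fun Y b c hbc => ?_
  rw [← hbc, length_append, Nat.cast_add]

lemma desuspend_map_signMap (a : ℤ) {X Y : Q.Ob} (s : Str Q X Y) :
    (s.map (Q.signMap (-1) a)).desuspend = s.desuspend.map (Q.signMap (-1) a) := by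
  induction s with
  | nil => rfl
  | cons f t ih =>
    rw [map_cons, desuspend, desuspend, map_cons, ih, length_map, ← LinearMap.comp_apply,
      ← LinearMap.comp_apply, signMap_comp, signMap_comp, add_comm]

lemma map_signMap_map_signMap (c a b : ℤ) {X Y : Q.Ob} (s : Str Q X Y) :
    (s.map (Q.signMap c a)).map (Q.signMap c b) = s.map (Q.signMap c (b + a)) := by
  rw [map_map]
  congr 1
  funext X Y
  exact signMap_comp c b a X Y

lemma map_signMap_add_two_mul (c a b : ℤ) {X Y : Q.Ob} (s : Str Q X Y) :
    s.map (Q.signMap c (a + 2 * b)) = s.map (Q.signMap c a) := by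
  congr 1
  funext X Y
  exact signMap_add_two_mul c a b X Y

/-- The Koszul signs for the unshifted and the shifted degrees differ by `(-1) ^ a` for every
entry. -/
lemma IsMultilinear.map_signMap_zero {M : Type*} [AddCommGroup M] [Module R M] {X Y : Q.Ob}
    {φ : Str Q X Y → M} (h : IsMultilinear φ) (a : ℕ) (b : ℤ) (s : Str Q X Y) :
    φ ((s.map (Q.signMap (-1) b)).map (Q.signMap 0 a))
      = (-1 : ℤ) ^ (s.length * a) • φ (s.map (Q.signMap (-1) (a + b))) := by
  have e : (s.map (Q.signMap (-1) b)).map (Q.signMap 0 a)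
      = s.map fun X Y => (((a : ℤ).negOnePow : ℤˣ) : ℤ) • Q.signMap (-1) (a + b) X Y := by
    rw [map_map]
    congr 1
    funext X Y
    rw [signMap_zero_eq, LinearMap.smul_comp, signMap_comp]
  rw [e, h.map_zsmul]
  congr 1
  rw [Int.negOnePow_def, zpow_natCast, mul_comm, pow_mul]
  simp

/-- The number of entries in all blocks. -/
def Blocks.total {X : Q.Ob} : {Z : Q.Ob} → Blocks Q X Z → ℕ
  | _, nil => 0
  | _, cons a B => a.length + total B

/-- The decomposition of the desuspended string. -/
def Blocks.desuspend {X : Q.Ob} : {Z : Q.Ob} → Blocks Q X Z → Blocks Q X Z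
  | _, nil => nil
  | _, cons a B => cons (a.desuspend.map (Q.signMap (-1) B.total)) (desuspend B)

lemma Blocks.total_of_mem {X Z : Q.Ob} {s : Str Q X Z} {B : Blocks Q X Z}
    (h : B ∈ s.blockings) : B.total = s.length := by
  induction s with
  | nil =>
    rw [blockings, List.mem_singleton] at h
    rw [h]
    rfl
  | cons f t ih =>
    rw [blockings, List.mem_flatMap] at h
    obtain ⟨B', hB', h⟩ := h
    have := ih hB'
    rw [List.mem_cons] at h
    rcases h with rfl | h
    · simp [total, single, this, add_comm]
    · cases B' with
      | nil => simp at h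
      | cons a B' =>
        rw [List.mem_singleton] at h
        subst h
        simp only [total, length_cons] at this ⊢
        omega

lemma sum_blockings_desuspend {M : Type*} [AddCommMonoid M] {X Z : Q.Ob} (s : Str Q X Z)
    (h : Blocks Q X Z → M) :
    (s.desuspend.blockings.map h).sum = (s.blockings.map fun B => h B.desuspend).sum := by
  induction hn : s.length using Nat.strong_induction_on generalizing Z with
  | _ n ih =>
    cases s with
    | nil => simp [blockings, desuspend, Blocks.desuspend]
    | cons f t =>
      rw [desuspend, sum_blockings_cons, sum_blockings_cons, sum₂_desuspend]
      refine sum₂_congr t fun Y a b hab => ?_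
      have hl : a.length + b.length = t.length := by rw [← hab, length_append]
      rw [length_cons] at hn
      rw [ih b.length (by omega) b _ rfl]
      congr 1
      refine List.map_congr_left fun B hB => ?_
      rw [Blocks.desuspend, desuspend, map_cons, ← LinearMap.comp_apply (Q.signMap _ _ _ _),
        signMap_comp, Blocks.total_of_mem hB, ← hl, Nat.cast_add, add_comm (a.length : ℤ)]

lemma Blocks.deg_desuspend (o : Q.Ob → Q'.Ob)
    (F : ∀ {X Y : Q.Ob}, Str Q X Y → Q'.Mor (o X) (o Y)) {X Z : Q.Ob} (B : Blocks Q X Z) :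
    B.desuspend.deg = B.total + (B.img o F).length := by
  induction B with
  | nil => rfl
  | cons a B ih =>
    rw [desuspend, deg, ih, total, img, length_map, length_desuspend, length_cons]
    omega

end Str

/-- The signs in the tensor product of the components and the signs of the suspension cancel. -/
lemma Components.sign_image {o : Q.Ob → Q'.Ob} {Φ : Components Q Q' o} (hΦ : Φ.IsHomogeneous)
    {M : Type*} [AddCommGroup M] [Module R M] {X Z : Q.Ob} (B : Str.Blocks Q X Z)
    {ψ : Str Q' (o X) (o Z) → M} (hψ : Str.IsMultilinear ψ) :
    (-1 : ℤ) ^ B.desuspend.sgn • ψ (B.desuspend.image o fun s => Φ.F s.desuspend)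
      = ψ (B.img o Φ.F).desuspend := by
  induction B with
  | nil => simp [Str.Blocks.desuspend, Str.Blocks.sgn, Str.Blocks.image, Str.Blocks.img,
      Str.desuspend]
  | @cons Y W a B ih =>
    have hF := (Φ.multilinear Y W).comp_desuspend
    have e : Φ.F (((a.desuspend.map (Q.signMap (-1) B.total)).map
          (Q.signMap 0 B.desuspend.deg)).desuspend)
        = (-1 : ℤ) ^ (a.length * B.desuspend.deg) •
          Q'.signMap (-1) (B.img o Φ.F).length _ _ (Φ.F a) := by
      rw [hF.map_signMap_zero, Str.length_desuspend, Str.Blocks.deg_desuspend o Φ.F]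
      congr 1
      have e2 : ((B.total + (B.img o Φ.F).length : ℕ) : ℤ) + B.total
          = (B.img o Φ.F).length + 2 * (B.total : ℤ) := by push_cast; ring
      rw [e2, Str.map_signMap_add_two_mul, Str.desuspend_map_signMap, Str.desuspend_desuspend,
        (Φ.multilinear _ _).map_signMap_of_deg 1 (fun s q hs => hΦ s q hs)]
      simp
    rw [Str.Blocks.desuspend, Str.Blocks.image, Str.Blocks.sgn, Str.Blocks.img, Str.desuspend, e,
      hψ.head_zsmul, smul_smul, ← ih (hψ.cons_left _), pow_add, Str.length_map,
      Str.length_desuspend, mul_right_comm, ← mul_pow]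
    simp

end GradedQuiver

namespace AInfCategory

open GradedQuiver TBar

variable {R : Type u} [CommRing R] {A D : AInfCategory.{u, v, w} R} {o : A.Ob → D.Ob}

/-! ### Functors in the bar picture -/

lemma corestrict_tensor_barD (Φ : Components A.toGradedQuiver D.toGradedQuiver o) {X Y : A.Ob}
    (s : Str A.toGradedQuiver X Y) :
    corestrict _ _ (Φ.tensor X Y (A.barD X Y (tprod s)))
      = -s.desuspend.sum₃ fun _ _ a b c => ((-1 : ℤ) ^ (a.length * b.length + c.length)) •
          Φ.F ((a.map (A.signMap 0 b.length)).append (Str.cons (A.m b) c)).desuspend := by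
  rw [barD_tprod, Str.map_sum₃, Str.map_sum₃, Str.sum₃_desuspend,
    ← neg_one_smul ℤ (Str.sum₃ s _)]
  have e (x : D.Mor (o X) (o Y)) :
      (-1 : ℤ) • x = ((-1 : ℤ) • (LinearMap.id : D.Mor (o X) (o Y) →ₗ[R] _)) x := rfl
  rw [e, Str.map_sum₃]
  refine Str.sum₃_congr s fun Z Z' a b c _ => ?_
  rw [← e, Components.corestrict_tensor]
  have hF := (Φ.multilinear X Y).comp_desuspend
  have hm := (A.m_multilinear Z Z').map_signMap_of_deg 2 (fun s q hs => A.m_deg s q hs)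
    c.length b.desuspend
  rw [hm]
  simp only [Str.length_map, Str.length_desuspend]
  rw [(hF.append_right _).map_signMap_zero, Str.length_desuspend]
  rw [(hF.append_left _).head_zsmul]
  have hs : Str.desuspend ((a.map (A.signMap (-1) 1)).append (Str.cons (A.d b) c))
      = (a.desuspend.map (A.signMap (-1) c.length)).append
          (Str.cons (A.signMap (-1) c.length _ _ (A.d b)) c.desuspend) := by
    rw [Str.desuspend_append, Str.desuspend_map_signMap, Str.map_signMap_map_signMap,
      Str.length_cons, Str.desuspend]
    have : ((c.length + 1 : ℕ) : ℤ) + 1 = c.length + 2 * 1 := by push_cast; ring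
    rw [this, Str.map_signMap_add_two_mul]
  have hd : A.signMap (-1) c.length _ _ (A.d b)
      = (-1 : ℤ) • A.signMap (-1) c.length _ _ (A.m b.desuspend) := by
    rw [d, map_neg, neg_one_smul]
  rw [← Str.desuspend_desuspend ((a.map (A.signMap (-1) 1)).append _), hs, hd]
  rw [(hF.append_left _).head_zsmul]
  have e3 : (b.length : ℤ) + (b.length + c.length) = c.length + 2 * (b.length : ℤ) := by ring
  rw [e3, Str.map_signMap_add_two_mul, smul_smul, smul_smul, smul_smul]
  congr 1
  rw [show (2 : ℤ) - 1 = 1 from rfl, mul_one, Int.coe_negOnePow_natCast, pow_add]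
  have h1 : ((-1 : ℤ) ^ (a.length * b.length)) * (-1) ^ (a.length * b.length) = 1 := by
    rw [← mul_pow]; simp
  have h2 : ((-1 : ℤ) ^ c.length) * (-1) ^ c.length = 1 := by
    rw [← mul_pow]; simp
  linear_combination ((-1 : ℤ) ^ (a.length * b.length) * (-1) ^ (a.length * b.length)) * h2 + h1

lemma corestrict_barD_tensor {Φ : Components A.toGradedQuiver D.toGradedQuiver o}
    (hΦ : Φ.IsHomogeneous) {X Y : A.Ob} (s : Str A.toGradedQuiver X Y) :
    corestrict _ _ (D.barD _ _ (Φ.tensor X Y (tprod s)))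
      = -(s.desuspend.blockings.map fun B =>
          ((-1 : ℤ) ^ B.sgn) • D.m (B.image o fun s => Φ.F s.desuspend)).sum := by
  rw [Φ.tensor_tprod', map_list_sum, map_list_sum, Str.sum_blockings_desuspend, ← neg_one_smul ℤ,
    List.smul_sum]
  simp only [List.map_map, Function.comp_def, corestrict_barD, d]
  congr 1
  refine List.map_congr_left fun B _ => ?_
  rw [Components.sign_image hΦ B (D.m_multilinear _ _), neg_one_smul]

/-- The equations of an `A∞`-functor say that the associated morphism of tensor cocategories
commutes with the codifferentials, after corestriction. -/
lemma functor_rel_iff {Φ : Components A.toGradedQuiver D.toGradedQuiver o}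
    (hΦ : Φ.IsHomogeneous) {X Y : A.Ob} (s : Str A.toGradedQuiver X Y) :
    ((s.desuspend.sum₃ fun _ _ a b c => ((-1 : ℤ) ^ (a.length * b.length + c.length)) •
          Φ.F ((a.map (A.signMap 0 b.length)).append (Str.cons (A.m b) c)).desuspend)
      = (s.desuspend.blockings.map fun B =>
          ((-1 : ℤ) ^ B.sgn) • D.m (B.image o fun s => Φ.F s.desuspend)).sum) ↔
    corestrict _ _ (D.barD _ _ (Φ.tensor X Y (tprod s)))
      = corestrict _ _ (Φ.tensor X Y (A.barD X Y (tprod s))) := by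
  rw [corestrict_tensor_barD, corestrict_barD_tensor hΦ, neg_inj, eq_comm]

/-- The `A_n`-functor with given suspended components. -/
def functorOf {n : ℕ∞} (Φ : Components A.toGradedQuiver D.toGradedQuiver o)
    (hΦ : Φ.IsHomogeneous)
    (h₀ : ∀ (X Y : A.Ob) (s : Str A.toGradedQuiver X Y), n < s.length → Φ.F s = 0)
    (h : ∀ (X Y : A.Ob) (s : Str A.toGradedQuiver X Y), (s.length : ℕ∞) ≤ n →
      corestrict _ _ (D.barD _ _ (Φ.tensor X Y (tprod s)))
        = corestrict _ _ (Φ.tensor X Y (A.barD X Y (tprod s)))) : AnFunctor n A D where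
  obj := o
  F s := Φ.F s.desuspend
  F_multilinear X Y := (Φ.multilinear X Y).comp_desuspend
  F_nil X := Φ.map_nil X
  F_of_lt s hs := h₀ _ _ _ (by rwa [Str.length_desuspend])
  F_deg s q hs := by
    have := hΦ _ _ hs.desuspend
    rwa [Str.length_desuspend] at this
  rel s hs := by
    have := (functor_rel_iff hΦ s.desuspend).2 (h _ _ s.desuspend (by rwa [Str.length_desuspend]))
    rwa [Str.desuspend_desuspend] at this

end AInfCategory

namespace AnFunctor

open GradedQuiver TBar

variable {R : Type u} [CommRing R] {A D : AInfCategory.{u, v, w} R} {n : ℕ∞}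

/-- The suspended components of an `A_n`-functor. -/
def components (F : AnFunctor n A D) : Components A.toGradedQuiver D.toGradedQuiver F.obj where
  F s := F.F s.desuspend
  multilinear X Y := (F.F_multilinear X Y).comp_desuspend
  map_nil X := F.F_nil X

variable (F : AnFunctor n A D)

lemma components_F {X Y : A.Ob} (s : Str A.toGradedQuiver X Y) :
    F.components.F s = F.F s.desuspend := rfl

lemma components_single {X Y : A.Ob} (f : A.Mor X Y) :
    F.components.F (Str.single f) = F.F (Str.single f) := by
  rw [components_F, Str.single, Str.desuspend, Str.desuspend, Str.length_nil, Nat.cast_zero,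
    signMap_zero, LinearMap.id_apply]

lemma isHomogeneous_components : F.components.IsHomogeneous := fun s q hs => by
  have := F.F_deg _ _ hs.desuspend
  rwa [Str.length_desuspend] at this

lemma corestrict_barD_tensor {X Y : A.Ob} (s : Str A.toGradedQuiver X Y)
    (hs : (s.length : ℕ∞) ≤ n) :
    corestrict _ _ (D.barD _ _ (F.components.tensor X Y (tprod s)))
      = corestrict _ _ (F.components.tensor X Y (A.barD X Y (tprod s))) := by
  refine (AInfCategory.functor_rel_iff F.isHomogeneous_components s).1 ?_
  simp only [components_F, Str.desuspend_desuspend]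
  exact F.rel s.desuspend (by rwa [Str.length_desuspend])

/-- An `A_n`-functor induces a morphism of tensor cocategories that commutes with the
codifferentials up to weight `n`. -/
lemma barD_tensor [Algebra ℚ R] {m : ℕ} (hm : (m : ℕ∞) ≤ n) {X Y : A.Ob} {x : A.TBar X Y}
    (hx : x ∈ A.weightLE m X Y) :
    D.barD _ _ (F.components.tensor X Y x) = F.components.tensor X Y (A.barD X Y x) := by
  have hΦ : F.components.IsHomogeneous := F.isHomogeneous_components
  have hK := (Components.isCoderAlong_comp_tensor F.components D.barD_mem_coDer).sub
    (hΦ.isCoderAlong_tensor_comp A.barD_mem_coDer)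
  refine sub_eq_zero.1 (hK.eq_zero_of_corestrict (fun X Y s q _ hs => ?_) hx)
  rw [LinearMap.sub_apply, LinearMap.comp_apply, LinearMap.comp_apply, map_sub,
    F.corestrict_barD_tensor s (le_trans (by exact_mod_cast hs) hm), sub_self]

/-- An `A∞`-quasi-isomorphism restricts to `A_n`-quasi-isomorphisms: its components in weights
`> n` are set to zero. -/
lemma IsQuasiIso.exists_truncation [Algebra ℚ R] {F : AnFunctor ⊤ A D} (hq : F.IsQuasiIso) {n : ℕ}
    (hn : 1 ≤ n) : ∃ G : AnFunctor n A D, G.IsQuasiIso := by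
  let Φ : Components A.toGradedQuiver D.toGradedQuiver F.obj :=
    { F := fun s => if s.length ≤ n then F.components.F s else 0
      multilinear := fun X Y => Str.IsMultilinear.of_length
        (φ := fun m s => if m ≤ n then F.components.F s else 0) fun m => by
          split_ifs
          · exact F.components.multilinear X Y
          · exact Str.IsMultilinear.zero
      map_nil := fun X => by simp [F.components.map_nil] }
  have hF {X Y : A.Ob} (s : Str A.toGradedQuiver X Y) :
      Φ.F s = if s.length ≤ n then F.components.F s else 0 := rfl
  have hΦ : Φ.IsHomogeneous := fun s q hs => by
    rw [hF]
    split_ifs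
    · exact F.isHomogeneous_components s q hs
    · exact zero_mem _
  have ht {X Y : A.Ob} {x : A.TBar X Y} (hx : x ∈ A.weightLE n X Y) :
      Φ.tensor X Y x = F.components.tensor X Y x := by
    refine sub_eq_zero.1 (eq_zero_of_mem_weightLE (l := Φ.tensor X Y - F.components.tensor X Y)
      (fun s _ _ hs => sub_eq_zero.2 ?_) hx)
    exact Components.tensor_congr (fun X Y s hs => if_pos hs) s hs
  let G : AnFunctor n A D := AInfCategory.functorOf Φ hΦ
    (fun X Y s hs => if_neg (not_le.2 (by exact_mod_cast hs)))
    (fun X Y s hs => by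
      have hx : tprod s ∈ A.weightLE n _ _ := tprod_mem_weightLE (by exact_mod_cast hs)
      rw [ht hx, ht (coDer_preserves_weight A.barD_mem_coDer hx),
        F.corestrict_barD_tensor s le_top])
  have hG (X Y : A.Ob) (f : A.Mor X Y) : F.F (Str.single f) = G.F (Str.single f) := by
    rw [← components_single, ← components_single]
    change _ = Φ.F (Str.single f).desuspend.desuspend
    rw [Str.desuspend_desuspend]
    exact (if_pos hn).symm
  refine ⟨G, hq.1, fun X Y => ⟨fun f hf ⟨g, hg⟩ => (hq.2 X Y).1 f hf ⟨g, ?_⟩, fun g hg => ?_⟩⟩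
  · exact hg.trans (hG X Y f).symm
  · obtain ⟨f, hf, h, hh⟩ := (hq.2 X Y).2 g hg
    exact ⟨f, hf, h, hh.trans (congrArg (· - g) (hG X Y f))⟩

end AnFunctor

namespace GradedQuiver

open TBar

variable {R : Type u} [CommRing R] {Q Q' : GradedQuiver.{u, v, w} R}

/-! ### Linearization of lifts of the Euler coderivation -/

namespace Str

/-- The image of a string under a morphism of graded quivers. -/
def push {o : Q.Ob → Q'.Ob} (P : ∀ X Y : Q.Ob, Q.Mor X Y →ₗ[R] Q'.Mor (o X) (o Y)) {X : Q.Ob} :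
    {Y : Q.Ob} → Str Q X Y → Str Q' (o X) (o Y)
  | _, nil => nil
  | _, cons f t => cons (P _ _ f) (push P t)

lemma sum₂_of_left_nonempty {M : Type*} [AddCommMonoid M] {X Z : Q.Ob} (s : Str Q X Z)
    {g : ∀ Y : Q.Ob, Str Q Y Z → Str Q X Y → M} (h : ∀ Y a b, a.length ≠ 0 → g Y a b = 0) :
    s.sum₂ g = g Z nil s := by
  cases s with
  | nil => rw [sum₂_nil]
  | cons f t =>
    rw [sum₂_cons, sum₂_congr t fun Y a b _ => h Y (cons f a) b (by simp), sum₂_zero, add_zero]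

end Str

lemma corestrict_euler {X Y : Q.Ob} (x : Q.TBar X Y) :
    corestrict X Y (Q.euler X Y x) = Q.degMap X Y (corestrict X Y x) :=
  LinearMap.congr_fun (f := corestrict X Y ∘ₗ Q.euler X Y) (g := Q.degMap X Y ∘ₗ corestrict X Y)
    (hom_ext fun s => by
      rw [LinearMap.comp_apply, LinearMap.comp_apply, corestrict_tprod]
      exact corestrict_coderOf _ _ _ _ s) x

namespace Components

/-- The components of the strict morphism induced by a morphism of graded quivers. -/
def strict {o : Q.Ob → Q'.Ob} (P : ∀ X Y : Q.Ob, Q.Mor X Y →ₗ[R] Q'.Mor (o X) (o Y)) :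
    Components Q Q' o where
  F s := P _ _ s.entry
  multilinear X Y := (Str.isMultilinear_entry X Y).linear_comp (P X Y)
  map_nil X := by rw [Str.entry_nil, map_zero]

lemma strict_F {o : Q.Ob → Q'.Ob} (P : ∀ X Y : Q.Ob, Q.Mor X Y →ₗ[R] Q'.Mor (o X) (o Y))
    {X Y : Q.Ob} (s : Str Q X Y) : (strict P).F s = P _ _ s.entry := rfl

lemma tensor_strict {o : Q.Ob → Q'.Ob} (P : ∀ X Y : Q.Ob, Q.Mor X Y →ₗ[R] Q'.Mor (o X) (o Y))
    {X Y : Q.Ob} (s : Str Q X Y) : (strict P).tensor X Y (tprod s) = tprod (s.push P) := by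
  induction s with
  | nil => rw [tprod_nil, map_zero, Str.push, tprod_nil]
  | cons f t ih =>
    rw [tensor_tprod, Str.sum₂_cons, Str.sum₂_of_left_nonempty, ih, (strict P).map_nil, strict_F,
      strict_F, Str.push, map_zero, map_zero, LinearMap.zero_apply, zero_add]
    · cases t with
      | nil =>
        rw [Str.push, tprod_nil, map_zero, add_zero]
        rfl
      | cons g u =>
        rw [Str.entry_of_length_ne_one _ (by simp), map_zero, map_zero, zero_add]
        exact mul_incl_tprod _ (by simp [Str.push])
    · intro Z a b ha
      rw [strict_F, Str.entry_of_length_ne_one _ (by simpa using ha)]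
      simp

variable (Q) in
/-- The components of the identity. -/
abbrev id : Components Q Q fun X => X := strict fun _ _ => LinearMap.id

lemma id_isHomogeneous : (id Q).IsHomogeneous := fun s q hs => by
  have h := corestrict_mem_gr (tprod_mem_tensorDeg hs)
  rw [corestrict_tprod, sub_add_eq_add_sub] at h
  exact h

lemma tensor_id {X Y : Q.Ob} (s : Str Q X Y) : (id Q).tensor X Y (tprod s) = tprod s := by
  refine (tensor_strict _ s).trans (congrArg _ ?_)
  induction s with
  | nil => rfl
  | cons f t ih => rw [Str.push, ih, LinearMap.id_apply]

variable [Algebra ℚ R]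

/-- One step of the recursion `(n - 1) Fₙ = -∑ τᵣ (F ⊗ ⋯ ⊗ F)` for the components of the
morphism that conjugates the Euler coderivation `E` into `E - τ`. -/
def conjStep (τ : Q.TEnd) (Φ : Components Q Q fun X => X) : Components Q Q fun X => X where
  F s := s.entry - algebraMap ℚ R ((s.length : ℚ) - 1)⁻¹ •
    corestrict _ _ (τ _ _ (Φ.tensor _ _ (tprod s)))
  multilinear X Y := (Str.isMultilinear_entry X Y).sub <|
    (isMultilinear_comp (corestrict X Y ∘ₗ τ X Y ∘ₗ Φ.tensor X Y)).length_smul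
      fun n => algebraMap ℚ R ((n : ℚ) - 1)⁻¹
  map_nil X := by simp [tprod_nil]

lemma conjStep_F (τ : Q.TEnd) (Φ : Components Q Q fun X => X) {X Y : Q.Ob} (s : Str Q X Y) :
    (conjStep τ Φ).F s = s.entry - algebraMap ℚ R ((s.length : ℚ) - 1)⁻¹ •
      corestrict _ _ (τ _ _ (Φ.tensor _ _ (tprod s))) := rfl

/-- The recursion has a solution. -/
lemma exists_conj {τ : Q.TEnd} (hτ : τ ∈ Q.coDer 0) (hτ' : τ ∈ Q.weightFil 2) :
    ∃ Φ : Components Q Q fun X => X, Φ.IsHomogeneous ∧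
      ∀ (X Y : Q.Ob) (s : Str Q X Y), Φ.F s = (conjStep τ Φ).F s := by
  let Ψ (n : ℕ) : Components Q Q fun X => X := Nat.rec (id Q) (fun _ => conjStep τ) n
  have hΨ (n : ℕ) : (Ψ n).IsHomogeneous := by
    induction n with
    | zero => exact id_isHomogeneous
    | succ n ih =>
      intro X Y s q hs
      refine sub_mem (id_isHomogeneous s q hs) (Submodule.smul_mem _ _ ?_)
      convert corestrict_mem_gr ((mem_coDer_iff.1 hτ).1 _ _ _ _
        (ih.tensor_mem_tensorDeg (tprod_mem_tensorDeg hs))) using 2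
      ring
  have hsucc (n : ℕ) {X Y : Q.Ob} (s : Str Q X Y) (hs : s.length ≤ n + 1) :
      (Ψ (n + 1)).F s = (Ψ n).F s := by
    induction n generalizing X Y with
    | zero =>
      change s.entry - _ = s.entry
      rw [sub_eq_self]
      rcases Nat.lt_or_ge s.length 1 with h | h
      · rw [tprod_of_length_eq_zero s (by omega)]
        simp
      · rw [le_antisymm hs h]
        simp
    | succ n ih =>
      change s.entry - _ • _ = s.entry - _ • _
      congr 3
      rw [← sub_eq_zero, ← map_sub]
      rcases Nat.lt_or_ge (n + 1) s.length with h | h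
      · exact hτ' _ _ _ (tensor_sub_mem (n := n + 1) (fun X Y s hs => ih s hs) s (by omega))
      · rw [tensor_congr (n := n + 1) (fun X Y s hs => ih s hs) s h, sub_self, map_zero]
  have hstable (m n : ℕ) (hmn : m ≤ n) {X Y : Q.Ob} (s : Str Q X Y) (hs : s.length ≤ m) :
      (Ψ n).F s = (Ψ m).F s := by
    induction n, hmn using Nat.le_induction with
    | base => rfl
    | succ n hmn ih => rw [hsucc n s (by omega), ih]
  let Φ : Components Q Q fun X => X :=
    { F := fun s => (Ψ s.length).F s
      multilinear := fun X Y =>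
        Str.IsMultilinear.of_length (φ := fun n s => (Ψ n).F s) fun n => (Ψ n).multilinear X Y
      map_nil := fun X => (Ψ 0).map_nil X }
  refine ⟨Φ, fun s q hs => hΨ s.length s q hs, fun X Y s => ?_⟩
  change (Ψ s.length).F s = _
  rw [← hsucc s.length s (by omega)]
  change s.entry - _ • _ = s.entry - _ • _
  congr 4
  exact tensor_congr (n := s.length) (fun X Y t ht => hstable _ _ ht t le_rfl) s le_rfl

/-- The solution of the recursion conjugates the Euler coderivation `E` into `E - τ`. -/
lemma tensor_euler {τ : Q.TEnd} (hτ : τ ∈ Q.coDer 0) (hτ' : τ ∈ Q.weightFil 2)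
    {Φ : Components Q Q fun X => X} (hΦ : Φ.IsHomogeneous)
    (h : ∀ (X Y : Q.Ob) (s : Str Q X Y), Φ.F s = (conjStep τ Φ).F s) {X Y : Q.Ob}
    (x : Q.TBar X Y) :
    Φ.tensor X Y (Q.euler X Y x) = Q.euler X Y (Φ.tensor X Y x) - τ X Y (Φ.tensor X Y x) := by
  obtain ⟨n, hx⟩ := exists_mem_weightLE x
  have hK := (hΦ.isCoderAlong_tensor_comp euler_mem_coDer).sub
    (isCoderAlong_comp_tensor Φ (sub_mem euler_mem_coDer hτ))
  refine sub_eq_zero.1 (hK.eq_zero_of_corestrict (n := n) (fun X Y s q hs _ => ?_) hx)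
  simp only [LinearMap.sub_apply, LinearMap.comp_apply, Pi.sub_apply]
  rw [euler_tprod hs, map_zsmul, map_sub, map_sub, map_zsmul, corestrict_euler,
    Φ.corestrict_tensor s, degMap_of_mem (hΦ s q hs), sub_sub_eq_add_sub, add_sub_right_comm,
    ← sub_smul]
  rcases Nat.lt_or_ge 1 s.length with hl | hl
  · have h1 := h X Y s
    rw [conjStep_F, Str.entry_of_length_ne_one s (by omega), zero_sub] at h1
    have hz : (((s.length : ℤ) - 1 : ℤ) : R) * algebraMap ℚ R ((s.length : ℚ) - 1)⁻¹ = 1 := by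
      have hz : (((s.length : ℤ) - 1 : ℤ) : ℚ) = (s.length : ℚ) - 1 := by push_cast; rfl
      rw [← map_intCast (algebraMap ℚ R), ← map_mul, hz, mul_inv_cancel₀, map_one]
      have : (1 : ℚ) < s.length := by exact_mod_cast hl
      linarith
    have e : q - (q + 1 - (s.length : ℤ)) = (s.length : ℤ) - 1 := by ring
    rw [e, ← Int.cast_smul_eq_zsmul R, h1, smul_neg, smul_smul, hz, one_smul, neg_add_cancel]
  · rw [hτ' _ _ _ (Φ.tensor_mem_weightLE (tprod_mem_weightLE hl)), map_zero, add_zero]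
    rcases Nat.lt_or_ge s.length 1 with h' | h'
    · rw [Φ.F_of_length_eq_zero s (by omega), smul_zero]
    · rw [le_antisymm hl h']
      simp

end Components

end GradedQuiver

namespace AInfCategory

open GradedQuiver TBar

variable {R : Type u} [CommRing R] {C : AInfCategory.{u, v, w} R}

/-! ### The cohomology category -/

lemma cohomology_m (hC : C.IsMinimal) {X Y : C.Ob} (s : Str C.toGradedQuiver X Y) :
    (C.cohomology hC).m (X := X) (Y := Y) s = if s.length = 2 then C.m s else 0 := rfl

lemma cohomology_isMinimal (hC : C.IsMinimal) : (C.cohomology hC).IsMinimal := fun X Y f =>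
  (cohomology_m hC (X := X) (Y := Y) (Str.single f)).trans (if_neg (by decide : ¬(1 : ℕ) = 2))

lemma cohomology_d (hC : C.IsMinimal) {X Y : C.Ob} (s : Str C.toGradedQuiver X Y) :
    (C.cohomology hC).d (X := X) (Y := Y) s = if s.length = 2 then C.d s else 0 := by
  change -(if s.desuspend.length = 2 then C.m s.desuspend else 0) = _
  rw [Str.length_desuspend]
  split_ifs
  · rfl
  · exact neg_zero

/-- The codifferential `d₂` of the bar construction of the cohomology category, on the tensor
cocategory of `𝒞[1]`. -/
def barD₂ (hC : C.IsMinimal) : C.TEnd := (C.cohomology hC).barD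

lemma barD₂_mem_coDer (hC : C.IsMinimal) : barD₂ hC ∈ C.coDer 1 :=
  (C.cohomology hC).barD_mem_coDer

lemma corestrict_barD₂ (hC : C.IsMinimal) {X Y : C.Ob} (s : Str C.toGradedQuiver X Y) :
    corestrict X Y (barD₂ hC X Y (tprod s)) = if s.length = 2 then C.d s else 0 :=
  ((C.cohomology hC).corestrict_barD (X := X) (Y := Y) s).trans (cohomology_d hC s)

lemma barD₂_vanish (hC : C.IsMinimal) {X Y : C.Ob} {x : C.TBar X Y}
    (hx : x ∈ C.weightLE 1 X Y) : barD₂ hC X Y x = 0 :=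
  barD_vanish (cohomology_isMinimal hC) (X := X) (Y := Y) hx

/-- If `d = d₂`, then `d` commutes with the Euler coderivation. -/
lemma barD_euler_of_quadratic (hC : C.IsMinimal)
    (h₂ : ∀ {X Y : C.Ob} (s : Str C.toGradedQuiver X Y), s.length ≠ 2 → C.d s = 0) {X Y : C.Ob}
    (x : C.TBar X Y) : C.barD X Y (C.euler X Y x) = C.euler X Y (C.barD X Y x) := by
  have h0 : C.kaledin = 0 := by
    funext X Y
    refine hom_ext fun s => ?_
    rw [kaledin_tprod]
    refine (Str.sum₃_congr s fun Y Y' a b c _ => ?_).trans (Str.sum₃_zero s)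
    rw [(isMultilinear_tprod _ _).map_smul]
    by_cases hb : b.length = 2
    · simp [hb]
    · have := (isMultilinear_tprod _ _).map_smul (a.map (C.signMap (-1) 1)) (0 : R) 0 c
      rw [zero_smul, zero_smul] at this
      rw [h₂ b hb, this, smul_zero]
  have h := congrFun (congrFun (bracket_barD_euler hC) X) Y
  rw [h0] at h
  exact sub_eq_zero.1 (LinearMap.congr_fun h x)

lemma barD₂_euler (hC : C.IsMinimal) {X Y : C.Ob} (x : C.TBar X Y) :
    barD₂ hC X Y (C.euler X Y x) = C.euler X Y (barD₂ hC X Y x) :=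
  barD_euler_of_quadratic (cohomology_isMinimal hC)
    (fun s hs => (cohomology_d hC s).trans (if_neg hs)) (X := X) (Y := Y) x

variable [Algebra ℚ R]

/-! ### Formality from a vanishing Kaledin class -/

/-- If `F` conjugates the Euler coderivation `E` into a lift `E - τ` that commutes with `d`, then
`F` conjugates `d₂` into `d`: the difference `K = d F - F d₂` satisfies `(E - τ) K = K E`, and on
the first weight `n` on which `K` does not vanish, the two sides differ by the factor `n - 2`. -/
lemma barD_tensor_eq (hC : C.IsMinimal) {τ : C.TEnd} (hτ : τ ∈ C.weightCC 2 0)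
    (hk : bracket C.barD τ = C.kaledin)
    {Φ : Components C.toGradedQuiver C.toGradedQuiver fun X => X} (hΦ : Φ.IsHomogeneous)
    (hF : ∀ (X Y : C.Ob) (f : C.Mor X Y), Φ.F (Str.single f) = f)
    (hE : ∀ {X Y : C.Ob} (x : C.TBar X Y), Φ.tensor X Y (C.euler X Y x)
      = C.euler X Y (Φ.tensor X Y x) - τ X Y (Φ.tensor X Y x))
    {X Y : C.Ob} (x : C.TBar X Y) :
    C.barD X Y (Φ.tensor X Y x) = Φ.tensor X Y (barD₂ hC X Y x) := by
  have hK := (Components.isCoderAlong_comp_tensor Φ C.barD_mem_coDer).sub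
    (hΦ.isCoderAlong_tensor_comp (barD₂_mem_coDer hC))
  set K : ∀ X Y : C.Ob, C.TBar X Y →ₗ[R] C.TBar X Y :=
    fun X Y => C.barD X Y ∘ₗ Φ.tensor X Y - Φ.tensor X Y ∘ₗ barD₂ hC X Y with hK_def
  have hKx {X Y : C.Ob} (x : C.TBar X Y) :
      K X Y x = C.barD X Y (Φ.tensor X Y x) - Φ.tensor X Y (barD₂ hC X Y x) := rfl
  have hδ {X Y : C.Ob} (x : C.TBar X Y) :
      C.barD X Y (C.euler X Y x) - C.barD X Y (τ X Y x)
        = C.euler X Y (C.barD X Y x) - τ X Y (C.barD X Y x) := by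
    have h1 := LinearMap.congr_fun (congrFun (congrFun (bracket_barD_euler hC) X) Y) x
    rw [← hk, bracket_apply, bracket_apply] at h1
    rw [sub_eq_sub_iff_sub_eq_sub]
    exact h1
  have hKE {X Y : C.Ob} (x : C.TBar X Y) :
      C.euler X Y (K X Y x) - τ X Y (K X Y x) = K X Y (C.euler X Y x) := by
    rw [hKx, hKx, hE, barD₂_euler, hE, map_sub, map_sub, map_sub, hδ]
    abel
  have key (n : ℕ) : ∀ X Y, ∀ x ∈ C.weightLE n X Y, K X Y x = 0 := by
    induction n with
    | zero =>
      intro X Y x hx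
      rw [weightLE_zero, Submodule.mem_bot] at hx
      rw [hx, map_zero]
    | succ n ih =>
      intro X Y x hx
      refine eq_zero_of_mem_weightLE (fun s q hs hl => ?_) hx
      rcases Nat.lt_or_ge n s.length with h | h
      swap
      · exact ih _ _ _ (tprod_mem_weightLE h)
      have hsn : s.length = n + 1 := by omega
      have h1 := hK.eq_incl ih (tprod_mem_weightLE (s := s) hl)
      by_cases hn : n = 1
      · rw [h1, hKx, map_sub]
        have hd : Φ.tensor X Y (tprod s) - tprod s ∈ C.weightLE 1 X Y := by
          have h2 := Components.tensor_sub_mem_of_linear (Φ := Φ) (Ψ := Components.id _)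
            (fun X Y f => hF X Y f) (n := 1) s (by omega)
          rwa [Components.tensor_id] at h2
        have e1 : C.barD X Y (Φ.tensor X Y (tprod s)) = C.barD X Y (tprod s) := by
          rw [← sub_eq_zero, ← map_sub]
          exact barD_vanish hC hd
        have e2 := (mem_coDer_iff.1 (barD₂_mem_coDer hC)).2.eq_incl (n := 1)
          (fun X Y x hx => barD₂_vanish hC hx) (tprod_mem_weightLE (s := s) (by omega))
        have e3 : corestrict X Y (Φ.tensor X Y (incl X Y (C.d s))) = C.d s :=
          (Φ.corestrict_tensor _).trans (hF X Y _)
        rw [e1, e2, corestrict_barD, corestrict_barD₂, if_pos (by omega), e3, sub_self, map_zero]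
      · have hdeg : K X Y (tprod s) ∈ C.tensorDeg (q - s.length + 1) X Y := by
          have h2 := tprod_mem_tensorDeg hs
          exact sub_mem ((mem_coDer_iff.1 C.barD_mem_coDer).1 _ _ _ _ (hΦ.tensor_mem_tensorDeg h2))
            (hΦ.tensor_mem_tensorDeg ((mem_coDer_iff.1 (barD₂_mem_coDer hC)).1 _ _ _ _ h2))
        have h2 := hKE (tprod s)
        have h3 : τ X Y (K X Y (tprod s)) = 0 := by
          rw [h1]
          exact hτ.2 _ _ _ (incl_mem_weightLE _ le_rfl)
        have h4 : C.euler X Y (K X Y (tprod s)) = (q - s.length + 1 + 1) • K X Y (tprod s) := by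
          rw [h1]
          exact euler_incl (corestrict_mem_gr hdeg)
        rw [h3, sub_zero, euler_tprod hs, map_zsmul, h4, ← sub_eq_zero, ← sub_smul] at h2
        have e : q - (s.length : ℤ) + 1 + 1 - q = 1 - n := by rw [hsn]; push_cast; ring
        rw [e, ← Int.cast_smul_eq_zsmul R] at h2
        have hu : algebraMap ℚ R (1 - n : ℚ)⁻¹ * ((1 - n : ℤ) : R) = 1 := by
          have hz : ((1 - n : ℤ) : ℚ) = 1 - n := by push_cast; rfl
          rw [← map_intCast (algebraMap ℚ R), ← map_mul, hz, inv_mul_cancel₀, map_one]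
          intro h0
          apply hn
          have : (n : ℚ) = 1 := by linarith
          exact_mod_cast this
        rw [← one_smul R (K X Y (tprod s)), ← hu, mul_smul, h2, smul_zero]
  obtain ⟨n, hx⟩ := exists_mem_weightLE x
  exact sub_eq_zero.1 (key n X Y x hx)

theorem isFormal_of_kaledinClassVanishes (hC : C.IsMinimal) (h : C.KaledinClassVanishes) :
    C.IsFormal hC := by
  obtain ⟨τ, hτ, hk⟩ := h
  rw [hochD_zero] at hk
  obtain ⟨Φ, hΦ, hrec⟩ := Components.exists_conj hτ.1 hτ.2
  have hF (X Y : C.Ob) (f : C.Mor X Y) : Φ.F (Str.single f) = f := by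
    rw [hrec, Components.conjStep_F]
    simp [Str.single, Str.entry]
  have hd {X Y : C.Ob} (x : C.TBar X Y) :
      C.barD X Y (Φ.tensor X Y x) = Φ.tensor X Y (barD₂ hC X Y x) :=
    barD_tensor_eq hC hτ hk hΦ hF (Components.tensor_euler hτ.1 hτ.2 hΦ hrec) x
  have hsingle (X Y : C.Ob) (f : C.Mor X Y) : Φ.F (Str.single f).desuspend = f := by
    have : (Str.single f).desuspend = Str.single f := by
      simp [Str.single, Str.desuspend, signMap_zero]
    rw [this, hF]
  have hd' {X Y : C.Ob} (s : Str C.toGradedQuiver X Y) :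
      corestrict X Y (C.barD X Y (Φ.tensor X Y (tprod s)))
        = corestrict X Y (Φ.tensor X Y (barD₂ hC X Y (tprod s))) := congrArg _ (hd _)
  let F : AnFunctor ⊤ (C.cohomology hC) C :=
    functorOf (A := C.cohomology hC) (D := C) (o := fun X => X) Φ hΦ
      (fun X Y s hs => absurd hs not_top_lt) (fun X Y s _ => hd' (X := X) (Y := Y) s)
  refine ⟨F, Function.bijective_id, fun X Y => ⟨fun f _ ⟨g, hg⟩ => ⟨0, ?_⟩, fun g _ =>
    ⟨g, cohomology_isMinimal hC X Y g, 0, ?_⟩⟩⟩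
  · have h1 : f = 0 := (hsingle X Y f).symm.trans (hg.symm.trans (hC _ _ g))
    rw [h1]
    exact cohomology_isMinimal hC X Y 0
  · exact (hC _ _ _).trans (sub_eq_zero.2 (hsingle X Y g)).symm

end AInfCategory

namespace GradedQuiver

open TBar

variable {R : Type u} [CommRing R] {Q Q' : GradedQuiver.{u, v, w} R}

/-! ### Invertibility of morphisms of tensor cocategories -/

variable (Q) in
/-- The projection onto the homogeneous part of degree `p`. -/
def grProj (X Y : Q.Ob) (p : ℤ) : Q.Mor X Y →ₗ[R] Q.Mor X Y :=
  DirectSum.lof R ℤ (fun p => Q.Hom X Y p) p ∘ₗ DirectSum.component R ℤ (fun p => Q.Hom X Y p) p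

lemma grProj_mem {X Y : Q.Ob} (p : ℤ) (f : Q.Mor X Y) : Q.grProj X Y p f ∈ Q.gr X Y p := ⟨_, rfl⟩

lemma grProj_of_mem {X Y : Q.Ob} {p i : ℤ} {f : Q.Mor X Y} (hf : f ∈ Q.gr X Y i) :
    Q.grProj X Y p f = if i = p then f else 0 := by
  obtain ⟨x, rfl⟩ := hf
  split_ifs with h
  · subst h
    rw [grProj, LinearMap.comp_apply, DirectSum.component.lof_self]
  · rw [grProj, LinearMap.comp_apply, DirectSum.component.of, dif_neg h, map_zero]

lemma mem_gr_iff {X Y : Q.Ob} {p : ℤ} {f : Q.Mor X Y} :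
    f ∈ Q.gr X Y p ↔ Q.grProj X Y p f = f :=
  ⟨fun hf => (grProj_of_mem hf).trans (if_pos rfl), fun h => h ▸ grProj_mem p f⟩

namespace Str

lemma HasDeg.eq_zero {X : Q.Ob} {q : ℤ} (hs : (Str.nil : Str Q X X).HasDeg q) : q = 0 := by
  cases hs
  rfl

lemma HasDeg.of_cons {X Y Z : Q.Ob} {f : Q.Mor Y Z} {t : Str Q X Y} {q : ℤ}
    (hs : (Str.cons f t).HasDeg q) : ∃ p r, f ∈ Q.gr Y Z p ∧ t.HasDeg r ∧ p + r = q := by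
  cases hs with
  | cons hf ht => exact ⟨_, _, hf, ht, rfl⟩

end Str

section push

variable {o : Q.Ob → Q'.Ob} {P : ∀ X Y : Q.Ob, Q.Mor X Y →ₗ[R] Q'.Mor (o X) (o Y)}

/-- Injective linear maps that preserve degrees also reflect them. -/
lemma mem_gr_of_injective (hP : ∀ X Y, Function.Injective (P X Y))
    (hd : ∀ X Y p, ∀ f ∈ Q.gr X Y p, P X Y f ∈ Q'.gr (o X) (o Y) p) {X Y : Q.Ob} {p : ℤ}
    {f : Q.Mor X Y} (hf : P X Y f ∈ Q'.gr (o X) (o Y) p) : f ∈ Q.gr X Y p := by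
  have e : P X Y ∘ₗ Q.grProj X Y p = Q'.grProj _ _ p ∘ₗ P X Y := mor_ext fun i f hf => by
    rw [LinearMap.comp_apply, LinearMap.comp_apply, grProj_of_mem hf, grProj_of_mem (hd _ _ _ f hf)]
    split_ifs
    · rfl
    · exact map_zero _
  rw [mem_gr_iff] at hf ⊢
  exact hP X Y ((LinearMap.congr_fun e f).trans hf)

namespace Str

@[simp] lemma length_push {X Y : Q.Ob} (s : Str Q X Y) : (s.push P).length = s.length := by
  induction s with
  | nil => rfl
  | cons f t ih => simp [push, ih]

lemma push_append {X Y Z : Q.Ob} (a : Str Q Y Z) (b : Str Q X Y) :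
    (a.append b).push P = (a.push P).append (b.push P) := by
  induction a with
  | nil => rfl
  | cons f a ih => simp [push, ih]

lemma push_injective (ho : Function.Injective o) (hP : ∀ X Y, Function.Injective (P X Y))
    {X Y : Q.Ob} : Function.Injective (push P : Str Q X Y → _) := by
  intro s
  induction s with
  | nil =>
    intro t h
    cases t with
    | nil => rfl
    | cons g t => simpa [push] using congrArg length h
  | @cons Y Z f s ih =>
    intro t h
    cases t with
    | nil => simpa [push] using congrArg length h
    | @cons Y' _ g t =>
      rw [push, push] at h
      rw [cons.injEq] at h
      obtain ⟨h1, h2, h3⟩ := h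
      obtain rfl := ho h1
      rw [hP _ _ (eq_of_heq h2), ih (eq_of_heq h3)]

lemma push_surjective (ho : Function.Bijective o) (hP : ∀ X Y, Function.Surjective (P X Y))
    {X Y : Q.Ob} : Function.Surjective (push P : Str Q X Y → _) := by
  have key : ∀ {Y' : Q'.Ob} (t : Str Q' (o X) Y') (Y : Q.Ob), o Y = Y' →
      ∃ s : Str Q X Y, HEq (s.push P) t := by
    intro Y' t
    induction t with
    | nil =>
      intro Y hY
      obtain rfl := ho.1 hY
      exact ⟨nil, HEq.rfl⟩
    | @cons V' Z' g t ih =>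
      rintro Y rfl
      obtain ⟨V, rfl⟩ := ho.2 V'
      obtain ⟨s, hs⟩ := ih V rfl
      obtain ⟨f, rfl⟩ := hP V Y g
      exact ⟨cons f s, by rw [push, eq_of_heq hs]⟩
  exact fun t => (key t Y rfl).imp fun s hs => eq_of_heq hs

lemma HasDeg.of_push (hP : ∀ X Y, Function.Injective (P X Y))
    (hd : ∀ X Y p, ∀ f ∈ Q.gr X Y p, P X Y f ∈ Q'.gr (o X) (o Y) p) {X Y : Q.Ob} {s : Str Q X Y}
    {q : ℤ} (hs : (s.push P).HasDeg q) : s.HasDeg q := by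
  induction s generalizing q with
  | nil =>
    obtain rfl := hs.eq_zero
    exact .nil _
  | cons f t ih =>
    obtain ⟨p, r, hf, ht, rfl⟩ := hs.of_cons
    exact .cons (mem_gr_of_injective hP hd hf) (ih ht)

end Str

/-- An isomorphism of graded quivers induces split injections of tensor cocategories. -/
lemma exists_leftInverse_tensor_strict (ho : Function.Bijective o)
    (hP : ∀ X Y, Function.Bijective (P X Y)) (X Y : Q.Ob) :
    ∃ G : Q'.TBar (o X) (o Y) →ₗ[R] Q.TBar X Y, ∀ s : Str Q X Y,
      G (tprod (s.push P)) = tprod s := by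
  have hi : ∀ X Y, Function.Injective (P X Y) := fun X Y => (hP X Y).1
  have hs : ∀ X Y, Function.Surjective (P X Y) := fun X Y => (hP X Y).2
  let inv : Str Q' (o X) (o Y) → Str Q X Y := Function.surjInv (Str.push_surjective ho hs)
  have hinv (s : Str Q X Y) : inv (s.push P) = s :=
    Str.push_injective ho.1 hi (Function.surjInv_eq _ _)
  have hm : Str.IsMultilinear fun t : Str Q' (o X) (o Y) => (tprod (inv t) : Q.TBar X Y) := by
    constructor
    · intro Z' W' a f g b
      obtain ⟨Z, rfl⟩ := ho.2 Z'
      obtain ⟨W, rfl⟩ := ho.2 W'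
      obtain ⟨a, rfl⟩ := Str.push_surjective ho hs a
      obtain ⟨b, rfl⟩ := Str.push_surjective ho hs b
      obtain ⟨f, rfl⟩ := hs _ _ f
      obtain ⟨g, rfl⟩ := hs _ _ g
      have e (k : Q.Mor Z W) : inv ((a.push P).append (Str.cons (P _ _ k) (b.push P)))
          = a.append (Str.cons k b) := by
        rw [← hinv (a.append (Str.cons k b)), Str.push_append, Str.push]
      rw [← map_add, e, e, e]
      exact (isMultilinear_tprod X Y).map_add a f g b
    · intro Z' W' a r f b
      obtain ⟨Z, rfl⟩ := ho.2 Z'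
      obtain ⟨W, rfl⟩ := ho.2 W'
      obtain ⟨a, rfl⟩ := Str.push_surjective ho hs a
      obtain ⟨b, rfl⟩ := Str.push_surjective ho hs b
      obtain ⟨f, rfl⟩ := hs _ _ f
      have e (k : Q.Mor Z W) : inv ((a.push P).append (Str.cons (P _ _ k) (b.push P)))
          = a.append (Str.cons k b) := by
        rw [← hinv (a.append (Str.cons k b)), Str.push_append, Str.push]
      rw [← map_smul, e, e]
      exact (isMultilinear_tprod X Y).map_smul a r f b
  have h0 (t : Str Q' (o X) (o Y)) (ht : t.length = 0) : (tprod (inv t) : Q.TBar X Y) = 0 := by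
    obtain ⟨s, rfl⟩ := Str.push_surjective ho hs t
    rw [hinv]
    exact tprod_of_length_eq_zero s (by simpa using ht)
  exact ⟨lift _ hm h0, fun s => by rw [lift_tprod, hinv]⟩

end push

/-- The part of weight at most `n` of a homogeneous tensor is homogeneous. -/
lemma weightLE_inf_tensorDeg_le {n : ℕ} {q : ℤ} {X Y : Q.Ob} {S : Submodule R (Q.TBar X Y)}
    (h : ∀ (s : Str Q X Y) (p : ℤ), s.HasDeg p → p - s.length = q → s.length ≤ n → tprod s ∈ S) :
    Q.weightLE n X Y ⊓ Q.tensorDeg q X Y ≤ S := by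
  rintro x ⟨hx, hx'⟩
  let pr : Q.TBar X Y →ₗ[R] Q.TBar X Y := ofWeights fun m => if m ≤ n then LinearMap.id else 0
  have h1 : pr x - (LinearMap.id : Q.TBar X Y →ₗ[R] Q.TBar X Y) x = 0 := by
    refine eq_zero_of_mem_weightLE (l := pr - LinearMap.id) (fun s _ _ hs => ?_) hx
    rw [LinearMap.sub_apply, ofWeights_tprod, if_pos hs, sub_self]
  have h2 : pr x ∈ S := by
    refine (tensorDeg_le (S := S.comap pr) fun s p hs hp => ?_) hx'
    rw [Submodule.mem_comap, ofWeights_tprod]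
    split_ifs with hn
    · exact h s p hs hp hn
    · exact zero_mem S
  rw [← LinearMap.id_apply (R := R) x, ← sub_eq_zero.1 h1]
  exact h2

lemma incl_corestrict_of_mem {X Y : Q.Ob} {x : Q.TBar X Y} (hx : x ∈ Q.weightLE 1 X Y) :
    incl X Y (corestrict X Y x) = x := by
  refine sub_eq_zero.1 (eq_zero_of_mem_weightLE (l := incl X Y ∘ₗ corestrict X Y - LinearMap.id)
    (fun s _ _ hs => ?_) hx)
  rw [LinearMap.sub_apply, LinearMap.comp_apply, corestrict_tprod, LinearMap.id_apply, sub_eq_zero]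
  rcases Nat.lt_or_ge s.length 1 with h | h
  · rw [tprod_of_length_eq_zero s (by omega), Str.entry_of_length_ne_one s (by omega), map_zero]
  · obtain ⟨f, rfl⟩ := s.exists_eq_single (le_antisymm hs h)
    rfl

lemma euler_of_mem_weightLE_one {X Y : Q.Ob} {q : ℤ} {x : Q.TBar X Y}
    (hx : x ∈ Q.weightLE 1 X Y) (hx' : x ∈ Q.tensorDeg q X Y) :
    Q.euler X Y x = (q + 1) • x := by
  rw [← incl_corestrict_of_mem hx]
  exact euler_incl (corestrict_mem_gr hx')

namespace Components

variable {o : Q.Ob → Q'.Ob} (Φ : Components Q Q' o)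

/-- The linear component of a morphism of tensor cocategories. -/
def linear (X Y : Q.Ob) : Q.Mor X Y →ₗ[R] Q'.Mor (o X) (o Y) :=
  corestrict _ _ ∘ₗ Φ.tensor X Y ∘ₗ incl X Y

lemma linear_apply {X Y : Q.Ob} (f : Q.Mor X Y) : Φ.linear X Y f = Φ.F (Str.single f) :=
  Φ.corestrict_tensor _

lemma tensor_sub_push_mem {n : ℕ} {X Y : Q.Ob} (s : Str Q X Y) (hs : s.length ≤ n + 1) :
    Φ.tensor X Y (tprod s) - tprod (s.push Φ.linear) ∈ Q'.weightLE n (o X) (o Y) := by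
  rw [← tensor_strict]
  exact tensor_sub_mem_of_linear (fun X Y f => (Φ.linear_apply f).symm) s hs

lemma IsHomogeneous.linear_mem {Φ : Components Q Q' o} (hΦ : Φ.IsHomogeneous) (X Y : Q.Ob) (p : ℤ)
    (f : Q.Mor X Y) (hf : f ∈ Q.gr X Y p) : Φ.linear X Y f ∈ Q'.gr (o X) (o Y) p := by
  rw [linear_apply]
  have := hΦ _ _ (.cons hf (.nil X))
  rwa [Str.length_cons, Str.length_nil, add_zero, zero_add, Nat.cast_one, add_sub_cancel_right]
    at this

variable {Φ}

lemma tensor_injective (ho : Function.Bijective o)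
    (hP : ∀ X Y, Function.Bijective (Φ.linear X Y))
    (X Y : Q.Ob) : Function.Injective (Φ.tensor X Y) := by
  obtain ⟨G, hG⟩ := exists_leftInverse_tensor_strict ho hP X Y
  have hGw {n : ℕ} {y : Q'.TBar (o X) (o Y)} (hy : y ∈ Q'.weightLE n _ _) :
      G y ∈ Q.weightLE n X Y := by
    refine (weightLE_le (S := (Q.weightLE n X Y).comap G) fun t _ _ ht => ?_) hy
    obtain ⟨s, rfl⟩ := Str.push_surjective ho (fun X Y => (hP X Y).2) t
    rw [Submodule.mem_comap, hG]
    exact tprod_mem_weightLE (by simpa using ht)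
  rw [← LinearMap.ker_eq_bot, LinearMap.ker_eq_bot']
  intro x hx
  obtain ⟨n, hn⟩ := exists_mem_weightLE x
  induction n with
  | zero => rwa [weightLE_zero, Submodule.mem_bot] at hn
  | succ n ih =>
    refine ih ?_
    have h1 : G (Φ.tensor X Y x) - x ∈ Q.weightLE n X Y := by
      refine (weightLE_le (S := (Q.weightLE n X Y).comap (G ∘ₗ Φ.tensor X Y - LinearMap.id))
        fun s _ _ hs => ?_) hn
      rw [Submodule.mem_comap, LinearMap.sub_apply, LinearMap.comp_apply, LinearMap.id_apply,
        ← hG s, ← map_sub, hG]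
      exact hGw (Φ.tensor_sub_push_mem s hs)
    rw [hx, map_zero, zero_sub] at h1
    exact neg_mem_iff.1 h1

/-- Morphisms of tensor cocategories with invertible linear component are surjective, compatibly
with weights and degrees. -/
lemma exists_tensor_eq (ho : Function.Bijective o)
    (hP : ∀ X Y, Function.Bijective (Φ.linear X Y))
    (hΦ : Φ.IsHomogeneous) {n : ℕ} {q : ℤ} {X Y : Q.Ob}
    {y : Q'.TBar (o X) (o Y)} (hy : y ∈ Q'.weightLE n _ _) (hy' : y ∈ Q'.tensorDeg q _ _) :
    ∃ x ∈ Q.weightLE n X Y ⊓ Q.tensorDeg q X Y, Φ.tensor X Y x = y := by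
  induction n generalizing y with
  | zero =>
    rw [weightLE_zero, Submodule.mem_bot] at hy
    exact ⟨0, zero_mem _, by rw [hy, map_zero]⟩
  | succ n ih =>
    refine (weightLE_inf_tensorDeg_le (n := n + 1)
      (S := (Q.weightLE (n + 1) X Y ⊓ Q.tensorDeg q X Y).map (Φ.tensor X Y))
      fun t p ht hp hl => ?_) ⟨hy, hy'⟩
    obtain ⟨s, rfl⟩ := Str.push_surjective ho (fun X Y => (hP X Y).2) t
    have hs := ht.of_push (fun X Y => (hP X Y).1) hΦ.linear_mem
    rw [Str.length_push] at hp hl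
    have h1 : tprod s ∈ Q.weightLE (n + 1) X Y ⊓ Q.tensorDeg q X Y :=
      ⟨tprod_mem_weightLE hl, hp ▸ tprod_mem_tensorDeg hs⟩
    have h2 : tprod (s.push Φ.linear) ∈ Q'.tensorDeg q (o X) (o Y) := by
      have := tprod_mem_tensorDeg ht
      rwa [Str.length_push, hp] at this
    obtain ⟨x, hx, hxy⟩ := ih (Φ.tensor_sub_push_mem s hl)
      (sub_mem (hΦ.tensor_mem_tensorDeg h1.2) h2)
    refine ⟨tprod s - x, sub_mem h1 ⟨weightLE_mono (by omega) _ _ hx.1, hx.2⟩, ?_⟩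
    rw [map_sub, hxy, sub_sub_cancel]

lemma exists_tensor_eq_of_weightLE (ho : Function.Bijective o)
    (hP : ∀ X Y, Function.Bijective (Φ.linear X Y))
    (hΦ : Φ.IsHomogeneous) {n : ℕ} {X Y : Q.Ob}
    {y : Q'.TBar (o X) (o Y)} (hy : y ∈ Q'.weightLE n _ _) :
    ∃ x ∈ Q.weightLE n X Y, Φ.tensor X Y x = y := by
  refine (weightLE_le (S := (Q.weightLE n X Y).map (Φ.tensor X Y)) fun t p ht hl => ?_) hy
  obtain ⟨x, hx, hxy⟩ := exists_tensor_eq ho hP hΦ (tprod_mem_weightLE hl) (tprod_mem_tensorDeg ht)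
  exact ⟨x, hx.1, hxy⟩

/-- The Euler coderivation may be transported along an invertible morphism of tensor
cocategories. -/
lemma exists_transport_euler (ho : Function.Bijective o)
    (hP : ∀ X Y, Function.Bijective (Φ.linear X Y))
    (hΦ : Φ.IsHomogeneous) :
    ∃ δ ∈ Q'.coDer 0, (∀ (X Y : Q.Ob) (x : Q.TBar X Y),
        δ (o X) (o Y) (Φ.tensor X Y x) = Φ.tensor X Y (Q.euler X Y x)) ∧
      Q'.euler - δ ∈ Q'.weightFil 2 := by
  have hsurj (X Y : Q.Ob) : Function.Surjective (Φ.tensor X Y) := fun y => by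
    obtain ⟨n, hn⟩ := exists_mem_weightLE y
    exact (exists_tensor_eq_of_weightLE ho hP hΦ hn).imp fun x hx => hx.2
  have key (X' Y' : Q'.Ob) : ∃ D : Q'.TBar X' Y' →ₗ[R] Q'.TBar X' Y',
      ∀ X Y, o X = X' → o Y = Y' → ∀ (x : Q.TBar X Y) (y z : Q'.TBar X' Y'),
        HEq y (Φ.tensor X Y x) → HEq z (Φ.tensor X Y (Q.euler X Y x)) → D y = z := by
    obtain ⟨X, rfl⟩ := ho.2 X'
    obtain ⟨Y, rfl⟩ := ho.2 Y'
    let e := LinearEquiv.ofBijective (Φ.tensor X Y) ⟨tensor_injective ho hP X Y, hsurj X Y⟩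
    refine ⟨Φ.tensor X Y ∘ₗ Q.euler X Y ∘ₗ e.symm.toLinearMap, fun X₁ Y₁ hX hY x y z hy hz => ?_⟩
    obtain rfl := ho.1 hX
    obtain rfl := ho.1 hY
    rw [eq_of_heq hy, eq_of_heq hz, LinearMap.comp_apply, LinearMap.comp_apply]
    congr 2
    exact e.symm_apply_apply x
  choose δ hδ' using key
  have hδ (X Y : Q.Ob) (x : Q.TBar X Y) :
      δ (o X) (o Y) (Φ.tensor X Y x) = Φ.tensor X Y (Q.euler X Y x) :=
    hδ' _ _ X Y rfl rfl x _ _ HEq.rfl HEq.rfl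
  have hE := mem_coDer_iff.1 (euler_mem_coDer (Q := Q))
  refine ⟨δ, mem_coDer_iff.2 ⟨fun q X' Y' y hy => ?_, fun X' Y' y => ?_⟩, hδ, fun X' Y' y hy => ?_⟩
  · obtain ⟨X, rfl⟩ := ho.2 X'
    obtain ⟨Y, rfl⟩ := ho.2 Y'
    obtain ⟨n, hn⟩ := exists_mem_weightLE y
    obtain ⟨x, hx, rfl⟩ := exists_tensor_eq ho hP hΦ hn hy
    rw [hδ]
    exact hΦ.tensor_mem_tensorDeg (hE.1 _ _ _ _ hx.2)
  · obtain ⟨X, rfl⟩ := ho.2 X'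
    obtain ⟨Y, rfl⟩ := ho.2 Y'
    obtain ⟨x, rfl⟩ := hsurj X Y y
    have h0 : Q.tensorSign 0 = fun X Y => LinearMap.id := by
      funext X Y; exact tensorSign_zero X Y
    have h0' : Q'.tensorSign 0 = fun X Y => LinearMap.id := by
      funext X Y; exact tensorSign_zero X Y
    have hc (X Y : Q.Ob) : δ (o X) (o Y) ∘ₗ Φ.tensor X Y = Φ.tensor X Y ∘ₗ Q.euler X Y :=
      LinearMap.ext (hδ X Y)
    rw [hδ, comul_tensor, comul_tensor, hE.2 X Y x, map_add, map₂_map₂, map₂_map₂, map₂_map₂,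
      map₂_map₂, h0, h0']
    simp only [hc, LinearMap.comp_id, LinearMap.id_comp]
  · obtain ⟨X, rfl⟩ := ho.2 X'
    obtain ⟨Y, rfl⟩ := ho.2 Y'
    refine eq_zero_of_mem_weightLE (fun t p ht hl => ?_) hy
    have h1 := tprod_mem_tensorDeg ht
    obtain ⟨x, hx, hxt⟩ := exists_tensor_eq ho hP hΦ (tprod_mem_weightLE hl) h1
    rw [Pi.sub_apply, Pi.sub_apply, LinearMap.sub_apply,
      euler_of_mem_weightLE_one (tprod_mem_weightLE hl) h1, ← hxt, hδ,
      euler_of_mem_weightLE_one hx.1 hx.2, map_zsmul, sub_self]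

end Components

end GradedQuiver

namespace AInfCategory

open GradedQuiver TBar

variable {R : Type u} [CommRing R]

/-! ### Truncated Kaledin classes of formal categories -/

/-- A quasi-isomorphism between minimal `A∞`-categories has an invertible linear component. -/
lemma bijective_linear {A D : AInfCategory.{u, v, w} R} (hA : A.IsMinimal) (hD : D.IsMinimal)
    {n : ℕ∞} {F : AnFunctor n A D} (hF : F.IsQuasiIso) (X Y : A.Ob) :
    Function.Bijective (F.components.linear X Y) := by
  have e (f : A.Mor X Y) : F.components.linear X Y f = F.F (Str.single f) :=
    (F.components.linear_apply f).trans (F.components_single f)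
  refine ⟨?_, fun g => ?_⟩
  · rw [← LinearMap.ker_eq_bot, LinearMap.ker_eq_bot']
    intro f hf
    obtain ⟨g, hg⟩ := (hF.2 X Y).1 f (hA X Y f) ⟨0, by rw [hD, ← e, hf]⟩
    rw [← hg, hA]
  · obtain ⟨f, -, h, hh⟩ := (hF.2 X Y).2 g (hD _ _ g)
    rw [hD] at hh
    exact ⟨f, (e f).trans (sub_eq_zero.1 hh.symm)⟩

variable [Algebra ℚ R] {C : AInfCategory.{u, v, w} R}

/-- Transport of the Euler coderivation along an `A_n`-quasi-isomorphism from a minimal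
`A∞`-category whose codifferential commutes with the Euler coderivation. -/
lemma exists_lift_euler {A D : AInfCategory.{u, v, w} R} (hA : A.IsMinimal) (hD : D.IsMinimal)
    (hE : ∀ (X Y : A.Ob) (x : A.TBar X Y), A.barD X Y (A.euler X Y x) = A.euler X Y (A.barD X Y x))
    {n : ℕ} {F : AnFunctor n A D} (hF : F.IsQuasiIso) :
    ∃ δ ∈ D.coDer 0, D.euler - δ ∈ D.weightFil 2 ∧
      ∀ X Y, ∀ y ∈ D.weightLE n X Y, bracket D.barD δ X Y y = 0 := by
  have hl := bijective_linear hA hD hF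
  have hΦ : F.components.IsHomogeneous := F.isHomogeneous_components
  obtain ⟨δ, hδ, hδE, hδ2⟩ := Components.exists_transport_euler hF.1 hl hΦ
  refine ⟨δ, hδ, hδ2, fun X' Y' y hy => ?_⟩
  obtain ⟨X, rfl⟩ := hF.1.2 X'
  obtain ⟨Y, rfl⟩ := hF.1.2 Y'
  obtain ⟨x, hx, rfl⟩ := Components.exists_tensor_eq_of_weightLE hF.1 hl hΦ hy
  rw [bracket_apply, hδE, F.barD_tensor le_rfl hx,
    F.barD_tensor le_rfl (coDer_preserves_weight euler_mem_coDer hx), hδE, hE, sub_self]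

theorem truncatedKaledinClassVanishes_of_isAnFormal (hC : C.IsMinimal) (n : ℕ)
    (h : C.IsAnFormal hC n) : C.TruncatedKaledinClassVanishes n := by
  obtain ⟨F, hF⟩ := h
  obtain ⟨δ, hδ, hδ2, hδd⟩ := exists_lift_euler (cohomology_isMinimal hC) hC
    (fun X Y x => barD₂_euler hC (X := X) (Y := Y) x) hF
  refine ⟨C.euler - δ, ⟨sub_mem euler_mem_coDer hδ, hδ2⟩, ?_⟩
  have e : C.hochD 0 (C.euler - δ) - C.kaledin = -bracket C.barD δ := by
    rw [hochD_zero, bracket_sub_right, bracket_barD_euler hC]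
    abel
  rw [e]
  exact neg_mem ⟨bracket_mem_coDer C.barD_mem_coDer hδ, hδd⟩

theorem isAnFormal_of_isFormal (hC : C.IsMinimal) (h : C.IsFormal hC) (n : ℕ) (hn : 1 ≤ n) :
    C.IsAnFormal hC n := by
  obtain ⟨F, hF⟩ := h
  exact AnFunctor.IsQuasiIso.exists_truncation hF hn

end AInfCategory

end

theorem mainTheorem7 {R : Type u} [CommRing R] [Algebra ℚ R] (C : AInfCategory.{u, v, w} R)
    (hC : C.IsMinimal) :
    List.TFAE [
      C.IsFormal hC,
      ∀ n : ℕ, 1 ≤ n → C.IsAnFormal hC n,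
      ∀ n : ℕ, 3 ≤ n → C.TruncatedKaledinClassVanishes n,
      C.KaledinClassVanishes] := by
  tfae_have 1 → 2 := fun h n hn => AInfCategory.isAnFormal_of_isFormal hC h n hn
  tfae_have 2 → 3 := fun h n hn =>
    AInfCategory.truncatedKaledinClassVanishes_of_isAnFormal hC n (h n (by omega))
  tfae_have 3 → 4 := fun h => AInfCategory.kaledinClassVanishes_of_truncated hC h
  tfae_have 4 → 1 := fun h => AInfCategory.isFormal_of_kaledinClassVanishes hC h
  tfae_finish
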